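/- **Setting.** A database consists of finitely many relations, each a finite set of tuples of fixed arity over a countable domain; some relations are *static* (never change), the others are *dynamic* (subject to single-tuple inserts and deletes). Its size $N$ is the total number of tuples. A conjunctive query has the form $Q(\mathbf X)=R_1(\mathbf X_1),\dots,R_k(\mathbf X_k)$, where $\mathbf X,\mathbf X_1,\dots,\mathbf X_k$ are tuples of distinct variables (relation symbols may repeat) and each *free* variable, i.e. each variable of the head $\mathbf X$, occurs in some body atom $R_i(\mathbf X_i)$. Two body atoms are in the same connected component of $Q$ if they are linked by a chain of body atoms in which consecutive atoms share a variable. A *view tree* for $Q$ is a rooted tree of views whose leaves are body atoms of $Q$ and whose inner nodes are *projection views* $V(\mathbf Y)$, with a single child $V'(\mathbf Y')$, $\mathbf Y\subseteq\mathbf Y'$, defined as the projection of $V'$ onto $\mathbf Y$, or *join views*, defined as the natural join of their (one or more) children, with the union of the children's variables as free variables. A view is *dynamic* if some atom in its subtree is over a dynamic relation. A *safe rewriting* of $Q$ is a finite set $\mathcal T$ of view trees in which each body atom of $Q$ occurs as exactly one leaf and such that: * (correctness) for each connected component $C$ of $Q$, all atoms of $C$ are in one tree of $\mathcal T$; and for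 each projection view $V(\mathbf Y)$ with child $V'(\mathbf Y')$, every body atom that contains a variable of $\mathbf Y'\setminus\mathbf Y$ is in the subtree rooted at $V$; * (update) the free variables of each dynamic view include the free variables of each of its siblings; * (enumeration) for each connected component $C$ of $Q$, the tree of $\mathcal T$ that contains the atoms of $C$ has a subtree with the same root such that the union of the free variables of the views in this subtree is the set of free variables of $C$. The computational model is the uniform-cost RAM with multi-dimensional arrays that are initially zero and have constant-time access; it has addition, subtraction and comparison, and possibly further fixed unit-cost binary operations. Complexity is data complexity: programs and constants may depend on $Q$ and $\mathcal T$, but not on the database. Input relations are given as lists of tuples. $\mathcal T$ has *materialisation time* $O(f(N))$ if some program computes, on every database of size $N$, lists of the tuples of all views of $\mathcal T$ (including the leaves), stored outside the input, in time $O(f(N))$. $Q$ *can be evaluated* with given preprocessing time, update time and enumeration delay if there are programs for preprocessing the initial database (of size $N$), for each single-tuple insert into and delete from a dynamic relation, and for enumeration, such that, after preprocessing and any sequence of updates and enumerations, the enumeration program outputs every tuple of the current result of $Q$ exactly once; the update time is the worst-case time per update, and the delay is the maximum time from the start of the enumeration to the first output, between two consecutive outputs, and from the last output to the end. **Proposition.**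 Let $Q$ be a conjunctive query and $f:\mathbb N\to\mathbb R$. If $Q$ has a safe rewriting with materialisation time $O(f(N))$, then $Q$ can be evaluated with $O(f(N))$ preprocessing time, $O(1)$ update time and $O(1)$ enumeration delay. -/

import Mathlib

namespace DynCQ

/-! ## Relations, databases and conjunctive queries -/

/-- A finite relational vocabulary. Every relation symbol has an arity and is either dynamic
(subject to inserts and deletes) or static. -/
structure Vocabulary where
  numRels : ℕ
  arity : Fin numRels → ℕ
  dynamic : Fin numRels → Prop

/-- A database assigns a finite set of tuples over the domain `ℕ` to every relation symbol. -/
def Database (S : Vocabulary) : Type :=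
  (r : Fin S.numRels) → Finset (Fin (S.arity r) → ℕ)

namespace Database

variable {S : Vocabulary}

/-- The size of a database: the total number of its tuples. -/
def size (D : Database S) : ℕ := ∑ r, (D r).card

/-- Insert the tuple `t` into the relation `r` (no effect if it is already there). -/
def insertTuple (D : Database S) (r : Fin S.numRels) (t : Fin (S.arity r) → ℕ) : Database S :=
  Function.update D r (insert t (D r))

/-- Delete the tuple `t` from the relation `r` (no effect if it is not there). -/
def deleteTuple (D : Database S) (r : Fin S.numRels) (t : Fin (S.arity r) → ℕ) : Database S :=
  Function.update D r ((D r).erase t)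

end Database

/-- A conjunctive query. Variables are natural numbers. The `i`-th body atom is the relation
symbol `rel i` applied to the tuple `args i` of distinct variables; relation symbols may repeat.
The head is a tuple of distinct variables (the free variables) that occur in the body. -/
structure CQ (S : Vocabulary) where
  numAtoms : ℕ
  rel : Fin numAtoms → Fin S.numRels
  args : (i : Fin numAtoms) → Fin (S.arity (rel i)) → ℕ
  args_injective : ∀ i, Function.Injective (args i)
  head : List ℕ
  head_nodup : head.Nodup
  head_mem_body : ∀ x ∈ head, ∃ i j, args i j = x

namespace CQ

variable {S : Vocabulary} (Q : CQ S)

/-- The set of variables of the `i`-th body atom. -/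
def atomVars (i : Fin Q.numAtoms) : Finset ℕ := Finset.univ.image (Q.args i)

/-- The valuation `v` satisfies the `i`-th body atom in `D`. -/
def atomHolds (D : Database S) (i : Fin Q.numAtoms) (v : ℕ → ℕ) : Prop :=
  (fun j => v (Q.args i j)) ∈ D (Q.rel i)

/-- The result of the query: all head tuples under valuations that satisfy the whole body. -/
def result (D : Database S) : Set (List ℕ) :=
  {y | ∃ v : ℕ → ℕ, (∀ i, Q.atomHolds D i v) ∧ y = Q.head.map v}

/-- Two body atoms share a variable. -/
def Adjacent (i j : Fin Q.numAtoms) : Prop := ∃ x, x ∈ Q.atomVars i ∧ x ∈ Q.atomVars j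

/-- Two body atoms lie in the same connected component of the query. -/
def SameComponent : Fin Q.numAtoms → Fin Q.numAtoms → Prop := Relation.ReflTransGen Q.Adjacent

open scoped Classical in
/-- The free variables of the connected component of the `i`-th body atom. -/
noncomputable def componentFree (i : Fin Q.numAtoms) : Finset ℕ :=
  Q.head.toFinset.filter (fun x => ∃ j, Q.SameComponent i j ∧ x ∈ Q.atomVars j)

end CQ

/-! ## View trees and safe rewritings -/

/-- View trees for a query with `k` body atoms. A leaf is a body atom. An inner node is either a
projection view, which projects its only child onto the variables `X`, or a join view, which is
the natural join of its (one or more) children. -/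
inductive ViewTree (k : ℕ) : Type
  | atom (i : Fin k) : ViewTree k
  | proj (X : Finset ℕ) (child : ViewTree k) : ViewTree k
  | join (n : ℕ) (child : Fin (n + 1) → ViewTree k) : ViewTree k

namespace ViewTree

/-- `IsNode t p u`: the node of `t` at address `p` is the root of the subtree `u`. -/
inductive IsNode {k : ℕ} : ViewTree k → List ℕ → ViewTree k → Prop
  | root (t : ViewTree k) : IsNode t [] t
  | proj (X : Finset ℕ) (c : ViewTree k) (p : List ℕ) (u : ViewTree k) :
      IsNode c p u → IsNode (ViewTree.proj X c) (0 :: p) u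
  | join (n : ℕ) (c : Fin (n + 1) → ViewTree k) (j : Fin (n + 1)) (p : List ℕ)
      (u : ViewTree k) :
      IsNode (c j) p u → IsNode (ViewTree.join n c) ((j : ℕ) :: p) u

/-- The number of leaves of the tree that are the `i`-th body atom. -/
def leafCount {k : ℕ} (i : Fin k) : ViewTree k → ℕ
  | atom j => if i = j then 1 else 0
  | proj _ c => leafCount i c
  | join _ c => ∑ j, leafCount i (c j)

/-- The `i`-th body atom is a leaf of the tree. -/
def HasLeaf {k : ℕ} (t : ViewTree k) (i : Fin k) : Prop := 0 < t.leafCount i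

variable {S : Vocabulary} (Q : CQ S)

/-- The free variables (the schema) of the view at the root of the tree. -/
def schema : ViewTree Q.numAtoms → Finset ℕ
  | atom i => Q.atomVars i
  | proj X _ => X
  | join _ c => Finset.univ.biUnion (fun j => schema (c j))

/-- `t.Holds Q D v`: the restriction of the valuation `v` to the schema of the root view of `t`
is a tuple of that view over the database `D`. -/
def Holds (D : Database S) : ViewTree Q.numAtoms → (ℕ → ℕ) → Prop
  | atom i, v => Q.atomHolds D i v
  | proj X c, v => ∃ w : ℕ → ℕ, (∀ x ∈ X, w x = v x) ∧ Holds D c w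
  | join _ c, v => ∀ j, Holds D (c j) v

/-- The root view of the tree is dynamic: some atom below it is over a dynamic relation. -/
def IsDynamic (t : ViewTree Q.numAtoms) : Prop := ∃ i, t.HasLeaf i ∧ S.dynamic (Q.rel i)

/-- `t.TopSubtree Q F`: there is a connected part of `t` that contains the root of `t` such that
`F` is the union of the schemas of the views in this part. The part is the root alone, or the root
together with such parts of some of the trees below it. -/
inductive TopSubtree : ViewTree Q.numAtoms → Finset ℕ → Prop
  | root (t : ViewTree Q.numAtoms) : TopSubtree t (t.schema Q)
  | proj (X : Finset ℕ) (c : ViewTree Q.numAtoms) (F : Finset ℕ) :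
      TopSubtree c F → TopSubtree (ViewTree.proj X c) (X ∪ F)
  | join (n : ℕ) (c : Fin (n + 1) → ViewTree Q.numAtoms) (J : Finset (Fin (n + 1)))
      (F : Fin (n + 1) → Finset ℕ) :
      (∀ j ∈ J, TopSubtree (c j) (F j)) →
        TopSubtree (ViewTree.join n c) ((ViewTree.join n c).schema Q ∪ J.biUnion F)

end ViewTree

/-- A finite family of view trees for the query `Q`. -/
structure Rewriting {S : Vocabulary} (Q : CQ S) where
  numTrees : ℕ
  tree : Fin numTrees → ViewTree Q.numAtoms

/-- Safe rewritings. -/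
structure Rewriting.IsSafe {S : Vocabulary} {Q : CQ S} (T : Rewriting Q) : Prop where
  /-- The leaves of the view trees are the body atoms of the query, each occurring once. -/
  leaf_unique : ∀ i, ∑ τ, (T.tree τ).leafCount i = 1
  /-- A projection view keeps a subset of the variables of its child. -/
  proj_subset : ∀ τ p X c, (T.tree τ).IsNode p (ViewTree.proj X c) → X ⊆ c.schema Q
  /-- Correctness: all atoms of a connected component of the query are in one tree. -/
  component : ∀ i j, Q.SameComponent i j → ∀ τ, (T.tree τ).HasLeaf i → (T.tree τ).HasLeaf j
  /-- Correctness: all atoms that contain a variable projected away by a projection view are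
  below this view. -/
  proj_atoms : ∀ τ p X c, (T.tree τ).IsNode p (ViewTree.proj X c) →
    ∀ x ∈ c.schema Q, x ∉ X → ∀ i, x ∈ Q.atomVars i → c.HasLeaf i
  /-- Update: the free variables of a dynamic view include those of each of its siblings. -/
  update : ∀ τ p n (c : Fin (n + 1) → ViewTree Q.numAtoms),
    (T.tree τ).IsNode p (ViewTree.join n c) →
      ∀ a b, a ≠ b → (c a).IsDynamic Q → (c b).schema Q ⊆ (c a).schema Q
  /-- Enumeration: for every connected component, the tree that holds its atoms has a connected
  part with the same root, whose views have exactly the free variables of the component. -/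
  enumeration : ∀ i τ, (T.tree τ).HasLeaf i → (T.tree τ).TopSubtree Q (Q.componentFree i)

/-! ## The machine model

A random access machine with the uniform cost measure: registers holding natural numbers and
multi-dimensional arrays (initially zero) whose cells are accessed in constant time. Besides the
instructions listed here, it may have any further binary register operations `Ω`, interpreted by
`I : Ω → ℕ → ℕ → ℕ`; for empty `Ω` one gets the machine with addition and subtraction only. -/

/-- A machine state: the registers, and the arrays. The cell of the array `a` at the index tuple
`l` is `mem a l`. -/
structure State where
  reg : ℕ → ℕ
  mem : ℕ → List ℕ → ℕ

/-- Instructions. Arguments called `d`, `s`, `s₁`, `s₂` and the entries of `l` are names of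
registers, and `a` is the name of an array. -/
inductive Instr (Ω : Type) : Type
  | skip : Instr Ω
  | const (d n : ℕ) : Instr Ω
  | copy (d s : ℕ) : Instr Ω
  | add (d s₁ s₂ : ℕ) : Instr Ω
  | sub (d s₁ s₂ : ℕ) : Instr Ω
  | ext (o : Ω) (d s₁ s₂ : ℕ) : Instr Ω
  | load (d a : ℕ) (l : List ℕ) : Instr Ω
  | store (a : ℕ) (l : List ℕ) (s : ℕ) : Instr Ω

namespace State

/-- Write the value `n` to the register `d`. -/
def setReg (σ : State) (d n : ℕ) : State := { σ with reg := Function.update σ.reg d n }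

/-- Write the value `n` to the cell of the array `a` at the index tuple `l`. -/
def setCell (σ : State) (a : ℕ) (l : List ℕ) (n : ℕ) : State :=
  { σ with mem := Function.update σ.mem a (Function.update (σ.mem a) l n) }

/-- Put the components of the tuple `t` into the registers `0, 1, …`. -/
def loadTuple {n : ℕ} (σ : State) (t : Fin n → ℕ) : State :=
  { σ with reg := fun d => if h : d < n then t ⟨d, h⟩ else σ.reg d }

end State

/-- The effect of an instruction. -/
def Instr.apply {Ω : Type} (I : Ω → ℕ → ℕ → ℕ) (σ : State) : Instr Ω → State
  | skip => σ
  | const d n => σ.setReg d n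
  | copy d s => σ.setReg d (σ.reg s)
  | add d s₁ s₂ => σ.setReg d (σ.reg s₁ + σ.reg s₂)
  | sub d s₁ s₂ => σ.setReg d (σ.reg s₁ - σ.reg s₂)
  | ext o d s₁ s₂ => σ.setReg d (I o (σ.reg s₁) (σ.reg s₂))
  | load d a l => σ.setReg d (σ.mem a (l.map σ.reg))
  | store a l s => σ.setCell a (l.map σ.reg) (σ.reg s)

/-- Comparisons of two registers. -/
inductive Test : Type
  | eq (s₁ s₂ : ℕ) : Test
  | lt (s₁ s₂ : ℕ) : Test

/-- The outcome of a comparison. -/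
def Test.Holds (σ : State) : Test → Prop
  | eq s₁ s₂ => σ.reg s₁ = σ.reg s₂
  | lt s₁ s₂ => σ.reg s₁ < σ.reg s₂

/-- Programs. The program `emit l` outputs the tuple of the values of the registers in `l`. -/
inductive Prog (Ω : Type) : Type
  | instr (i : Instr Ω) : Prog Ω
  | emit (l : List ℕ) : Prog Ω
  | seq (p q : Prog Ω) : Prog Ω
  | ite (b : Test) (p q : Prog Ω) : Prog Ω
  | loop (b : Test) (p : Prog Ω) : Prog Ω

/-- A trace has one entry per time step: `none` for a step without output, and `some y` for a
step that outputs the tuple `y`. Its length is the running time. -/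
abbrev Trace : Type := List (Option (List ℕ))

/-- `Exec I p σ tr σ'`: started in the state `σ`, the program `p` halts in the state `σ'`, and
`tr` is the trace of the run. Every instruction, output and test takes one time step. -/
inductive Exec {Ω : Type} (I : Ω → ℕ → ℕ → ℕ) : Prog Ω → State → Trace → State → Prop
  | instr (i : Instr Ω) (σ : State) : Exec I (.instr i) σ [none] (i.apply I σ)
  | emit (l : List ℕ) (σ : State) : Exec I (.emit l) σ [some (l.map σ.reg)] σ
  | seq (p q : Prog Ω) (σ₁ σ₂ σ₃ : State) (tr₁ tr₂ : Trace) :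
      Exec I p σ₁ tr₁ σ₂ → Exec I q σ₂ tr₂ σ₃ → Exec I (.seq p q) σ₁ (tr₁ ++ tr₂) σ₃
  | ite_true (b : Test) (p q : Prog Ω) (σ₁ σ₂ : State) (tr : Trace) :
      b.Holds σ₁ → Exec I p σ₁ tr σ₂ → Exec I (.ite b p q) σ₁ (none :: tr) σ₂
  | ite_false (b : Test) (p q : Prog Ω) (σ₁ σ₂ : State) (tr : Trace) :
      ¬ b.Holds σ₁ → Exec I q σ₁ tr σ₂ → Exec I (.ite b p q) σ₁ (none :: tr) σ₂
  | loop_true (b : Test) (p : Prog Ω) (σ₁ σ₂ σ₃ : State) (tr₁ tr₂ : Trace) :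
      b.Holds σ₁ → Exec I p σ₁ tr₁ σ₂ → Exec I (.loop b p) σ₂ tr₂ σ₃ →
        Exec I (.loop b p) σ₁ (none :: (tr₁ ++ tr₂)) σ₃
  | loop_false (b : Test) (p : Prog Ω) (σ : State) :
      ¬ b.Holds σ → Exec I (.loop b p) σ [none] σ

namespace Trace

/-- The tuples that are output, in this order. -/
def outputs (tr : Trace) : List (List ℕ) := tr.filterMap id

/-- The delay is at most `c`: at most `c` consecutive steps pass without output, be it before the
first output, between two consecutive outputs, or after the last output. -/
def DelayLE (tr : Trace) (c : ℕ) : Prop :=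
  ∀ s : Trace, s <:+: tr → (∀ e ∈ s, e = none) → s.length ≤ c

end Trace

/-! ## Materialisation and dynamic evaluation -/

/-- The initial state for a database whose relations are given as lists of tuples. The array `r`
holds the length of the list of the relation `r` in its cell `[]` and the `j`-th component of the
`i`-th tuple in its cell `[i, j]`. All other cells and all registers are zero. -/
def inputState {S : Vocabulary} (L : (r : Fin S.numRels) → List (Fin (S.arity r) → ℕ)) :
    State where
  reg := fun _ => 0
  mem := fun a l =>
    if ha : a < S.numRels then
      match l with
      | [] => (L ⟨a, ha⟩).length
      | [i, j] =>
        if hi : i < (L ⟨a, ha⟩).length then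
          if hj : j < S.arity ⟨a, ha⟩ then (L ⟨a, ha⟩)[i] ⟨j, hj⟩ else 0
        else 0
      | _ => 0
    else 0

/-- `σ` is an initial state for the database `D`: every relation is given as a list of its tuples
without repetitions, in any order. -/
def IsInput {S : Vocabulary} (D : Database S) (σ : State) : Prop :=
  ∃ L : (r : Fin S.numRels) → List (Fin (S.arity r) → ℕ),
    (∀ r, (L r).Nodup ∧ (L r).toFinset = D r) ∧ σ = inputState L

/-- In the state `σ`, the array `a` holds a list without repetitions of all tuples of the root
view of `u` over `D`: the length in cell `[]`, and the value of variable `x` in the `i`-th tuple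
in cell `[i, x]`. -/
def ViewStored {S : Vocabulary} (Q : CQ S) (D : Database S) (u : ViewTree Q.numAtoms)
    (σ : State) (a : ℕ) : Prop :=
  (∀ i < σ.mem a [], u.Holds Q D (fun x => σ.mem a [i, x])) ∧
  (∀ v : ℕ → ℕ, u.Holds Q D v →
    ∃! i, i < σ.mem a [] ∧ ∀ x ∈ u.schema Q, σ.mem a [i, x] = v x)

/-- The rewriting has materialisation time `O(f(N))`: some program, started on any database `D` of
size `N`, stores every view of the rewriting (the leaves included) in arrays of its own choice
other than the input arrays, in time `O(f(N))`. -/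
def Rewriting.HasMaterialisationTime {S : Vocabulary} {Q : CQ S} (T : Rewriting Q)
    {Ω : Type} (I : Ω → ℕ → ℕ → ℕ) (f : ℕ → ℝ) : Prop :=
  ∃ (P : Prog Ω) (place : Fin T.numTrees → List ℕ → ℕ) (c : ℕ),
    (∀ τ p, S.numRels ≤ place τ p) ∧
    ∀ (D : Database S) (σ : State), IsInput D σ →
      ∃ tr σ', Exec I P σ tr σ' ∧ (tr.length : ℝ) ≤ c * f D.size ∧
        ∀ τ p u, (T.tree τ).IsNode p u → ViewStored Q D u σ' (place τ p)

/-- The programs of a dynamic evaluation algorithm: preprocessing, insertion into and deletion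
from each relation, and enumeration. -/
structure DynAlg (S : Vocabulary) (Ω : Type) where
  pre : Prog Ω
  ins : Fin S.numRels → Prog Ω
  del : Fin S.numRels → Prog Ω
  enum : Prog Ω

/-- `A.Reach I D σ`: `σ` is a state that can arise when the algorithm preprocesses some database
and then serves any sequence of single-tuple updates to dynamic relations and of enumeration
requests, and `D` is the database after these updates. -/
inductive DynAlg.Reach {S : Vocabulary} {Ω : Type} (A : DynAlg S Ω) (I : Ω → ℕ → ℕ → ℕ) :
    Database S → State → Prop
  | pre (D : Database S) (σ σ' : State) (tr : Trace) :
      IsInput D σ → Exec I A.pre σ tr σ' → Reach A I D σ'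
  | ins (D : Database S) (σ σ' : State) (tr : Trace) (r : Fin S.numRels)
      (t : Fin (S.arity r) → ℕ) :
      Reach A I D σ → S.dynamic r → Exec I (A.ins r) (σ.loadTuple t) tr σ' →
        Reach A I (D.insertTuple r t) σ'
  | del (D : Database S) (σ σ' : State) (tr : Trace) (r : Fin S.numRels)
      (t : Fin (S.arity r) → ℕ) :
      Reach A I D σ → S.dynamic r → Exec I (A.del r) (σ.loadTuple t) tr σ' →
        Reach A I (D.deleteTuple r t) σ'
  | enum (D : Database S) (σ σ' : State) (tr : Trace) :
      Reach A I D σ → Exec I A.enum σ tr σ' → Reach A I D σ'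

/-- The query can be evaluated with preprocessing time `O(f(N))`, where `N` is the size of the
initial database, worst-case update time `O(1)` and enumeration delay `O(1)`. At any time, the
enumeration outputs every tuple of the current query result exactly once. -/
def CQ.CanBeEvaluated {S : Vocabulary} (Q : CQ S) {Ω : Type} (I : Ω → ℕ → ℕ → ℕ)
    (f : ℕ → ℝ) : Prop :=
  ∃ (A : DynAlg S Ω) (c : ℕ),
    (∀ (D : Database S) (σ : State), IsInput D σ →
      ∃ tr σ', Exec I A.pre σ tr σ' ∧ (tr.length : ℝ) ≤ c * f D.size) ∧
    (∀ (D : Database S) (σ : State), A.Reach I D σ →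
      ∀ r, S.dynamic r → ∀ t : Fin (S.arity r) → ℕ,
        (∃ tr σ', Exec I (A.ins r) (σ.loadTuple t) tr σ' ∧ tr.length ≤ c) ∧
        (∃ tr σ', Exec I (A.del r) (σ.loadTuple t) tr σ' ∧ tr.length ≤ c)) ∧
    (∀ (D : Database S) (σ : State), A.Reach I D σ →
      ∃ tr σ', Exec I A.enum σ tr σ' ∧ tr.outputs.Nodup ∧
        (∀ y, y ∈ tr.outputs ↔ y ∈ Q.result D) ∧ tr.DelayLE c)

end DynCQ

namespace DynCQ

/-! ## Programs without loops and outputs -/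

/-! Every view is kept in a table that answers membership in constant time and holds, for each key
(a valuation of a chosen set `K` of its variables), a gap-free list of the tuples with that key.
Roots and children of join views have the empty key set; the child of a projection onto `X` is keyed
by `X`.

Updates. Let one body atom over a dynamic relation change at one tuple. By the update condition, the
child of a join view that contains this atom has a schema including those of its siblings; hence,
going up the tree, every view changes at most at one tuple (`Safe.sat_iff_of_not_eqOn`). Whether
this tuple now belongs to the view is read off the children: for a join view by one membership test
per child, for a projection view by asking whether the child's list for the corresponding key is
nonempty (`Table.Stores.len_ne_zero_iff`). So a loop-free program repairs all tables
(`run_refresh`), and no multiplicities have to be counted. Repeated relation symbols are treated by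
changing one atom at a time; the intermediate situations come from no database, which is why views
are evaluated over arbitrary interpretations of the atoms (`Sat`).

Enumeration. By correctness, a variable that occurs below two different children of a join view lies
in the schemas of both (`Safe.mem_schema_of_ne`). Hence solutions of the children glue
(`Safe.glue`), and every tuple of a view extends to a solution of all atoms below it
(`Safe.exists_solution`). The part of the tree given by the enumeration condition is traversed by
nested loops: one over the root view and one for each projection view that is crossed, running over
the child's tuples with the current key. Join views need no loop of their own. Once the root views
are known to be nonempty, no loop is ever empty, so every iteration produces output and the delay is
constant (`exec_enumProg`). The loops assign exactly the head variables, so different iterations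
give different outputs (`pairwise_enumVals`). Components share no variables, so their loops can be
nested in any order.

Preprocessing. The tables are built from the materialised views in time linear in the view sizes.
These sizes are bounded by the materialisation time: the arrays are initially zero, so each tuple
other than the all-zero one forces a cell to be written (`ViewStored.length_le`). -/

theorem Exec.deterministic {Ω : Type} {I : Ω → ℕ → ℕ → ℕ} {p : Prog Ω} {σ σ₁ : State}
    {tr₁ : Trace} (h₁ : Exec I p σ tr₁ σ₁) :
    ∀ {tr₂ σ₂}, Exec I p σ tr₂ σ₂ → tr₁ = tr₂ ∧ σ₁ = σ₂ := by
  induction h₁ with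
  | instr i σ => intro tr₂ σ₂ h; cases h; exact ⟨rfl, rfl⟩
  | emit l σ => intro tr₂ σ₂ h; cases h; exact ⟨rfl, rfl⟩
  | seq p q σ₁ σ₂ σ₃ tr₁ tr₂ _ _ ihp ihq =>
    intro tr σ' h
    cases h with
    | seq _ _ _ _ _ _ _ hp hq =>
      obtain ⟨rfl, rfl⟩ := ihp hp
      obtain ⟨rfl, rfl⟩ := ihq hq
      exact ⟨rfl, rfl⟩
  | ite_true b p q σ₁ σ₂ tr hb _ ih =>
    intro tr σ' h
    cases h with
    | ite_true _ _ _ _ _ _ _ hp => obtain ⟨rfl, rfl⟩ := ih hp; exact ⟨rfl, rfl⟩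
    | ite_false _ _ _ _ _ _ hb' _ => exact absurd hb hb'
  | ite_false b p q σ₁ σ₂ tr hb _ ih =>
    intro tr σ' h
    cases h with
    | ite_true _ _ _ _ _ _ hb' _ => exact absurd hb' hb
    | ite_false _ _ _ _ _ _ _ hq => obtain ⟨rfl, rfl⟩ := ih hq; exact ⟨rfl, rfl⟩
  | loop_true b p σ₁ σ₂ σ₃ tr₁ tr₂ hb _ _ ihp ihl =>
    intro tr σ' h
    cases h with
    | loop_true _ _ _ _ _ _ _ _ hp hl =>
      obtain ⟨rfl, rfl⟩ := ihp hp
      obtain ⟨rfl, rfl⟩ := ihl hl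
      exact ⟨rfl, rfl⟩
    | loop_false _ _ _ hb' => exact absurd hb hb'
  | loop_false b p σ hb =>
    intro tr σ' h
    cases h with
    | loop_true _ _ _ _ _ _ _ hb' _ _ => exact absurd hb' hb
    | loop_false _ _ _ _ => exact ⟨rfl, rfl⟩

/-- Serves to absorb additive constants into a multiple of the materialisation time, and to show
that `f` is positive at the size of every database. -/
theorem Exec.trace_length_pos {Ω : Type} {I : Ω → ℕ → ℕ → ℕ} {p : Prog Ω} {σ σ' : State}
    {tr : Trace} (h : Exec I p σ tr σ') : 0 < tr.length := by
  induction h <;> simp_all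

/-- A bound on the names of the arrays that an instruction writes to. -/
def Instr.arrayBound {Ω : Type} : Instr Ω → ℕ
  | store a _ _ => a + 1
  | _ => 0

namespace Prog

variable {Ω : Type} (I : Ω → ℕ → ℕ → ℕ)

/-- A bound on the names of the arrays that a program writes to. -/
def arrayBound : Prog Ω → ℕ
  | instr i => i.arrayBound
  | emit _ => 0
  | seq p q => max p.arrayBound q.arrayBound
  | ite _ p q => max p.arrayBound q.arrayBound
  | loop _ p => p.arrayBound

/-- A program without loops and outputs. -/
def Straight : Prog Ω → Prop
  | instr _ => True
  | emit _ => False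
  | seq p q => p.Straight ∧ q.Straight
  | ite _ p q => p.Straight ∧ q.Straight
  | loop _ _ => False

/-- A bound on the running time of a program without loops. -/
def cost : Prog Ω → ℕ
  | instr _ => 1
  | emit _ => 1
  | seq p q => p.cost + q.cost
  | ite _ p q => 1 + (p.cost + q.cost)
  | loop _ _ => 1

open scoped Classical in
/-- The final state of a program without loops. -/
noncomputable def run : Prog Ω → State → State
  | instr i, σ => i.apply I σ
  | emit _, σ => σ
  | seq p q, σ => q.run (p.run σ)
  | ite b p q, σ => if b.Holds σ then p.run σ else q.run σ
  | loop _ _, σ => σ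

/-- The bound `p.cost` does not mention the state: this is where all constant update times come
from. The trace is silent, so such programs merely pad the gaps between outputs. -/
theorem exec_run (p : Prog Ω) (hp : p.Straight) (σ : State) :
    ∃ n ≤ p.cost, Exec I p σ (List.replicate n none) (p.run I σ) := by
  induction p generalizing σ with
  | instr i => exact ⟨1, le_rfl, Exec.instr i σ⟩
  | emit l => exact hp.elim
  | seq p q ihp ihq =>
    obtain ⟨n, hn, h⟩ := ihp hp.1 σ
    obtain ⟨m, hm, h'⟩ := ihq hp.2 (p.run I σ)
    refine ⟨n + m, add_le_add hn hm, ?_⟩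
    rw [List.replicate_add]
    exact Exec.seq _ _ _ _ _ _ _ h h'
  | ite b p q ihp ihq =>
    by_cases hb : b.Holds σ
    · obtain ⟨n, hn, h⟩ := ihp hp.1 σ
      refine ⟨n + 1, by simp only [cost]; omega, ?_⟩
      simp only [run, if_pos hb, List.replicate_succ]
      exact Exec.ite_true _ _ _ _ _ _ hb h
    · obtain ⟨n, hn, h⟩ := ihq hp.2 σ
      refine ⟨n + 1, by simp only [cost]; omega, ?_⟩
      simp only [run, if_neg hb, List.replicate_succ]
      exact Exec.ite_false _ _ _ _ _ _ hb h
  | loop b p => exact hp.elim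

/-- Run programs one after the other. -/
def block : List (Prog Ω) → Prog Ω
  | [] => instr .skip
  | p :: ps => seq p (block ps)

theorem straight_block {ps : List (Prog Ω)} (h : ∀ p ∈ ps, p.Straight) : (block ps).Straight := by
  induction ps with
  | nil => trivial
  | cons p ps ih =>
    exact ⟨h p (by simp), ih fun q hq => h q (by simp [hq])⟩

@[simp] theorem run_block_nil (σ : State) : (block ([] : List (Prog Ω))).run I σ = σ := rfl

@[simp] theorem run_block_cons (p : Prog Ω) (ps : List (Prog Ω)) (σ : State) :
    (block (p :: ps)).run I σ = (block ps).run I (p.run I σ) := rfl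

end Prog

/-- Guarantees that the arrays reserved for the tables, whose names exceed this bound, are still
zero when the materialisation program halts. -/
theorem Exec.mem_eq_of_arrayBound_le {Ω : Type} {I : Ω → ℕ → ℕ → ℕ} {p : Prog Ω} {σ σ' : State}
    {tr : Trace} (h : Exec I p σ tr σ') (a : ℕ) (ha : p.arrayBound ≤ a) :
    σ'.mem a = σ.mem a := by
  induction h with
  | instr i σ =>
    cases i <;> simp_all [Instr.apply, State.setReg, State.setCell, Prog.arrayBound,
      Instr.arrayBound]
    rw [Function.update_of_ne (by omega)]
  | emit => rfl
  | seq p q _ _ _ _ _ _ _ ihp ihq =>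
    simp only [Prog.arrayBound, max_le_iff] at ha
    rw [ihq ha.2, ihp ha.1]
  | ite_true _ _ _ _ _ _ _ _ ih =>
    simp only [Prog.arrayBound, max_le_iff] at ha
    exact ih ha.1
  | ite_false _ _ _ _ _ _ _ _ ih =>
    simp only [Prog.arrayBound, max_le_iff] at ha
    exact ih ha.2
  | loop_true _ _ _ _ _ _ _ _ _ _ ihp ihl => rw [ihl ha, ihp ha]
  | loop_false => rfl

/-- A run changes at most as many cells as it takes steps. -/
theorem Exec.exists_changed_cells {Ω : Type} {I : Ω → ℕ → ℕ → ℕ} {p : Prog Ω} {σ σ' : State}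
    {tr : Trace} (h : Exec I p σ tr σ') :
    ∃ F : Finset (ℕ × List ℕ), F.card ≤ tr.length ∧
      ∀ a l, (a, l) ∉ F → σ'.mem a l = σ.mem a l := by
  induction h with
  | instr i σ =>
    by_cases hi : ∃ a l s, i = .store a l s
    · obtain ⟨a, l, s, rfl⟩ := hi
      refine ⟨{(a, l.map σ.reg)}, by simp, fun b k hb => ?_⟩
      simp only [Finset.mem_singleton, Prod.mk.injEq, not_and] at hb
      simp only [Instr.apply, State.setCell]
      by_cases hab : b = a
      · subst hab
        rw [Function.update_self, Function.update_of_ne (hb rfl)]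
      · rw [Function.update_of_ne hab]
    · refine ⟨∅, by simp, fun a l _ => ?_⟩
      cases i <;> simp_all [Instr.apply, State.setReg]
  | emit => exact ⟨∅, by simp, fun _ _ _ => rfl⟩
  | seq _ _ _ _ _ _ _ _ _ ihp ihq =>
    obtain ⟨F, hF, h⟩ := ihp
    obtain ⟨G, hG, h'⟩ := ihq
    refine ⟨F ∪ G, (Finset.card_union_le _ _).trans (by simp; omega), fun a l hal => ?_⟩
    simp only [Finset.mem_union, not_or] at hal
    rw [h' a l hal.2, h a l hal.1]
  | ite_true _ _ _ _ _ _ _ _ ih =>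
    obtain ⟨F, hF, h⟩ := ih
    exact ⟨F, by simp; omega, h⟩
  | ite_false _ _ _ _ _ _ _ _ ih =>
    obtain ⟨F, hF, h⟩ := ih
    exact ⟨F, by simp; omega, h⟩
  | loop_true _ _ _ _ _ _ _ _ _ _ ihp ihq =>
    obtain ⟨F, hF, h⟩ := ihp
    obtain ⟨G, hG, h'⟩ := ihq
    refine ⟨F ∪ G, (Finset.card_union_le _ _).trans (by simp; omega), fun a l hal => ?_⟩
    simp only [Finset.mem_union, not_or] at hal
    rw [h' a l hal.2, h a l hal.1]
  | loop_false => exact ⟨∅, by simp, fun _ _ _ => rfl⟩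

/-! ## Register and array names -/

/-- The register for the value of the variable `x`. -/
def vr (B x : ℕ) : ℕ := B + 3 * x
/-- A second register for a value of the variable `x`. -/
def ur (B x : ℕ) : ℕ := B + 3 * x + 1
/-- Auxiliary registers. -/
def sr (B k : ℕ) : ℕ := B + 3 * k + 2
/-- The arrays of the data structure with the name `c`. -/
def arr (B c k : ℕ) : ℕ := B + Nat.pair c k

section names
variable {B : ℕ}
@[simp] theorem vr_inj {x y : ℕ} : vr B x = vr B y ↔ x = y := by simp [vr]
@[simp] theorem ur_inj {x y : ℕ} : ur B x = ur B y ↔ x = y := by simp [ur]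
@[simp] theorem sr_inj {x y : ℕ} : sr B x = sr B y ↔ x = y := by simp [sr]
@[simp] theorem vr_ne_ur {x y : ℕ} : vr B x ≠ ur B y := by simp only [vr, ur]; omega
@[simp] theorem vr_ne_sr {x y : ℕ} : vr B x ≠ sr B y := by simp only [vr, sr]; omega
@[simp] theorem ur_ne_sr {x y : ℕ} : ur B x ≠ sr B y := by simp only [ur, sr]; omega
@[simp] theorem sr_ne_vr {x y : ℕ} : sr B x ≠ vr B y := by simp only [vr, sr]; omega
@[simp] theorem sr_ne_ur {x y : ℕ} : sr B x ≠ ur B y := by simp only [ur, sr]; omega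
@[simp] theorem arr_inj {c k c' k' : ℕ} : arr B c k = arr B c' k' ↔ c = c' ∧ k = k' := by
  simp [arr, Nat.pair_eq_pair]
theorem le_vr (x : ℕ) : B ≤ vr B x := by simp only [vr]; omega
theorem le_arr (c k : ℕ) : B ≤ arr B c k := by simp only [arr]; omega
end names

/-- Registers that subroutines may overwrite. -/
def Scratch (B r : ℕ) : Prop := (∃ k < 6, r = sr B k) ∨ ∃ x, r = ur B x

theorem not_scratch_vr {B x : ℕ} : ¬ Scratch B (vr B x) := by simp [Scratch]

theorem not_scratch_sr {B k : ℕ} (hk : 6 ≤ k) : ¬ Scratch B (sr B k) := by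
  simp only [Scratch, sr_inj, sr_ne_ur, exists_false, or_false, not_exists, not_and]
  omega

/-! ## Loading and storing tuples -/

section tuples
variable {Ω : Type} (I : Ω → ℕ → ℕ → ℕ)

/-- For every `x` in `Y`, load the cell with index `l` of the array `a x` into the
register `dst x`. -/
def loadEach (Ω : Type) (dst a : ℕ → ℕ) (l Y : List ℕ) : Prog Ω :=
  .block (Y.map fun x => .instr (.load (dst x) (a x) l))

/-- For every `x` in `Y`, store the register `src x` in the cell with index `l` of the
array `a x`. -/
def storeEach (Ω : Type) (a : ℕ → ℕ) (l : List ℕ) (src : ℕ → ℕ) (Y : List ℕ) : Prog Ω :=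
  .block (Y.map fun x => .instr (.store (a x) l (src x)))

theorem straight_loadEach (dst a : ℕ → ℕ) (l Y : List ℕ) : (loadEach Ω dst a l Y).Straight :=
  Prog.straight_block (by simp [Prog.Straight])

theorem straight_storeEach (a : ℕ → ℕ) (l : List ℕ) (src : ℕ → ℕ) (Y : List ℕ) :
    (storeEach Ω a l src Y).Straight :=
  Prog.straight_block (by simp [Prog.Straight])

/-- The index registers must not be among the destinations, since otherwise the index would change
between two loads. -/
theorem run_loadEach {dst : ℕ → ℕ} (hdst : Function.Injective dst) (a : ℕ → ℕ) (l Y : List ℕ)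
    (hl : ∀ x ∈ Y, dst x ∉ l) (σ : State) :
    ((loadEach Ω dst a l Y).run I σ).mem = σ.mem ∧
    (∀ x ∈ Y, ((loadEach Ω dst a l Y).run I σ).reg (dst x) = σ.mem (a x) (l.map σ.reg)) ∧
    ∀ r, (∀ x ∈ Y, r ≠ dst x) → ((loadEach Ω dst a l Y).run I σ).reg r = σ.reg r := by
  induction Y generalizing σ with
  | nil => simp [loadEach]
  | cons y Y ih =>
    simp only [loadEach, List.map_cons, Prog.run_block_cons] at ih ⊢
    set τ := Prog.run I (.instr (.load (dst y) (a y) l)) σ with hτ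
    have hreg : ∀ r, r ≠ dst y → τ.reg r = σ.reg r := fun r hr => by
      simp [hτ, Prog.run, Instr.apply, State.setReg, Function.update_of_ne hr]
    have hy : τ.reg (dst y) = σ.mem (a y) (l.map σ.reg) := by
      simp [hτ, Prog.run, Instr.apply, State.setReg]
    have hmem : τ.mem = σ.mem := rfl
    have hlm : l.map τ.reg = l.map σ.reg := List.map_congr_left fun r hr =>
      hreg r fun h => hl y (by simp) (h ▸ hr)
    obtain ⟨h1, h2, h3⟩ := ih (fun x hx => hl x (by simp [hx])) τ
    refine ⟨h1.trans hmem, fun x hx => ?_, fun r hr => ?_⟩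
    · by_cases hxY : x ∈ Y
      · rw [h2 x hxY, hmem, hlm]
      · obtain rfl : x = y := by simpa [hxY] using hx
        rw [h3 _ (fun z hz h => hxY (by rwa [hdst h])), hy]
    · rw [h3 r fun x hx => hr x (by simp [hx]), hreg r (hr y (by simp))]

open scoped Classical in
theorem run_storeEach {a : ℕ → ℕ} (ha : Function.Injective a) (l : List ℕ) (src : ℕ → ℕ)
    (Y : List ℕ) (σ : State) :
    ((storeEach Ω a l src Y).run I σ).reg = σ.reg ∧
    (∀ x k, ((storeEach Ω a l src Y).run I σ).mem (a x) k =
      if x ∈ Y ∧ k = l.map σ.reg then σ.reg (src x) else σ.mem (a x) k) ∧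
    ∀ b, (∀ x, b ≠ a x) → ((storeEach Ω a l src Y).run I σ).mem b = σ.mem b := by
  induction Y generalizing σ with
  | nil => simp [storeEach]
  | cons y Y ih =>
    simp only [storeEach, List.map_cons, Prog.run_block_cons] at ih ⊢
    set τ := Prog.run I (.instr (.store (a y) l (src y))) σ with hτ
    have hreg : τ.reg = σ.reg := rfl
    obtain ⟨h1, h2, h3⟩ := ih τ
    refine ⟨h1.trans hreg, fun x k => ?_, fun b hb => ?_⟩
    · rw [h2, hreg]
      simp only [hτ, Prog.run, Instr.apply, State.setCell]
      by_cases hxy : x = y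
      · subst hxy
        by_cases hk : k = l.map σ.reg <;> simp [hk]
      · have : a x ≠ a y := fun h => hxy (ha h)
        simp [this, hxy]
    · rw [h3 b hb]
      simp [hτ, Prog.run, Instr.apply, State.setCell, Function.update_of_ne (hb y)]

/-- Set the flag (register `sr B 0`) to a nonzero value if and only if all cells in the list
are nonzero. -/
def testAll (Ω : Type) (B : ℕ) (cells : List (ℕ × List ℕ)) : Prog Ω :=
  .seq (.instr (.const (sr B 3) 0)) <| .seq (.instr (.const (sr B 0) 1)) <|
    .block (cells.map fun al => .seq (.instr (.load (sr B 1) al.1 al.2))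
      (.ite (.eq (sr B 1) (sr B 3)) (.instr (.const (sr B 0) 0)) (.instr .skip)))

theorem straight_testAll (B : ℕ) (cells : List (ℕ × List ℕ)) : (testAll Ω B cells).Straight :=
  ⟨trivial, trivial, Prog.straight_block <| by
    rintro p hp
    obtain ⟨al, _, rfl⟩ := List.mem_map.1 hp
    exact ⟨trivial, trivial, trivial⟩⟩

theorem run_testAll (B : ℕ) (cells : List (ℕ × List ℕ))
    (hc : ∀ al ∈ cells, ∀ r ∈ al.2, ¬ Scratch B r) (σ : State) :
    ((testAll Ω B cells).run I σ).mem = σ.mem ∧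
    (∀ r, ¬ Scratch B r → ((testAll Ω B cells).run I σ).reg r = σ.reg r) ∧
    (((testAll Ω B cells).run I σ).reg (sr B 0) ≠ 0 ↔
      ∀ al ∈ cells, σ.mem al.1 (al.2.map σ.reg) ≠ 0) ∧
    ((testAll Ω B cells).run I σ).reg (sr B 3) = 0 := by
  simp only [testAll, Prog.run]
  set τ := Instr.apply I (Instr.apply I σ (.const (sr B 3) 0)) (.const (sr B 0) 1) with hτ
  -- The flag only ever drops to zero. The induction therefore starts from an arbitrary flag, which
  -- stays nonzero exactly if it was nonzero before and all remaining cells are nonzero.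
  have key : ∀ (ρ : State), ρ.mem = σ.mem → (∀ r, ¬ Scratch B r → ρ.reg r = σ.reg r) →
      ρ.reg (sr B 3) = 0 →
      let ρ' := (Prog.block (cells.map fun al => .seq (.instr (.load (sr B 1) al.1 al.2))
        (.ite (.eq (sr B 1) (sr B 3)) (.instr (.const (sr B 0) 0)) (.instr .skip)))).run I ρ
      ρ'.mem = σ.mem ∧ (∀ r, ¬ Scratch B r → ρ'.reg r = σ.reg r) ∧
        (ρ'.reg (sr B 0) ≠ 0 ↔ ρ.reg (sr B 0) ≠ 0 ∧
          ∀ al ∈ cells, σ.mem al.1 (al.2.map σ.reg) ≠ 0) ∧ ρ'.reg (sr B 3) = 0 := by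
    clear hτ τ
    induction cells with
    | nil => intro ρ h1 h2 h3; simp [h1, h3]; exact h2
    | cons al cells ih =>
      intro ρ h1 h2 h3
      have hmap : al.2.map ρ.reg = al.2.map σ.reg :=
        List.map_congr_left fun r hr => h2 r (hc al (by simp) r hr)
      have hne : ∀ k < 6, ∀ r, ¬ Scratch B r → r ≠ sr B k := fun k hk r hr h =>
        hr (Or.inl ⟨k, hk, h⟩)
      simp only [List.map_cons, Prog.run_block_cons]
      have ih' := ih (fun al h => hc al (by simp [h]))
      simp only [Prog.run, Instr.apply, Test.Holds, State.setReg, Function.update_self,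
        Function.update_of_ne (show sr B 3 ≠ sr B 1 by simp), h3, h1, hmap] at ih' ⊢
      set m := σ.mem al.1 (al.2.map σ.reg) with hm
      by_cases h0 : m = 0
      · rw [if_pos h0]
        obtain ⟨k1, k2, k3, k4⟩ := ih'
          ⟨Function.update (Function.update ρ.reg (sr B 1) m) (sr B 0) 0, σ.mem⟩ rfl
          (fun r hr => by
            simp only
            rw [Function.update_of_ne (hne 0 (by omega) r hr),
              Function.update_of_ne (hne 1 (by omega) r hr), h2 r hr]) (by simp [h3])
        refine ⟨k1, k2, k3.trans ?_, k4⟩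
        simp [← hm, h0]
      · rw [if_neg h0]
        obtain ⟨k1, k2, k3, k4⟩ := ih' ⟨Function.update ρ.reg (sr B 1) m, σ.mem⟩ rfl
          (fun r hr => by
            simp only
            rw [Function.update_of_ne (hne 1 (by omega) r hr), h2 r hr]) (by simp [h3])
        refine ⟨k1, k2, k3.trans ?_, k4⟩
        simp [← hm, h0]
  have hτr : ∀ r, ¬ Scratch B r → τ.reg r = σ.reg r := fun r hr => by
    simp only [hτ, Instr.apply, State.setReg]
    rw [Function.update_of_ne fun h => hr (Or.inl ⟨0, by omega, h⟩),
      Function.update_of_ne fun h => hr (Or.inl ⟨3, by omega, h⟩)]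
  obtain ⟨k1, k2, k3, k4⟩ := key τ rfl hτr (by simp [hτ, Instr.apply, State.setReg])
  refine ⟨k1, k2, k3.trans ?_, k4⟩
  simp [hτ, Instr.apply, State.setReg]

end tuples

/-! ## Tables: sets of tuples, grouped by some of their components -/

/-- The restriction of the valuation `v` to `Y`, as a list. -/
noncomputable def tup (v : ℕ → ℕ) (Y : Finset ℕ) : List ℕ := Y.toList.map v

theorem tup_eq_iff {v w : ℕ → ℕ} {Y : Finset ℕ} : tup v Y = tup w Y ↔ Set.EqOn v w Y := by
  simp [tup, Set.EqOn]

/-- A table. A tuple of the table with the key `k` has some index `i` below `len k`, and the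
components of the tuple with the key `k` and the index `i` are found at `i :: k` in `elem`. The
map `pos` assigns to every tuple of the table the successor of its index, and zero to all
other tuples. -/
@[ext]
structure Table where
  pos : List ℕ → ℕ
  len : List ℕ → ℕ
  elem : ℕ → List ℕ → ℕ

namespace Table

/-- The table `T` stores the restrictions to `Y` of the valuations in `V`, grouped by `K`. -/
structure Stores (T : Table) (K Y : Finset ℕ) (V : (ℕ → ℕ) → Prop) : Prop where
  key_subset : K ⊆ Y
  congr : ∀ u v, Set.EqOn u v Y → V u → V v
  mem : ∀ v, V v → 0 < T.pos (tup v Y) ∧ T.pos (tup v Y) ≤ T.len (tup v K) ∧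
    ∀ x ∈ Y, T.elem x ((T.pos (tup v Y) - 1) :: tup v K) = v x
  not_mem : ∀ v, ¬ V v → T.pos (tup v Y) = 0
  entry : ∀ v i, i < T.len (tup v K) →
    T.pos (tup (fun x => T.elem x (i :: tup v K)) Y) = i + 1 ∧
      ∀ x ∈ K, T.elem x (i :: tup v K) = v x

open scoped Classical in
/-- Append a tuple. -/
noncomputable def insert (T : Table) (K Y : Finset ℕ) (v : ℕ → ℕ) : Table where
  pos := Function.update T.pos (tup v Y) (T.len (tup v K) + 1)
  len := Function.update T.len (tup v K) (T.len (tup v K) + 1)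
  elem := fun x k => if x ∈ Y ∧ k = T.len (tup v K) :: tup v K then v x else T.elem x k

open scoped Classical in
/-- Delete a tuple and move the last tuple with the same key to its place. -/
noncomputable def delete (T : Table) (K Y : Finset ℕ) (v : ℕ → ℕ) : Table where
  pos := Function.update (Function.update T.pos
    (tup (fun x => T.elem x ((T.len (tup v K) - 1) :: tup v K)) Y) (T.pos (tup v Y))) (tup v Y) 0
  len := Function.update T.len (tup v K) (T.len (tup v K) - 1)
  elem := fun x k => if x ∈ Y ∧ k = (T.pos (tup v Y) - 1) :: tup v K then
    T.elem x ((T.len (tup v K) - 1) :: tup v K) else T.elem x k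

open scoped Classical in
/-- Make the tuple a member of the table if and only if `b` holds. -/
noncomputable def setMember (T : Table) (K Y : Finset ℕ) (v : ℕ → ℕ) (b : Prop) : Table :=
  if T.pos (tup v Y) = 0 then if b then T.insert K Y v else T
  else if b then T else T.delete K Y v

variable {T : Table} {K Y : Finset ℕ} {V : (ℕ → ℕ) → Prop}

theorem Stores.pos_ne_zero_iff (h : T.Stores K Y V) (v : ℕ → ℕ) :
    T.pos (tup v Y) ≠ 0 ↔ V v := by
  by_cases hv : V v
  · have := (h.mem v hv).1
    exact ⟨fun _ => hv, fun _ => by omega⟩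
  · simp [hv, h.not_mem v hv]

/-- This is the constant-time membership test for the projection of the stored view onto the key
variables: entry 0 of a nonempty list is a witness. -/
theorem Stores.len_ne_zero_iff (h : T.Stores K Y V) (v : ℕ → ℕ) :
    T.len (tup v K) ≠ 0 ↔ ∃ w, (∀ x ∈ K, w x = v x) ∧ V w := by
  constructor
  · intro h0
    obtain ⟨h1, h2⟩ := h.entry v 0 (Nat.pos_of_ne_zero h0)
    exact ⟨_, h2, (h.pos_ne_zero_iff _).1 (by rw [h1]; omega)⟩
  · rintro ⟨w, hw, hVw⟩
    rw [← tup_eq_iff.2 (fun x hx => hw x hx : Set.EqOn w v K)]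
    have := h.mem w hVw
    omega

theorem stores_empty (hK : K ⊆ Y) (hpos : ∀ k, T.pos k = 0) (hlen : ∀ k, T.len k = 0) :
    T.Stores K Y (fun _ => False) where
  key_subset := hK
  congr := fun _ _ _ h => h
  mem := fun _ h => h.elim
  not_mem := fun _ _ => hpos _
  entry := fun v i hi => by simp [hlen] at hi

/-- The new tuple takes the first free index of its key. No old entry has its position overwritten,
because the position of a tuple outside the table is zero while entries have positive positions. -/
theorem Stores.insert (h : T.Stores K Y V) {v : ℕ → ℕ} (hv : ¬ V v) {V' : (ℕ → ℕ) → Prop}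
    (hV' : ∀ u, V' u ↔ V u ∨ Set.EqOn u v Y) : (T.insert K Y v).Stores K Y V' := by
  have hKY : ∀ {u w : ℕ → ℕ}, Set.EqOn u w Y → tup u K = tup w K := fun e =>
    tup_eq_iff.2 (e.mono (by exact_mod_cast h.key_subset))
  refine ⟨h.key_subset, ?_, ?_, ?_, ?_⟩
  · intro u w e hu
    rw [hV'] at hu ⊢
    exact hu.imp (h.congr u w e) (e.symm.trans ·)
  · intro u hu
    by_cases e : Set.EqOn u v Y
    · simp only [Table.insert, tup_eq_iff.2 e, hKY e, Function.update_self]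
      refine ⟨by omega, le_rfl, fun x hx => ?_⟩
      simp [hx, e hx]
    · have hVu : V u := ((hV' u).1 hu).resolve_right e
      obtain ⟨h1, h2, h3⟩ := h.mem u hVu
      have e' : tup u Y ≠ tup v Y := fun h => e (tup_eq_iff.1 h)
      simp only [Table.insert, Function.update_of_ne e']
      refine ⟨h1, ?_, fun x hx => ?_⟩
      · by_cases hk : tup u K = tup v K
        · rw [hk, Function.update_self, ← hk]; omega
        · rwa [Function.update_of_ne hk]
      · rw [if_neg, h3 x hx]
        rintro ⟨-, hk⟩
        rw [List.cons.injEq] at hk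
        rw [← hk.2] at hk
        omega
  · intro u hu
    rw [hV', not_or] at hu
    simp only [Table.insert]
    rw [Function.update_of_ne fun h => hu.2 (tup_eq_iff.1 h), h.not_mem u hu.1]
  · intro u i hi
    by_cases hk : tup u K = tup v K
    · simp only [Table.insert, hk, Function.update_self] at hi ⊢
      by_cases hin : i = T.len (tup v K)
      · have e : Set.EqOn (fun x => if x ∈ Y ∧ i :: tup v K = T.len (tup v K) :: tup v K
            then v x else T.elem x (i :: tup v K)) v Y := fun x hx => by
          simp [hin, show x ∈ Y from hx]
        rw [tup_eq_iff.2 e, Function.update_self, hin]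
        refine ⟨rfl, fun x hx => ?_⟩
        rw [if_pos ⟨h.key_subset hx, rfl⟩]
        exact (tup_eq_iff.1 hk hx).symm
      · obtain ⟨h1, h2⟩ := h.entry u i (by rw [hk]; omega)
        rw [hk] at h1 h2
        have hne : ∀ x, ¬ (x ∈ Y ∧ i :: tup v K = T.len (tup v K) :: tup v K) := by
          rintro x ⟨-, hk⟩; exact hin (List.cons.inj hk).1
        simp only [hne, if_false]
        refine ⟨?_, h2⟩
        rw [Function.update_of_ne, h1]
        intro h0
        rw [h0, h.not_mem v hv] at h1
        omega
    · simp only [Table.insert, Function.update_of_ne hk] at hi ⊢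
      have hne : ∀ x, ¬ (x ∈ Y ∧ i :: tup u K = T.len (tup v K) :: tup v K) := by
        rintro x ⟨-, hk'⟩; exact hk (List.cons.inj hk').2
      simp only [hne, if_false]
      obtain ⟨h1, h2⟩ := h.entry u i hi
      refine ⟨?_, h2⟩
      rw [Function.update_of_ne, h1]
      intro h0
      rw [h0, h.not_mem v hv] at h1
      omega

/-- Lists stay gap-free because the last tuple `w` with the same key moves into the slot of the
deleted one. Only the positions of `v` and `w` change, and both have the key of `v`, so the other
lists are untouched. -/
theorem Stores.delete (h : T.Stores K Y V) {v : ℕ → ℕ} (hv : V v) {V' : (ℕ → ℕ) → Prop}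
    (hV' : ∀ u, V' u ↔ V u ∧ ¬ Set.EqOn u v Y) : (T.delete K Y v).Stores K Y V' := by
  have hKY : ∀ {u w : ℕ → ℕ}, Set.EqOn u w Y → tup u K = tup w K := fun e =>
    tup_eq_iff.2 (e.mono (by exact_mod_cast h.key_subset))
  obtain ⟨p1, p2, p3⟩ := h.mem v hv
  obtain ⟨n, hn⟩ : ∃ n, T.len (tup v K) = n + 1 := ⟨T.len (tup v K) - 1, by omega⟩
  obtain ⟨p, hp⟩ : ∃ p, T.pos (tup v Y) = p + 1 := ⟨T.pos (tup v Y) - 1, by omega⟩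
  obtain ⟨l1, l2⟩ := h.entry v n (by omega)
  rw [hp] at p2 p3
  set w : ℕ → ℕ := fun x => T.elem x (n :: tup v K) with hw
  have hwK : tup w K = tup v K := tup_eq_iff.2 fun x hx => l2 x hx
  -- The order of the two updates matters if `v` is itself the last tuple: then both concern the
  -- same cell, and the value 0 has to win.
  have hpos : ∀ k, (T.delete K Y v).pos k =
      Function.update (Function.update T.pos (tup w Y) (p + 1)) (tup v Y) 0 k := fun k => by
    simp only [Table.delete, hn, hp, hw, Nat.add_sub_cancel]
  have hlen : ∀ k, (T.delete K Y v).len k = Function.update T.len (tup v K) n k := fun k => by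
    simp only [Table.delete, hn, Nat.add_sub_cancel]
  have helem : ∀ x ∈ Y, ∀ k, (T.delete K Y v).elem x k =
      if k = p :: tup v K then w x else T.elem x k := fun x hx k => by
    simp only [Table.delete, hn, hp, hw, Nat.add_sub_cancel, hx, true_and]
  have hpv : Set.EqOn (fun x => T.elem x (p :: tup v K)) v Y := fun x hx => p3 x hx
  -- If the last tuple is not the deleted one, the freed slot lies strictly before the end, so it
  -- survives the decrease of the length.
  have hposw : ¬ Set.EqOn w v Y → n ≠ p := by
    rintro e rfl
    exact e hpv
  refine ⟨h.key_subset, ?_, ?_, ?_, ?_⟩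
  · intro u u' e hu
    rw [hV'] at hu ⊢
    exact ⟨h.congr u u' e hu.1, fun e' => hu.2 (e.trans e')⟩
  · intro u hu
    obtain ⟨hVu, e⟩ := (hV' u).1 hu
    obtain ⟨h1, h2, h3⟩ := h.mem u hVu
    have e' : tup u Y ≠ tup v Y := fun h => e (tup_eq_iff.1 h)
    rw [hpos, hlen, Function.update_of_ne e']
    by_cases euw : Set.EqOn u w Y
    · have hnp : n ≠ p := hposw fun h => e (euw.trans h)
      rw [tup_eq_iff.2 euw, Function.update_self, hKY euw, hwK, Function.update_self]
      refine ⟨by omega, by omega, fun x hx => ?_⟩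
      rw [helem x hx, Nat.add_sub_cancel, if_pos rfl, euw hx]
    · have e'' : tup u Y ≠ tup w Y := fun h => euw (tup_eq_iff.1 h)
      rw [Function.update_of_ne e'']
      refine ⟨h1, ?_, fun x hx => ?_⟩
      · by_cases hk : tup u K = tup v K
        · rw [hk, Function.update_self]
          by_contra hlt
          rw [hk, hn] at h2
          have hun : T.pos (tup u Y) - 1 = n := by omega
          refine euw fun x hx => ?_
          rw [← h3 x hx, hun, hk]
        · rwa [Function.update_of_ne hk]
      · rw [helem x hx, if_neg, h3 x hx]
        intro hk
        rw [List.cons.injEq] at hk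
        refine e fun y hy => ?_
        rw [← h3 y hy, hk.1, hk.2]
        exact p3 y hy
  · intro u hu
    rw [hpos]
    by_cases e : Set.EqOn u v Y
    · rw [tup_eq_iff.2 e, Function.update_self]
    · have hVu : ¬ V u := fun h => hu ((hV' u).2 ⟨h, e⟩)
      rw [Function.update_of_ne fun h => e (tup_eq_iff.1 h), Function.update_of_ne,
        h.not_mem u hVu]
      intro h0
      have := h.not_mem u hVu
      rw [h0, l1] at this
      omega
  · intro u i hi
    rw [hlen] at hi
    by_cases hk : tup u K = tup v K
    · rw [hk, Function.update_self] at hi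
      rw [hk]
      by_cases hip : i = p
      · subst hip
        have hwv : ¬ Set.EqOn w v Y := fun e => by
          rw [tup_eq_iff.2 e, hp] at l1; omega
        have e : Set.EqOn (fun x => (T.delete K Y v).elem x (i :: tup v K)) w Y := fun x hx => by
          simp only [helem x hx, if_true]
        rw [tup_eq_iff.2 e, hpos, Function.update_of_ne fun h => hwv (tup_eq_iff.1 h),
          Function.update_self]
        exact ⟨rfl, fun x hx => (e (h.key_subset hx)).trans
          ((l2 x hx).trans (tup_eq_iff.1 hk hx).symm)⟩
      · have e : Set.EqOn (fun x => (T.delete K Y v).elem x (i :: tup v K))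
            (fun x => T.elem x (i :: tup v K)) Y := fun x hx => by
          simp only [helem x hx]
          rw [if_neg fun h => hip (List.cons.inj h).1]
        obtain ⟨h1, h2⟩ := h.entry u i (by rw [hk]; omega)
        rw [hk] at h1 h2
        rw [tup_eq_iff.2 e, hpos, Function.update_of_ne, Function.update_of_ne, h1]
        · exact ⟨rfl, fun x hx => (e (h.key_subset hx)).trans (h2 x hx)⟩
        · intro h0; rw [h0, l1] at h1; omega
        · intro h0; rw [h0, hp] at h1; omega
    · rw [Function.update_of_ne hk] at hi
      have e : Set.EqOn (fun x => (T.delete K Y v).elem x (i :: tup u K))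
          (fun x => T.elem x (i :: tup u K)) Y := fun x hx => by
        simp only [helem x hx]
        rw [if_neg fun h => hk (List.cons.inj h).2]
      obtain ⟨h1, h2⟩ := h.entry u i hi
      have hne : ∀ u', tup u' K = tup v K →
          tup (fun x => T.elem x (i :: tup u K)) Y ≠ tup u' Y := by
        intro u' hu' h0
        have := hKY (tup_eq_iff.1 h0)
        rw [hu'] at this
        exact hk (by rw [← this]; exact (tup_eq_iff.2 fun x hx => h2 x hx).symm)
      rw [tup_eq_iff.2 e, hpos, Function.update_of_ne (hne v rfl),
        Function.update_of_ne (hne w hwK), h1]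
      exact ⟨rfl, fun x hx => (e (h.key_subset hx)).trans (h2 x hx)⟩

/-- Only the tuple `v` can distinguish `V` from `V'`, so the table is right once membership of `v`
is. It need not be known whether that membership changes. -/
theorem Stores.setMember (h : T.Stores K Y V) {v : ℕ → ℕ} {V' : (ℕ → ℕ) → Prop}
    (hcongr : ∀ u w, Set.EqOn u w Y → V' u → V' w)
    (hV' : ∀ u, ¬ Set.EqOn u v Y → (V u ↔ V' u)) {b : Prop} (hb : b ↔ V' v) :
    (T.setMember K Y v b).Stores K Y V' := by
  have same : (V v ↔ V' v) → T.Stores K Y V' := fun hv => by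
    have : V = V' := funext fun u => propext <| by
      by_cases e : Set.EqOn u v Y
      · exact ⟨fun hu => hcongr v u e.symm (hv.1 (h.congr u v e hu)),
          fun hu => h.congr v u e.symm (hv.2 (hcongr u v e hu))⟩
      · exact hV' u e
    exact this ▸ h
  have hpos := h.pos_ne_zero_iff v
  unfold Table.setMember
  split_ifs with h0 h1 h1
  · refine h.insert (fun hv => hpos.2 hv h0) fun u => ?_
    by_cases e : Set.EqOn u v Y
    · exact ⟨fun _ => Or.inr e, fun _ => hcongr v u e.symm (hb.1 h1)⟩
    · rw [hV' u e]; simp [e]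
  · exact same ⟨fun hv => absurd h0 (hpos.2 hv), fun hv => absurd (hb.2 hv) h1⟩
  · exact same ⟨fun _ => hb.1 h1, fun _ => hpos.1 h0⟩
  · refine h.delete (hpos.1 h0) fun u => ?_
    by_cases e : Set.EqOn u v Y
    · exact ⟨fun hu => absurd (hb.2 (hcongr u v e hu)) h1, fun hu => absurd e hu.2⟩
    · rw [hV' u e]; simp [e]

/-- The table with the name `c` in the memory. -/
def ofMem (B : ℕ) (mem : ℕ → List ℕ → ℕ) (c : ℕ) : Table where
  pos := mem (arr B c 0)
  len := mem (arr B c 1)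
  elem := fun x => mem (arr B c (x + 2))

end Table

/-! ### Constant-time programs that change a table -/

section update
variable {Ω : Type} (I : Ω → ℕ → ℕ → ℕ)

/-- Append the tuple in the registers `vr` to the table `c`. -/
noncomputable def insertProg (Ω : Type) (B c : ℕ) (K Y : Finset ℕ) : Prog Ω :=
  .block [storeEach Ω (fun x => arr B c (x + 2)) (sr B 2 :: K.toList.map (vr B)) (vr B) Y.toList,
    .instr (.const (sr B 4) 1), .instr (.add (sr B 2) (sr B 2) (sr B 4)),
    .instr (.store (arr B c 1) (K.toList.map (vr B)) (sr B 2)),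
    .instr (.store (arr B c 0) (Y.toList.map (vr B)) (sr B 2))]

/-- Delete the tuple in the registers `vr` from the table `c`. -/
noncomputable def deleteProg (Ω : Type) (B c : ℕ) (K Y : Finset ℕ) : Prog Ω :=
  .block [.instr (.const (sr B 4) 1), .instr (.sub (sr B 2) (sr B 2) (sr B 4)),
    .instr (.sub (sr B 5) (sr B 1) (sr B 4)),
    loadEach Ω (ur B) (fun x => arr B c (x + 2)) (sr B 2 :: K.toList.map (vr B)) Y.toList,
    storeEach Ω (fun x => arr B c (x + 2)) (sr B 5 :: K.toList.map (vr B)) (ur B) Y.toList,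
    .instr (.store (arr B c 0) (Y.toList.map (ur B)) (sr B 1)),
    .instr (.store (arr B c 0) (Y.toList.map (vr B)) (sr B 3)),
    .instr (.store (arr B c 1) (K.toList.map (vr B)) (sr B 2))]

/-- Make the tuple in the registers `vr` a member of the table `c` if and only if the flag
(register `sr B 0`) is nonzero. -/
noncomputable def setMemberProg (Ω : Type) (B c : ℕ) (K Y : Finset ℕ) : Prog Ω :=
  .block [.instr (.const (sr B 3) 0),
    .instr (.load (sr B 1) (arr B c 0) (Y.toList.map (vr B))),
    .instr (.load (sr B 2) (arr B c 1) (K.toList.map (vr B))),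
    .ite (.eq (sr B 1) (sr B 3))
      (.ite (.eq (sr B 0) (sr B 3)) (.instr .skip) (insertProg Ω B c K Y))
      (.ite (.eq (sr B 0) (sr B 3)) (deleteProg Ω B c K Y) (.instr .skip))]

theorem straight_setMemberProg (B c : ℕ) (K Y : Finset ℕ) :
    (setMemberProg Ω B c K Y).Straight := by
  simp [setMemberProg, insertProg, deleteProg, Prog.block, Prog.Straight, straight_loadEach,
    straight_storeEach]

theorem map_vr_eq_tup (B : ℕ) (reg : ℕ → ℕ) (Y : Finset ℕ) :
    (Y.toList.map (vr B)).map reg = tup (fun x => reg (vr B x)) Y := by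
  simp [tup, Function.comp_def]

theorem map_ur_eq_tup (B : ℕ) (reg : ℕ → ℕ) (Y : Finset ℕ) :
    (Y.toList.map (ur B)).map reg = tup (fun x => reg (ur B x)) Y := by
  simp [tup, Function.comp_def]

theorem arr_add_two_injective (B c : ℕ) : Function.Injective fun x => arr B c (x + 2) :=
  fun x y h => by simpa using h

theorem run_insertProg (B c : ℕ) (K Y : Finset ℕ) (σ : State) {v : ℕ → ℕ}
    (hv : ∀ x, σ.reg (vr B x) = v x)
    (h2 : σ.reg (sr B 2) = σ.mem (arr B c 1) (tup v K)) :
    Table.ofMem B ((insertProg Ω B c K Y).run I σ).mem c =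
      (Table.ofMem B σ.mem c).insert K Y v ∧
    (∀ a, (∀ k, a ≠ arr B c k) → ((insertProg Ω B c K Y).run I σ).mem a = σ.mem a) ∧
    ∀ r, ¬ Scratch B r → ((insertProg Ω B c K Y).run I σ).reg r = σ.reg r := by
  obtain rfl : (fun x => σ.reg (vr B x)) = v := funext hv
  simp only [insertProg, Prog.run_block_cons, Prog.run_block_nil]
  obtain ⟨k1, k2, k3⟩ := run_storeEach I (arr_add_two_injective B c)
    (sr B 2 :: K.toList.map (vr B)) (vr B) Y.toList σ
  generalize Prog.run I (storeEach Ω _ _ _ _) σ = τ at k1 k2 k3 ⊢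
  simp only [List.map_cons, map_vr_eq_tup, Finset.mem_toList, h2] at k2
  have m0 := k3 (arr B c 0) (by simp)
  have m1 := k3 (arr B c 1) (by simp)
  simp only [Prog.run, Instr.apply, State.setReg, State.setCell, map_vr_eq_tup, k1]
  simp only [ne_eq, vr_ne_sr, not_false_eq_true, Function.update_of_ne, Function.update_self]
  refine ⟨?_, fun a ha => ?_, fun r hr => ?_⟩
  · ext x k
    · simp [Table.ofMem, Table.insert, m0, h2]
    · simp [Table.ofMem, Table.insert, m1, h2]
    · simp only [Table.ofMem, Table.insert, ne_eq, arr_inj, Nat.add_eq_zero_iff,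
        OfNat.ofNat_ne_zero, and_false, not_false_eq_true, Function.update_of_ne,
        Nat.reduceEqDiff, k2]
      by_cases h : x ∈ Y ∧ k = σ.mem (arr B c 1) (tup (fun x => σ.reg (vr B x)) K) ::
          tup (fun x => σ.reg (vr B x)) K
      · exact (if_pos h).trans (if_pos h).symm
      · exact (if_neg h).trans (if_neg h).symm
  · rw [Function.update_of_ne (ha 0), Function.update_of_ne (ha 1), k3 a fun x => ha _]
  · rw [Function.update_of_ne fun h => hr (Or.inl ⟨2, by omega, h⟩),
      Function.update_of_ne fun h => hr (Or.inl ⟨4, by omega, h⟩)]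

theorem run_deleteProg (B c : ℕ) (K Y : Finset ℕ) (σ : State) {v : ℕ → ℕ}
    (hv : ∀ x, σ.reg (vr B x) = v x)
    (h1 : σ.reg (sr B 1) = σ.mem (arr B c 0) (tup v Y))
    (h2 : σ.reg (sr B 2) = σ.mem (arr B c 1) (tup v K)) (h3 : σ.reg (sr B 3) = 0) :
    Table.ofMem B ((deleteProg Ω B c K Y).run I σ).mem c =
      (Table.ofMem B σ.mem c).delete K Y v ∧
    (∀ a, (∀ k, a ≠ arr B c k) → ((deleteProg Ω B c K Y).run I σ).mem a = σ.mem a) ∧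
    ∀ r, ¬ Scratch B r → ((deleteProg Ω B c K Y).run I σ).reg r = σ.reg r := by
  obtain rfl : (fun x => σ.reg (vr B x)) = v := funext hv
  simp only [deleteProg, Prog.run_block_cons, Prog.run_block_nil]
  set σ₁ : State := Prog.run I (.instr (.sub (sr B 5) (sr B 1) (sr B 4)))
    (Prog.run I (.instr (.sub (sr B 2) (sr B 2) (sr B 4)))
      (Prog.run I (.instr (.const (sr B 4) 1)) σ)) with hσ₁
  have a1 : σ₁.mem = σ.mem := rfl
  have a2 : ∀ r, ¬ Scratch B r → σ₁.reg r = σ.reg r := fun r hr => by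
    simp only [hσ₁, Prog.run, Instr.apply, State.setReg]
    rw [Function.update_of_ne fun h => hr (Or.inl ⟨5, by omega, h⟩),
      Function.update_of_ne fun h => hr (Or.inl ⟨2, by omega, h⟩),
      Function.update_of_ne fun h => hr (Or.inl ⟨4, by omega, h⟩)]
  have a3 : σ₁.reg (sr B 1) = σ.reg (sr B 1) := by
    simp [hσ₁, Prog.run, Instr.apply, State.setReg]
  have a4 : σ₁.reg (sr B 2) = σ.reg (sr B 2) - 1 := by
    simp [hσ₁, Prog.run, Instr.apply, State.setReg]
  have a5 : σ₁.reg (sr B 3) = σ.reg (sr B 3) := by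
    simp [hσ₁, Prog.run, Instr.apply, State.setReg]
  have a6 : σ₁.reg (sr B 5) = σ.reg (sr B 1) - 1 := by
    simp [hσ₁, Prog.run, Instr.apply, State.setReg]
  clear_value σ₁
  have a7 : (fun x => σ₁.reg (vr B x)) = fun x => σ.reg (vr B x) :=
    funext fun x => a2 _ not_scratch_vr
  obtain ⟨b1, b2, b3⟩ := run_loadEach I (dst := ur B) (fun x y h => by simpa using h)
    (fun x => arr B c (x + 2)) (sr B 2 :: K.toList.map (vr B)) Y.toList (by simp) σ₁
  generalize Prog.run I (loadEach Ω _ _ _ _) σ₁ = σ₂ at b1 b2 b3 ⊢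
  simp only [List.map_cons, map_vr_eq_tup, Finset.mem_toList, a4, a1, a7, h2] at b2
  have b4 : (fun x => σ₂.reg (vr B x)) = fun x => σ.reg (vr B x) :=
    (funext fun x => b3 (vr B x) (by simp)).trans a7
  have b5 : σ₂.reg (sr B 5) = σ.reg (sr B 1) - 1 := (b3 _ (by simp)).trans a6
  have b6 : σ₂.reg (sr B 2) = σ.reg (sr B 2) - 1 := (b3 _ (by simp)).trans a4
  have b7 : σ₂.reg (sr B 1) = σ.reg (sr B 1) := (b3 _ (by simp)).trans a3
  have b8 : σ₂.reg (sr B 3) = 0 := (b3 _ (by simp)).trans (a5.trans h3)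
  rw [a1] at b1
  have b9 : tup (fun x => σ₂.reg (ur B x)) Y = tup (fun x => σ.mem (arr B c (x + 2))
      ((σ.mem (arr B c 1) (tup (fun x => σ.reg (vr B x)) K) - 1) ::
        tup (fun x => σ.reg (vr B x)) K)) Y := tup_eq_iff.2 fun x hx => b2 x hx
  have b10 : ∀ r, ¬ Scratch B r → σ₂.reg r = σ.reg r := fun r hr =>
    (b3 r fun x _ h => hr (Or.inr ⟨x, h⟩)).trans (a2 r hr)
  obtain ⟨k1, k2, k3⟩ := run_storeEach I (arr_add_two_injective B c)
    (sr B 5 :: K.toList.map (vr B)) (ur B) Y.toList σ₂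
  generalize Prog.run I (storeEach Ω _ _ _ _) σ₂ = τ at k1 k2 k3 ⊢
  simp only [List.map_cons, map_vr_eq_tup, Finset.mem_toList, b5, b4, b1] at k2
  have m0 := k3 (arr B c 0) (by simp)
  have m1 := k3 (arr B c 1) (by simp)
  simp only [Prog.run, Instr.apply, State.setCell, map_vr_eq_tup, map_ur_eq_tup, k1, b4, b9]
  refine ⟨?_, fun a ha => ?_, fun r hr => b10 r hr⟩
  · ext x k
    · simp [Table.ofMem, Table.delete, m0, b7, b8, b1, h1]
    · simp [Table.ofMem, Table.delete, m1, b6, b1, h2]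
    · simp only [Table.ofMem, Table.delete, ne_eq, arr_inj, Nat.add_eq_zero_iff,
        OfNat.ofNat_ne_zero, and_false, not_false_eq_true, Function.update_of_ne,
        Nat.reduceEqDiff, k2, h1]
      by_cases h : x ∈ Y ∧ k = (σ.mem (arr B c 0) (tup (fun x => σ.reg (vr B x)) Y) - 1) ::
          tup (fun x => σ.reg (vr B x)) K
      · exact (if_pos h).trans ((b2 x h.1).trans (if_pos h).symm)
      · exact (if_neg h).trans (if_neg h).symm
  · rw [Function.update_of_ne (ha 1), Function.update_of_ne (ha 0), Function.update_of_ne (ha 0),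
      k3 a fun x => ha _, b1]

theorem run_setMemberProg (B c : ℕ) (K Y : Finset ℕ) (σ : State) {v : ℕ → ℕ}
    (hv : ∀ x, σ.reg (vr B x) = v x) :
    Table.ofMem B ((setMemberProg Ω B c K Y).run I σ).mem c =
      (Table.ofMem B σ.mem c).setMember K Y v (σ.reg (sr B 0) ≠ 0) ∧
    (∀ a, (∀ k, a ≠ arr B c k) → ((setMemberProg Ω B c K Y).run I σ).mem a = σ.mem a) ∧
    ∀ r, ¬ Scratch B r → ((setMemberProg Ω B c K Y).run I σ).reg r = σ.reg r := by
  obtain rfl : (fun x => σ.reg (vr B x)) = v := funext hv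
  simp only [setMemberProg, Prog.run_block_cons, Prog.run_block_nil]
  set τ : State := Prog.run I (.instr (.load (sr B 2) (arr B c 1) (K.toList.map (vr B))))
    (Prog.run I (.instr (.load (sr B 1) (arr B c 0) (Y.toList.map (vr B))))
      (Prog.run I (.instr (.const (sr B 3) 0)) σ)) with hτ
  have a1 : τ.mem = σ.mem := rfl
  have a2 : ∀ r, ¬ Scratch B r → τ.reg r = σ.reg r := fun r hr => by
    simp only [hτ, Prog.run, Instr.apply, State.setReg]
    rw [Function.update_of_ne fun h => hr (Or.inl ⟨2, by omega, h⟩),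
      Function.update_of_ne fun h => hr (Or.inl ⟨1, by omega, h⟩),
      Function.update_of_ne fun h => hr (Or.inl ⟨3, by omega, h⟩)]
  have a3 : τ.reg (sr B 0) = σ.reg (sr B 0) := by
    simp [hτ, Prog.run, Instr.apply, State.setReg]
  have a4 : τ.reg (sr B 1) = σ.mem (arr B c 0) (tup (fun x => σ.reg (vr B x)) Y) := by
    simp only [hτ, Prog.run, Instr.apply, State.setReg, map_vr_eq_tup]
    simp
  have a5 : τ.reg (sr B 2) = σ.mem (arr B c 1) (tup (fun x => σ.reg (vr B x)) K) := by
    simp only [hτ, Prog.run, Instr.apply, State.setReg, map_vr_eq_tup]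
    simp
  have a6 : τ.reg (sr B 3) = 0 := by simp [hτ, Prog.run, Instr.apply, State.setReg]
  clear_value τ
  rw [← a1] at a4 a5
  have a7 : ∀ x, τ.reg (vr B x) = σ.reg (vr B x) := fun x => a2 _ not_scratch_vr
  have hi := run_insertProg I B c K Y τ a7 a5
  have hd := run_deleteProg I B c K Y τ a7 a4 a5 a6
  simp only [Prog.run, Test.Holds, a3, a4, a6, Instr.apply, Table.setMember, ne_eq]
  simp only [Table.ofMem] at hi hd ⊢
  rw [a1] at hi hd ⊢
  split_ifs
  · exact ⟨by rw [a1], fun _ _ => congrFun a1 _, a2⟩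
  · exact ⟨hi.1, hi.2.1, fun r hr => (hi.2.2 r hr).trans (a2 r hr)⟩
  · exact ⟨hd.1, hd.2.1, fun r hr => (hd.2.2 r hr).trans (a2 r hr)⟩
  · exact ⟨by rw [a1], fun _ _ => congrFun a1 _, a2⟩

end update

/-! ## Safe view trees and their views -/

namespace ViewTree

variable {S : Vocabulary} (Q : CQ S)

/-- The restriction of `v` to the schema of the root view is a tuple of that view, if the
`i`-th body atom is interpreted by `A i`. -/
def Sat (A : Fin Q.numAtoms → (ℕ → ℕ) → Prop) : ViewTree Q.numAtoms → (ℕ → ℕ) → Prop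
  | atom i, v => A i v
  | proj X c, v => ∃ w : ℕ → ℕ, (∀ x ∈ X, w x = v x) ∧ Sat A c w
  | join _ c, v => ∀ j, Sat A (c j) v

variable {Q}

/-- `Sat` allows the atoms to be interpreted independently of each other. This is needed in an
update of a relation that occurs in several atoms, where some atoms already see the new relation and
others still the old one. -/
theorem holds_iff_sat (D : Database S) (t : ViewTree Q.numAtoms) (v : ℕ → ℕ) :
    t.Holds Q D v ↔ t.Sat Q (Q.atomHolds D) v := by
  induction t generalizing v with
  | atom i => rfl
  | proj X c ih => simp only [Holds, Sat, ih]
  | join n c ih => simp only [Holds, Sat, ih]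

/-- The interpretation of every body atom only depends on the variables of the atom. -/
def AtomCongr (Q : CQ S) (A : Fin Q.numAtoms → (ℕ → ℕ) → Prop) : Prop :=
  ∀ i u v, Set.EqOn u v (Q.atomVars i) → A i u → A i v

theorem atomCongr_atomHolds (D : Database S) : AtomCongr Q (Q.atomHolds D) := by
  intro i u v e h
  have : (fun j => v (Q.args i j)) = fun j => u (Q.args i j) :=
    funext fun j => (e (by simp [CQ.atomVars])).symm
  simpa only [CQ.atomHolds, this] using h

theorem schema_child_subset {n : ℕ} (c : Fin (n + 1) → ViewTree Q.numAtoms) (j : Fin (n + 1)) :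
    (c j).schema Q ⊆ (join n c).schema Q := fun x hx => by
  simp only [schema, Finset.mem_biUnion, Finset.mem_univ, true_and]
  exact ⟨j, hx⟩

theorem Sat.congr {A : Fin Q.numAtoms → (ℕ → ℕ) → Prop} (hA : AtomCongr Q A)
    (t : ViewTree Q.numAtoms) {u v : ℕ → ℕ} (e : Set.EqOn u v (t.schema Q)) (h : t.Sat Q A u) :
    t.Sat Q A v := by
  induction t with
  | atom i => exact hA i u v e h
  | proj X c ih =>
    obtain ⟨w, hw, hc⟩ := h
    exact ⟨w, fun x hx => (hw x hx).trans (e hx), hc⟩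
  | join n c ih =>
    exact fun j => ih j (e.mono (by exact_mod_cast schema_child_subset c j)) (h j)

theorem sat_congr_of_leaves {A A' : Fin Q.numAtoms → (ℕ → ℕ) → Prop} (t : ViewTree Q.numAtoms)
    (h : ∀ i, t.HasLeaf i → ∀ u, A i u ↔ A' i u) (u : ℕ → ℕ) : t.Sat Q A u ↔ t.Sat Q A' u := by
  induction t generalizing u with
  | atom i => exact h i (by simp [HasLeaf, leafCount]) u
  | proj X c ih =>
    simp only [Sat]
    exact exists_congr fun w => and_congr_right fun _ => ih h w
  | join n c ih =>
    simp only [Sat]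
    refine forall_congr' fun j => ih j (fun i hi => h i ?_) u
    simp only [HasLeaf, leafCount] at hi ⊢
    exact hi.trans_le (Finset.single_le_sum (f := fun j => leafCount i (c j))
      (fun _ _ => Nat.zero_le _) (Finset.mem_univ j))

theorem hasLeaf_join {n : ℕ} {c : Fin (n + 1) → ViewTree Q.numAtoms} {i : Fin Q.numAtoms} :
    (join n c).HasLeaf i ↔ ∃ j, (c j).HasLeaf i := by
  simp only [HasLeaf, leafCount, Finset.sum_pos_iff, Finset.mem_univ, true_and]

/-- The conditions on a view tree of a safe rewriting, apart from the one on enumeration. -/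
structure Safe (t : ViewTree Q.numAtoms) : Prop where
  leaf_le : ∀ i, t.leafCount i ≤ 1
  proj_subset : ∀ p X c, t.IsNode p (proj X c) → X ⊆ c.schema Q
  proj_atoms : ∀ p X c, t.IsNode p (proj X c) →
    ∀ x ∈ c.schema Q, x ∉ X → ∀ i, x ∈ Q.atomVars i → c.HasLeaf i
  update : ∀ p n (c : Fin (n + 1) → ViewTree Q.numAtoms), t.IsNode p (join n c) →
    ∀ a b, a ≠ b → (c a).IsDynamic Q → (c b).schema Q ⊆ (c a).schema Q

theorem Safe.of_proj {X : Finset ℕ} {c : ViewTree Q.numAtoms} (h : (proj X c).Safe) :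
    c.Safe where
  leaf_le := h.leaf_le
  proj_subset p _ _ hn := h.proj_subset (0 :: p) _ _ (.proj _ _ _ _ hn)
  proj_atoms p _ _ hn := h.proj_atoms (0 :: p) _ _ (.proj _ _ _ _ hn)
  update p _ _ hn := h.update (0 :: p) _ _ (.proj _ _ _ _ hn)

theorem Safe.of_join {n : ℕ} {c : Fin (n + 1) → ViewTree Q.numAtoms} (h : (join n c).Safe)
    (j : Fin (n + 1)) : (c j).Safe where
  leaf_le i := (Finset.single_le_sum (f := fun j => leafCount i (c j))
      (fun _ _ => Nat.zero_le _) (Finset.mem_univ j)).trans (h.leaf_le i)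
  proj_subset p _ _ hn := h.proj_subset (j :: p) _ _ (.join _ _ _ _ _ hn)
  proj_atoms p _ _ hn := h.proj_atoms (j :: p) _ _ (.join _ _ _ _ _ hn)
  update p _ _ hn := h.update (j :: p) _ _ (.join _ _ _ _ _ hn)

theorem Safe.child_unique {n : ℕ} {c : Fin (n + 1) → ViewTree Q.numAtoms} (h : (join n c).Safe)
    {i : Fin Q.numAtoms} {a b : Fin (n + 1)} (ha : (c a).HasLeaf i) (hb : (c b).HasLeaf i) :
    a = b := by
  by_contra hab
  have h1 := h.leaf_le i
  have h2 : ∑ j ∈ {a, b}, leafCount i (c j) ≤ ∑ j, leafCount i (c j) :=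
    Finset.sum_le_sum_of_subset (Finset.subset_univ _)
  rw [Finset.sum_pair hab] at h2
  simp only [leafCount, HasLeaf] at h1 ha hb
  omega

/-- If the interpretation of a single body atom over a dynamic relation changes, and only at the
tuple `v`, then every view changes at most at `v`. -/
theorem Safe.sat_iff_of_not_eqOn {A A' : Fin Q.numAtoms → (ℕ → ℕ) → Prop}
    {i : Fin Q.numAtoms} (hi : S.dynamic (Q.rel i)) {v : ℕ → ℕ}
    (hne : ∀ j, j ≠ i → ∀ u, A j u ↔ A' j u)
    (heq : ∀ u, ¬ Set.EqOn u v (Q.atomVars i) → (A i u ↔ A' i u))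
    {t : ViewTree Q.numAtoms} (ht : t.Safe) {u : ℕ → ℕ} (hu : ¬ Set.EqOn u v (t.schema Q)) :
    t.Sat Q A u ↔ t.Sat Q A' u := by
  induction t generalizing u with
  | atom j =>
    by_cases hj : j = i
    · subst hj; exact heq u hu
    · exact hne j hj u
  | proj X c ih =>
    simp only [Sat]
    -- A witness `w` that agreed with `v` on the child's schema would make `u` agree with `v` on
    -- `X`. So all relevant witnesses lie where the child does not change.
    refine exists_congr fun w => and_congr_right fun hw => ih ht.of_proj fun e => hu ?_
    intro x hx
    exact (hw x hx).symm.trans (e (ht.proj_subset [] X c (.root _) hx))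
  | join n c ih =>
    simp only [Sat]
    have other : ∀ j, ¬ (c j).HasLeaf i → ((c j).Sat Q A u ↔ (c j).Sat Q A' u) := fun j hj =>
      sat_congr_of_leaves _ (fun i' hi' => hne i' fun h => hj (h ▸ hi')) u
    by_cases hl : ∃ j, (c j).HasLeaf i
    · obtain ⟨j, hj⟩ := hl
      refine forall_congr' fun b => ?_
      by_cases hb : b = j
      · subst hb
        -- The child `b` that contains the changing atom is dynamic, so its schema includes those of
        -- its siblings and hence the whole schema of the join view. Agreement with `v` there is
        -- agreement everywhere.
        refine ih b (ht.of_join b) fun e => hu fun x hx => ?_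
        simp only [schema, Finset.coe_biUnion, Set.mem_iUnion] at hx
        obtain ⟨a, -, hx⟩ := hx
        by_cases hab : b = a
        · subst hab; exact e hx
        · exact e (ht.update [] n c (.root _) b a hab ⟨i, hj, hi⟩ hx)
      · exact other b fun h => hb (ht.child_unique h hj)
    · exact forall_congr' fun j => other j fun h => hl ⟨j, h⟩

/-! ## The data structure for a view tree -/

/-- The table with the name `g p` stores the view at the address `p`. The root view is grouped by
`K`, the child of a projection view by the variables of the projection view. -/
def Stored (Q : CQ S) (B : ℕ) (mem : ℕ → List ℕ → ℕ) (A : Fin Q.numAtoms → (ℕ → ℕ) → Prop) :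
    ViewTree Q.numAtoms → Finset ℕ → (List ℕ → ℕ) → Prop
  | atom i, K, g =>
    (Table.ofMem B mem (g [])).Stores K ((atom i).schema Q) ((atom i).Sat Q A)
  | proj X c, K, g =>
    (Table.ofMem B mem (g [])).Stores K ((proj X c).schema Q) ((proj X c).Sat Q A) ∧
      Stored Q B mem A c X fun p => g (0 :: p)
  | join n c, K, g =>
    (Table.ofMem B mem (g [])).Stores K ((join n c).schema Q) ((join n c).Sat Q A) ∧
      ∀ j : Fin (n + 1), Stored Q B mem A (c j) ∅ fun p => g ((j : ℕ) :: p)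

theorem Stored.root {B : ℕ} {mem : ℕ → List ℕ → ℕ} {A : Fin Q.numAtoms → (ℕ → ℕ) → Prop}
    {t : ViewTree Q.numAtoms} {K : Finset ℕ} {g : List ℕ → ℕ} (h : t.Stored Q B mem A K g) :
    (Table.ofMem B mem (g [])).Stores K (t.schema Q) (t.Sat Q A) := by
  cases t with
  | atom i => exact h
  | proj X c => exact h.1
  | join n c => exact h.1

theorem _root_.DynCQ.Table.ofMem_congr {B : ℕ} {mem mem' : ℕ → List ℕ → ℕ} {c : ℕ}
    (h : ∀ k, mem' (arr B c k) = mem (arr B c k)) :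
    Table.ofMem B mem' c = Table.ofMem B mem c := by
  simp only [Table.ofMem, h]

theorem Stored.congr {B : ℕ} {mem mem' : ℕ → List ℕ → ℕ} {A : Fin Q.numAtoms → (ℕ → ℕ) → Prop}
    {t : ViewTree Q.numAtoms} {K : Finset ℕ} {g : List ℕ → ℕ} (h : t.Stored Q B mem A K g)
    (hmem : ∀ p k, mem' (arr B (g p) k) = mem (arr B (g p) k)) : t.Stored Q B mem' A K g := by
  induction t generalizing K g with
  | atom i =>
    simp only [Stored] at h ⊢
    rwa [Table.ofMem_congr fun k => hmem [] k]
  | proj X c ih =>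
    simp only [Stored] at h ⊢
    rw [Table.ofMem_congr fun k => hmem [] k]
    exact ⟨h.1, ih h.2 fun p => hmem (0 :: p)⟩
  | join n c ih =>
    simp only [Stored] at h ⊢
    rw [Table.ofMem_congr fun k => hmem [] k]
    exact ⟨h.1, fun j => ih j (h.2 j) fun p => hmem (j :: p)⟩

/-- Adapt the tables of all views of a tree after the tuple in the registers `vr` has become a
member (`b = 1`) or a non-member (`b = 0`) of the leaf that is the `i`-th body atom. -/
noncomputable def refresh (Ω : Type) (Q : CQ S) (B : ℕ) (i : Fin Q.numAtoms) (b : ℕ) :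
    ViewTree Q.numAtoms → Finset ℕ → (List ℕ → ℕ) → Prog Ω
  | atom j, K, g =>
    if i = j then .seq (.instr (.const (sr B 0) b))
      (setMemberProg Ω B (g []) K ((atom j).schema Q)) else .instr .skip
  | proj X c, K, g =>
    .seq (refresh Ω Q B i b c X fun p => g (0 :: p))
      (.seq (testAll Ω B [(arr B (g [0]) 1, X.toList.map (vr B))])
        (setMemberProg Ω B (g []) K ((proj X c).schema Q)))
  | join n c, K, g =>
    .seq (.block (List.ofFn fun j : Fin (n + 1) =>
        refresh Ω Q B i b (c j) ∅ fun p => g ((j : ℕ) :: p)))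
      (.seq (testAll Ω B (List.ofFn fun j : Fin (n + 1) =>
          (arr B (g [(j : ℕ)]) 0, ((c j).schema Q).toList.map (vr B))))
        (setMemberProg Ω B (g []) K ((join n c).schema Q)))

theorem straight_refresh (Ω : Type) (B : ℕ) (i : Fin Q.numAtoms) (b : ℕ)
    (t : ViewTree Q.numAtoms) (K : Finset ℕ) (g : List ℕ → ℕ) :
    (refresh Ω Q B i b t K g).Straight := by
  induction t generalizing K g with
  | atom j =>
    simp only [refresh]
    split_ifs
    · exact ⟨trivial, straight_setMemberProg _ _ _ _⟩
    · trivial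
  | proj X c ih => exact ⟨ih _ _, straight_testAll _ _, straight_setMemberProg _ _ _ _⟩
  | join n c ih =>
    refine ⟨Prog.straight_block ?_, straight_testAll _ _, straight_setMemberProg _ _ _ _⟩
    intro p hp
    obtain ⟨j, rfl⟩ := (List.mem_ofFn' _ _).1 hp
    exact ih _ _ _

/-- Run refresh programs for several trees with separate tables. -/
theorem run_block_refresh {Ω : Type} (I : Ω → ℕ → ℕ → ℕ) {B : ℕ}
    {A A' : Fin Q.numAtoms → (ℕ → ℕ) → Prop} {v : ℕ → ℕ} {ι : Type} (t : ι → ViewTree Q.numAtoms)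
    (g : ι → List ℕ → ℕ) (hg : ∀ i j p q, g i p = g j q → i = j) (P : ι → Prog Ω)
    (hP : ∀ j, ∀ σ : State, (t j).Stored Q B σ.mem A ∅ (g j) → (∀ x, σ.reg (vr B x) = v x) →
      (t j).Stored Q B ((P j).run I σ).mem A' ∅ (g j) ∧
      (∀ a, (∀ p k, a ≠ arr B (g j p) k) → ((P j).run I σ).mem a = σ.mem a) ∧
      ∀ r, ¬ Scratch B r → ((P j).run I σ).reg r = σ.reg r)
    (l : List ι) (hl : l.Nodup) (σ : State)
    (hσ : ∀ j ∈ l, (t j).Stored Q B σ.mem A ∅ (g j)) (hv : ∀ x, σ.reg (vr B x) = v x) :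
    (∀ j ∈ l, (t j).Stored Q B ((Prog.block (l.map P)).run I σ).mem A' ∅ (g j)) ∧
    (∀ a, (∀ j ∈ l, ∀ p k, a ≠ arr B (g j p) k) →
      ((Prog.block (l.map P)).run I σ).mem a = σ.mem a) ∧
    ∀ r, ¬ Scratch B r → ((Prog.block (l.map P)).run I σ).reg r = σ.reg r := by
  induction l generalizing σ with
  | nil => exact ⟨by simp, fun _ _ => rfl, fun _ _ => rfl⟩
  | cons j l ihl =>
    rw [List.nodup_cons] at hl
    obtain ⟨a1, a2, a3⟩ := hP j σ (hσ j (by simp)) hv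
    simp only [List.map_cons, Prog.run_block_cons]
    generalize (P j).run I σ = σ₁ at a1 a2 a3 ⊢
    have hne : ∀ j' ∈ l, ∀ p k p' k', arr B (g j' p) k ≠ arr B (g j p') k' :=
      fun j' hj' p k p' k' h => hl.1 (hg _ _ _ _ (arr_inj.1 h).1 ▸ hj')
    obtain ⟨b1, b2, b3⟩ := ihl hl.2 σ₁
      (fun j' hj' => (hσ j' (by simp [hj'])).congr fun p k => a2 _ (hne j' hj' p k))
      (fun x => (a3 _ not_scratch_vr).trans (hv x))
    refine ⟨?_, fun a ha => ?_, fun r hr => (b3 r hr).trans (a3 r hr)⟩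
    · intro j' hj'
      rcases List.mem_cons.1 hj' with rfl | hj'
      · exact a1.congr fun p k => b2 _ fun j' hj' p' k' => (hne j' hj' p' k' p k).symm
      · exact b1 j' hj'
    · rw [b2 a fun j' hj' => ha j' (by simp [hj']), a2 a (ha j (by simp))]

/-- By `Safe.sat_iff_of_not_eqOn` each view can change only at `v`, so after the subtrees have been
repaired, one membership test at `v` and one `setMemberProg` suffice. The tables of different nodes
have different names because `g` is injective, so the repairs do not interfere. -/
theorem run_refresh {Ω : Type} (I : Ω → ℕ → ℕ → ℕ) {A A' : Fin Q.numAtoms → (ℕ → ℕ) → Prop}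
    (hA' : AtomCongr Q A') {i : Fin Q.numAtoms} (hi : S.dynamic (Q.rel i)) {v : ℕ → ℕ}
    (hne : ∀ j, j ≠ i → ∀ u, A j u ↔ A' j u)
    (heq : ∀ u, ¬ Set.EqOn u v (Q.atomVars i) → (A i u ↔ A' i u))
    {b : ℕ} (hb : b ≠ 0 ↔ A' i v) (B : ℕ) {t : ViewTree Q.numAtoms} (ht : t.Safe)
    {K : Finset ℕ} {g : List ℕ → ℕ} (hg : Function.Injective g) {σ : State}
    (hσ : t.Stored Q B σ.mem A K g) (hv : ∀ x, σ.reg (vr B x) = v x) :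
    t.Stored Q B ((refresh Ω Q B i b t K g).run I σ).mem A' K g ∧
    (∀ a, (∀ p k, a ≠ arr B (g p) k) →
      ((refresh Ω Q B i b t K g).run I σ).mem a = σ.mem a) ∧
    ∀ r, ¬ Scratch B r → ((refresh Ω Q B i b t K g).run I σ).reg r = σ.reg r := by
  -- the common last step: recompute the flag and update the table of the root view
  have last : ∀ (t : ViewTree Q.numAtoms), t.Safe → ∀ (K : Finset ℕ) (c : ℕ) (τ : State),
      (Table.ofMem B τ.mem c).Stores K (t.schema Q) (t.Sat Q A) →
      (∀ x, τ.reg (vr B x) = v x) → (τ.reg (sr B 0) ≠ 0 ↔ t.Sat Q A' v) →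
      (Table.ofMem B ((setMemberProg Ω B c K (t.schema Q)).run I τ).mem c).Stores K
        (t.schema Q) (t.Sat Q A') := by
    intro t ht K c τ h1 h2 h3
    rw [(run_setMemberProg I B c K (t.schema Q) τ h2).1]
    exact h1.setMember (fun u w e => Sat.congr hA' t e)
      (fun u hu => ht.sat_iff_of_not_eqOn hi hne heq hu) h3
  induction t generalizing K g σ with
  | atom j =>
    simp only [refresh]
    split_ifs with hij
    · subst hij
      set τ := Prog.run I (.instr (.const (sr B 0) b)) σ with hτ
      have hτv : ∀ x, τ.reg (vr B x) = v x := fun x => by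
        simp [hτ, Prog.run, Instr.apply, State.setReg, hv]
      have h0 : τ.reg (sr B 0) = b := by simp [hτ, Prog.run, Instr.apply, State.setReg]
      have hrun := run_setMemberProg I B (g []) K ((atom i).schema Q) τ hτv
      refine ⟨last (atom i) ht K (g []) τ hσ hτv (by rw [h0]; exact hb),
        fun a ha => hrun.2.1 a (ha []), fun r hr => (hrun.2.2 r hr).trans ?_⟩
      simp only [hτ, Prog.run, Instr.apply, State.setReg]
      exact Function.update_of_ne (fun h => hr (Or.inl ⟨0, by omega, h⟩)) _ _
    · refine ⟨?_, fun _ _ => rfl, fun _ _ => rfl⟩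
      have : A j = A' j := funext fun u => propext (hne j (fun h => hij h.symm) u)
      simp only [Stored, Sat] at hσ ⊢
      change Table.Stores _ _ _ (A' j)
      rw [← this]
      exact hσ
  | proj X c ih =>
    have hg0 : Function.Injective fun p => g (0 :: p) := fun p q h => by simpa using hg h
    obtain ⟨a1, a2, a3⟩ := ih ht.of_proj hg0 hσ.2 hv
    simp only [refresh, Prog.run]
    generalize Prog.run I (refresh Ω Q B i b c X fun p => g (0 :: p)) σ = σ₁ at a1 a2 a3 ⊢
    have hv₁ : ∀ x, σ₁.reg (vr B x) = v x := fun x => (a3 _ not_scratch_vr).trans (hv x)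
    obtain ⟨b1, b2, b3, -⟩ := run_testAll I B [(arr B (g [0]) 1, X.toList.map (vr B))]
      (by simp [not_scratch_vr]) σ₁
    generalize Prog.run I (testAll Ω B _) σ₁ = σ₂ at b1 b2 b3 ⊢
    have hv₂ : ∀ x, σ₂.reg (vr B x) = v x := fun x => (b2 _ not_scratch_vr).trans (hv₁ x)
    have hroot : Table.ofMem B σ₂.mem (g []) = Table.ofMem B σ.mem (g []) :=
      Table.ofMem_congr fun k => by
        rw [b1]
        exact a2 _ fun p k' h => by simpa using hg (arr_inj.1 h).1
    -- The child is grouped by `X`, so a nonzero list length at the key `v` says exactly that `v`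
    -- has an extension in the child.
    have hflag : σ₂.reg (sr B 0) ≠ 0 ↔ (proj X c).Sat Q A' v := by
      rw [b3]
      simp only [List.mem_singleton, forall_eq, map_vr_eq_tup, funext hv₁]
      exact a1.root.len_ne_zero_iff v
    have hrun := run_setMemberProg I B (g []) K ((proj X c).schema Q) σ₂ hv₂
    refine ⟨⟨last (proj X c) ht K (g []) σ₂ (hroot ▸ hσ.1) hv₂ hflag, ?_⟩, fun a ha => ?_,
      fun r hr => ?_⟩
    · refine Stored.congr (mem := σ₁.mem) a1 fun p k => ?_
      rw [hrun.2.1, b1]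
      intro k' h
      simpa using hg (arr_inj.1 h).1
    · rw [hrun.2.1 a (ha []), b1, a2 a fun p => ha _]
    · rw [hrun.2.2 r hr, b2 r hr, a3 r hr]
  | join n c ih =>
    have hgj : ∀ j : ℕ, Function.Injective fun p => g (j :: p) := fun j p q h => by
      simpa using hg h
    obtain ⟨a1, a2, a3⟩ := run_block_refresh I c (fun (j : Fin (n + 1)) p => g ((j : ℕ) :: p))
      (fun i j p q h => by
        have := hg h
        rw [List.cons.injEq] at this
        exact Fin.ext this.1)
      (fun j : Fin (n + 1) => refresh Ω Q B i b (c j) ∅ fun p => g ((j : ℕ) :: p))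
      (fun j σ h h' => ih j (ht.of_join j) (hgj j) h h')
      (List.finRange (n + 1)) (List.nodup_finRange _) σ (fun j _ => hσ.2 j) hv
    simp only [refresh, Prog.run, List.ofFn_eq_map]
    generalize Prog.run I (Prog.block ((List.finRange (n + 1)).map _)) σ = σ₁ at a1 a2 a3 ⊢
    have hv₁ : ∀ x, σ₁.reg (vr B x) = v x := fun x => (a3 _ not_scratch_vr).trans (hv x)
    obtain ⟨b1, b2, b3, -⟩ := run_testAll I B ((List.finRange (n + 1)).map fun j : Fin (n + 1) =>
      (arr B (g [(j : ℕ)]) 0, ((c j).schema Q).toList.map (vr B)))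
      (by simp [not_scratch_vr]) σ₁
    generalize Prog.run I (testAll Ω B _) σ₁ = σ₂ at b1 b2 b3 ⊢
    have hv₂ : ∀ x, σ₂.reg (vr B x) = v x := fun x => (b2 _ not_scratch_vr).trans (hv₁ x)
    have hroot : Table.ofMem B σ₂.mem (g []) = Table.ofMem B σ.mem (g []) :=
      Table.ofMem_congr fun k => by
        rw [b1]
        exact a2 _ fun j _ p k' h => by simpa using hg (arr_inj.1 h).1
    have hflag : σ₂.reg (sr B 0) ≠ 0 ↔ (join n c).Sat Q A' v := by
      rw [b3]
      simp only [List.mem_map, List.mem_finRange, true_and, forall_exists_index,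
        forall_apply_eq_imp_iff, map_vr_eq_tup, funext hv₁]
      exact forall_congr' fun j => (a1 j (List.mem_finRange j)).root.pos_ne_zero_iff v
    have hrun := run_setMemberProg I B (g []) K ((join n c).schema Q) σ₂ hv₂
    refine ⟨⟨last (join n c) ht K (g []) σ₂ (hroot ▸ hσ.1) hv₂ hflag, fun j => ?_⟩,
      fun a ha => ?_, fun r hr => ?_⟩
    · refine Stored.congr (mem := σ₁.mem) (a1 j (List.mem_finRange j)) fun p k => ?_
      rw [hrun.2.1, b1]
      intro k' h
      simpa using hg (arr_inj.1 h).1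
    · rw [hrun.2.1 a (ha []), b1, a2 a fun j _ p => ha _]
    · rw [hrun.2.2 r hr, b2 r hr, a3 r hr]

end ViewTree

/-! ## Updates -/

section forest
variable {S : Vocabulary} {Q : CQ S} (T : Rewriting Q)

/-- The name of the table for the view at the address `p` of the `τ`-th tree. -/
def tableName (τ : ℕ) (p : List ℕ) : ℕ := Encodable.encode (τ, p)

theorem tableName_inj {τ τ' : ℕ} {p p' : List ℕ} :
    tableName τ p = tableName τ' p' ↔ τ = τ' ∧ p = p' := by
  simp [tableName]

/-- All views of the rewriting are stored. -/
def Rewriting.Stored (B : ℕ) (mem : ℕ → List ℕ → ℕ)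
    (A : Fin Q.numAtoms → (ℕ → ℕ) → Prop) : Prop :=
  ∀ τ, (T.tree τ).Stored Q B mem A ∅ (tableName τ)

theorem Rewriting.IsSafe.safe_tree {T : Rewriting Q} (hT : T.IsSafe) (τ : Fin T.numTrees) :
    (T.tree τ).Safe where
  leaf_le i := (Finset.single_le_sum (f := fun τ => (T.tree τ).leafCount i)
    (fun _ _ => Nat.zero_le _) (Finset.mem_univ τ)).trans (hT.leaf_unique i).le
  proj_subset := hT.proj_subset τ
  proj_atoms := hT.proj_atoms τ
  update := hT.update τ

/-- Copy the registers `0, 1, …` to the registers for the variables `a 0, a 1, …`. -/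
def copyProg (Ω : Type) (B : ℕ) {m : ℕ} (a : Fin m → ℕ) : Prog Ω :=
  .block ((List.finRange m).map fun j => .instr (.copy (vr B (a j)) j))

theorem run_copyProg {Ω : Type} (I : Ω → ℕ → ℕ → ℕ) {B m : ℕ} (hm : m ≤ B) {a : Fin m → ℕ}
    (ha : Function.Injective a) (σ : State) :
    ((copyProg Ω B a).run I σ).mem = σ.mem ∧
    (∀ j, ((copyProg Ω B a).run I σ).reg (vr B (a j)) = σ.reg j) ∧
    ∀ r < B, ((copyProg Ω B a).run I σ).reg r = σ.reg r := by
  have key : ∀ (l : List (Fin m)) (σ : State),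
      let σ' := (Prog.block (l.map fun j : Fin m =>
        (.instr (.copy (vr B (a j)) j) : Prog Ω))).run I σ
      σ'.mem = σ.mem ∧ (∀ j ∈ l, σ'.reg (vr B (a j)) = σ.reg j) ∧
        ∀ r, (∀ j ∈ l, r ≠ vr B (a j)) → σ'.reg r = σ.reg r := by
    intro l
    induction l with
    | nil => intro σ; simp
    | cons j l ih =>
      intro σ
      simp only [List.map_cons, Prog.run_block_cons]
      have hlt : ∀ (j : Fin m) x, (j : ℕ) ≠ vr B x := fun j x => by
        have := le_vr (B := B) x; omega
      obtain ⟨h1, h2, h3⟩ := ih (Prog.run I (.instr (.copy (vr B (a j)) j)) σ)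
      refine ⟨h1, fun j' hj' => ?_, fun r hr => ?_⟩
      · by_cases hl : j' ∈ l
        · rw [h2 j' hl]
          simp [Prog.run, Instr.apply, State.setReg, Function.update_of_ne (hlt j' _)]
        · obtain rfl : j' = j := by simpa [hl] using hj'
          rw [h3 _ fun k hk h => hl (by rwa [ha (vr_inj.1 h)])]
          simp [Prog.run, Instr.apply, State.setReg]
      · rw [h3 r fun k hk => hr k (by simp [hk])]
        simp [Prog.run, Instr.apply, State.setReg, Function.update_of_ne (hr j (by simp))]
  obtain ⟨h1, h2, h3⟩ := key (List.finRange m) σ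
  exact ⟨h1, fun j => h2 j (List.mem_finRange j), fun r hr => h3 r fun j _ => by
    have := le_vr (B := B) (a j); omega⟩

/-- Refresh all trees after a change at the `i`-th body atom. -/
noncomputable def refreshAll (Ω : Type) (B : ℕ) (i : Fin Q.numAtoms) (b : ℕ) : Prog Ω :=
  .block ((List.finRange T.numTrees).map fun τ =>
    (T.tree τ).refresh Ω Q B i b ∅ (tableName τ))

/-- The change of the tuple in the registers `0, 1, …` at the `i`-th body atom. -/
noncomputable def atomUpdate (Ω : Type) (B b : ℕ) (i : Fin Q.numAtoms) : Prog Ω :=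
  .seq (copyProg Ω B (Q.args i)) (refreshAll T Ω B i b)

/-- Insert the tuple in the registers `0, 1, …` into the relation `r` if `b = 1`, and delete it
if `b = 0`. -/
noncomputable def updateProg (Ω : Type) (B b : ℕ) (r : Fin S.numRels) : Prog Ω :=
  .block (((List.finRange Q.numAtoms).filter fun i => Q.rel i = r).map (atomUpdate T Ω B b))

theorem straight_updateProg (Ω : Type) (B b : ℕ) (r : Fin S.numRels) :
    (updateProg T Ω B b r).Straight := by
  refine Prog.straight_block fun p hp => ?_
  obtain ⟨i, _, rfl⟩ := List.mem_map.1 hp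
  refine ⟨Prog.straight_block fun p hp => ?_, Prog.straight_block fun p hp => ?_⟩
  · obtain ⟨j, _, rfl⟩ := List.mem_map.1 hp
    trivial
  · obtain ⟨τ, _, rfl⟩ := List.mem_map.1 hp
    exact ViewTree.straight_refresh _ _ _ _ _ _ _

variable {T}

theorem run_atomUpdate {Ω : Type} (I : Ω → ℕ → ℕ → ℕ) (hT : T.IsSafe) {B b : ℕ}
    {i : Fin Q.numAtoms} (hi : S.dynamic (Q.rel i)) (hB : S.arity (Q.rel i) ≤ B)
    {A A' : Fin Q.numAtoms → (ℕ → ℕ) → Prop} (hA' : ViewTree.AtomCongr Q A')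
    (hne : ∀ j, j ≠ i → ∀ u, A j u ↔ A' j u) {σ : State}
    (heq : ∀ u : ℕ → ℕ, ¬ (∀ j, u (Q.args i j) = σ.reg j) → (A i u ↔ A' i u))
    (hb : ∀ u : ℕ → ℕ, (∀ j, u (Q.args i j) = σ.reg j) → (A' i u ↔ b ≠ 0))
    (hσ : T.Stored B σ.mem A) :
    T.Stored B ((atomUpdate T Ω B b i).run I σ).mem A' ∧
      ∀ r < B, ((atomUpdate T Ω B b i).run I σ).reg r = σ.reg r := by
  obtain ⟨a1, a2, a3⟩ := run_copyProg I hB (Q.args_injective i) σ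
  simp only [atomUpdate, Prog.run]
  generalize Prog.run I (copyProg Ω B (Q.args i)) σ = σ₁ at a1 a2 a3 ⊢
  -- Registers of variables outside the atom keep whatever they contained. This is harmless: the
  -- atom changes only where it agrees with `v` on its own variables, and the refresh lemma accepts
  -- any such full valuation.
  set v : ℕ → ℕ := fun x => σ₁.reg (vr B x) with hv
  have hva : ∀ j, v (Q.args i j) = σ.reg j := a2
  obtain ⟨b1, b2, b3⟩ := ViewTree.run_block_refresh I (B := B) (A := A) (A' := A') (v := v) T.tree
    (fun τ => tableName τ) (fun τ τ' p q h => Fin.ext (tableName_inj.1 h).1)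
    (fun τ => (T.tree τ).refresh Ω Q B i b ∅ (tableName τ))
    (fun τ σ h h' => ViewTree.run_refresh I hA' hi hne
      (fun u hu => heq u fun h => hu fun x hx => by
        simp only [CQ.atomVars, Finset.coe_image, Finset.coe_univ, Set.image_univ,
          Set.mem_range] at hx
        obtain ⟨j, rfl⟩ := hx
        rw [h j, hva j])
      (hb v hva).symm B (hT.safe_tree τ) (fun p q h => (tableName_inj.1 h).2) h h')
    (List.finRange T.numTrees) (List.nodup_finRange _) σ₁ (fun τ _ => a1 ▸ hσ τ) (fun _ => rfl)
  refine ⟨fun τ => b1 τ (List.mem_finRange τ), fun r hr => (b3 r ?_).trans (a3 r hr)⟩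
  rintro (⟨k, -, h⟩ | ⟨x, h⟩) <;> simp only [sr, ur] at h <;> omega

theorem run_updateProg {Ω : Type} (I : Ω → ℕ → ℕ → ℕ) (hT : T.IsSafe) {B b : ℕ}
    {r : Fin S.numRels} (hr : S.dynamic r) (hB : S.arity r ≤ B) {D D' : Database S}
    {t : Fin (S.arity r) → ℕ} (hD : ∀ r', r' ≠ r → D' r' = D r')
    (hDr : ∀ s, s ≠ t → (s ∈ D r ↔ s ∈ D' r)) (ht : t ∈ D' r ↔ b ≠ 0) {σ : State}
    (hσ : T.Stored B σ.mem (Q.atomHolds D)) :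
    T.Stored B ((updateProg T Ω B b r).run I (σ.loadTuple t)).mem (Q.atomHolds D') := by
  -- The atoms over `r` are switched from `D` to `D'` one by one. The interpretation `A` is
  -- arbitrary outside `l`, as the atoms treated earlier are already in their new state.
  have key : ∀ l : List (Fin Q.numAtoms), (∀ i ∈ l, Q.rel i = r) → l.Nodup →
      ∀ (A : Fin Q.numAtoms → (ℕ → ℕ) → Prop) (σ : State), ViewTree.AtomCongr Q A →
      (∀ i ∈ l, A i = Q.atomHolds D i) → T.Stored B σ.mem A → (∀ j : Fin (S.arity r), σ.reg j = t j) →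
      T.Stored B ((Prog.block (l.map (atomUpdate T Ω B b))).run I σ).mem
        (fun i => if i ∈ l then Q.atomHolds D' i else A i) := by
    intro l
    induction l with
    | nil => intro _ _ A σ _ _ h _; simpa using h
    | cons i l ih =>
      intro hl hnd A σ hA hAD hσ hreg
      rw [List.nodup_cons] at hnd
      have hi := hl i (by simp)
      have hA' : ViewTree.AtomCongr Q (Function.update A i (Q.atomHolds D' i)) := by
        intro j u v e h
        by_cases hj : j = i
        · subst hj
          rw [Function.update_self] at h ⊢
          exact ViewTree.atomCongr_atomHolds D' j u v e h
        · rw [Function.update_of_ne hj] at h ⊢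
          exact hA j u v e h
      have tupEq : ∀ u : ℕ → ℕ, (∀ j, u (Q.args i j) = σ.reg j) → (Q.atomHolds D' i u ↔ b ≠ 0) := by
        subst hi
        intro u hu
        rw [← ht, CQ.atomHolds, show (fun j => u (Q.args i j)) = t from
          funext fun j => (hu j).trans (hreg j)]
      have tupNe : ∀ u : ℕ → ℕ, ¬ (∀ j, u (Q.args i j) = σ.reg j) →
          (Q.atomHolds D i u ↔ Q.atomHolds D' i u) := by
        subst hi
        intro u hu
        exact hDr _ fun h => hu fun j => (congrFun h j).trans (hreg j).symm
      obtain ⟨h1, h2⟩ := run_atomUpdate I hT (i := i) (hi ▸ hr) (hi ▸ hB) hA'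
        (fun j hj u => by rw [Function.update_of_ne hj])
        (fun u hu => by rw [Function.update_self, hAD i (by simp)]; exact tupNe u hu)
        (fun u hu => by rw [Function.update_self]; exact tupEq u hu) hσ
      have := ih (fun j hj => hl j (by simp [hj])) hnd.2 _ _ hA'
        (fun j hj => by
          rw [Function.update_of_ne (ne_of_mem_of_not_mem hj hnd.1), hAD j (by simp [hj])])
        h1 (fun j => (h2 j (j.2.trans_le hB)).trans (hreg j))
      simp only [List.map_cons, Prog.run_block_cons]
      convert this using 2 with j
      by_cases hj : j = i
      · subst hj; simp [hnd.1]
      · simp [hj]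
  have := key ((List.finRange Q.numAtoms).filter fun i => Q.rel i = r) (by simp)
    ((List.nodup_finRange _).filter _) (Q.atomHolds D) (σ.loadTuple t)
    (ViewTree.atomCongr_atomHolds D) (fun _ _ => rfl) hσ (fun j => by simp [State.loadTuple])
  refine (congrArg (T.Stored B _) (funext fun i => ?_)).mp this
  by_cases hi : Q.rel i = r
  · simp [hi]
  · simp only [List.mem_filter, hi, decide_false, Bool.false_eq_true, and_false, if_false]
    funext u
    simp only [CQ.atomHolds, hD _ hi]

end forest

/-! ## Preprocessing -/

/-- A loop with a body that is free of loops and outputs. -/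
theorem exec_loop {Ω : Type} (I : Ω → ℕ → ℕ → ℕ) {b : Test} {p : Prog Ω} (hp : p.Straight)
    (Inv : ℕ → State → Prop) (n : ℕ) (htest : ∀ i σ, i ≤ n → Inv i σ → (b.Holds σ ↔ i < n))
    (hstep : ∀ i σ, i < n → Inv i σ → Inv (i + 1) (p.run I σ)) (m i : ℕ) (hm : i + m = n)
    (σ : State) (hσ : Inv i σ) :
    ∃ tr σ', Exec I (.loop b p) σ tr σ' ∧ tr.length ≤ m * (p.cost + 1) + 1 ∧ Inv n σ' := by
  induction m generalizing i σ with
  | zero =>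
    obtain rfl : i = n := by omega
    exact ⟨[none], σ, Exec.loop_false _ _ _ (by simp [htest i σ le_rfl hσ]), by simp, hσ⟩
  | succ m ih =>
    obtain ⟨k, hk, hrun⟩ := p.exec_run I hp σ
    obtain ⟨tr, σ', h1, h2, h3⟩ := ih (i + 1) (by omega) _ (hstep i σ (by omega) hσ)
    refine ⟨_, σ', Exec.loop_true _ _ _ _ _ _ _
      ((htest i σ (by omega) hσ).2 (by omega)) hrun h1, ?_, h3⟩
    simp only [List.length_cons, List.length_append, List.length_replicate, add_mul, one_mul]
    omega

/-! ### From materialised views to tables -/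

section materialised
variable {S : Vocabulary} {Q : CQ S}

/-- Load the tuple with the index `sr B 6` of the materialised view `a`. -/
noncomputable def loadTupleProg (Ω : Type) (B a : ℕ) (Y : Finset ℕ) : Prog Ω :=
  .block (Y.toList.map fun x => .seq (.instr (.const (sr B 9) x))
    (.instr (.load (vr B x) a [sr B 6, sr B 9])))

theorem run_loadTupleProg {Ω : Type} (I : Ω → ℕ → ℕ → ℕ) (B a : ℕ) (Y : Finset ℕ) (σ : State) :
    ((loadTupleProg Ω B a Y).run I σ).mem = σ.mem ∧
    (∀ x ∈ Y, ((loadTupleProg Ω B a Y).run I σ).reg (vr B x) =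
      σ.mem a [σ.reg (sr B 6), x]) ∧
    ∀ k ≠ 9, ((loadTupleProg Ω B a Y).run I σ).reg (sr B k) = σ.reg (sr B k) := by
  have key : ∀ (l : List ℕ) (σ : State),
      let σ' := (Prog.block (l.map fun x => (.seq (.instr (.const (sr B 9) x))
        (.instr (.load (vr B x) a [sr B 6, sr B 9])) : Prog Ω))).run I σ
      σ'.mem = σ.mem ∧ (∀ x ∈ l, σ'.reg (vr B x) = σ.mem a [σ.reg (sr B 6), x]) ∧
        (∀ k ≠ 9, σ'.reg (sr B k) = σ.reg (sr B k)) ∧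
        ∀ x ∉ l, σ'.reg (vr B x) = σ.reg (vr B x) := by
    intro l
    induction l with
    | nil => intro σ; simp
    | cons y l ih =>
      intro σ
      simp only [List.map_cons, Prog.run_block_cons]
      set τ := Prog.run I (.seq (.instr (.const (sr B 9) y))
        (.instr (.load (vr B y) a [sr B 6, sr B 9]))) σ with hτ
      have h1 : τ.mem = σ.mem := rfl
      have h2 : τ.reg (vr B y) = σ.mem a [σ.reg (sr B 6), y] := by
        simp [hτ, Prog.run, Instr.apply, State.setReg]
      have h3 : ∀ k ≠ 9, τ.reg (sr B k) = σ.reg (sr B k) := fun k hk => by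
        simp [hτ, Prog.run, Instr.apply, State.setReg, hk]
      have h4 : ∀ x ≠ y, τ.reg (vr B x) = σ.reg (vr B x) := fun x hx => by
        simp [hτ, Prog.run, Instr.apply, State.setReg, hx]
      clear_value τ
      obtain ⟨a1, a2, a3, a4⟩ := ih τ
      refine ⟨a1.trans h1, fun x hx => ?_, fun k hk => (a3 k hk).trans (h3 k hk), fun x hx => ?_⟩
      · by_cases hl : x ∈ l
        · rw [a2 x hl, h1, h3 6 (by omega)]
        · obtain rfl : x = y := by simpa [hl] using hx
          rw [a4 x hl, h2]
      · simp only [List.mem_cons, not_or] at hx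
        rw [a4 x hx.2, h4 x hx.1]
  obtain ⟨h1, h2, h3, -⟩ := key Y.toList σ
  exact ⟨h1, fun x hx => h2 x (by simpa using hx), h3⟩

/-- The body of the loop of `buildTable`. -/
noncomputable def buildTableBody (Ω : Type) (B c a : ℕ) (K Y : Finset ℕ) : Prog Ω :=
  .block [loadTupleProg Ω B a Y, .instr (.const (sr B 0) 1), setMemberProg Ω B c K Y,
    .instr (.add (sr B 6) (sr B 6) (sr B 8))]

/-- Build the table `c` from the materialised view in the array `a`. -/
noncomputable def buildTable (Ω : Type) (B c a : ℕ) (K Y : Finset ℕ) : Prog Ω :=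
  .seq (.block [.instr (.const (sr B 6) 0), .instr (.const (sr B 8) 1),
    .instr (.load (sr B 7) a [])])
    (.loop (.lt (sr B 6) (sr B 7)) (buildTableBody Ω B c a K Y))

theorem straight_buildTableBody (Ω : Type) (B c a : ℕ) (K Y : Finset ℕ) :
    (buildTableBody Ω B c a K Y).Straight := by
  refine ⟨Prog.straight_block fun p hp => ?_, trivial, straight_setMemberProg _ _ _ _, trivial,
    trivial⟩
  obtain ⟨x, _, rfl⟩ := List.mem_map.1 hp
  exact ⟨trivial, trivial⟩

/-- The invariant is that the table holds the first `i` tuples of the list. Each iteration sets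
membership of one tuple, so a repeated tuple would do no harm. In the time bound, 5 is the
initialisation (4 steps) plus the failing last test. -/
theorem exec_buildTable {Ω : Type} (I : Ω → ℕ → ℕ → ℕ) {B c a : ℕ} (ha : a < B)
    {K Y : Finset ℕ} (hK : K ⊆ Y) (σ : State)
    (hσ : ∀ k l, σ.mem (arr B c k) l = 0) :
    ∃ tr σ', Exec I (buildTable Ω B c a K Y) σ tr σ' ∧
      tr.length ≤ σ.mem a [] * ((buildTableBody Ω B c a K Y).cost + 1) + 5 ∧
      (Table.ofMem B σ'.mem c).Stores K Y
        (fun v => ∃ i < σ.mem a [], Set.EqOn v (fun x => σ.mem a [i, x]) Y) ∧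
      ∀ a', (∀ k, a' ≠ arr B c k) → σ'.mem a' = σ.mem a' := by
  have haB : ∀ k, a ≠ arr B c k := fun k => by
    have := le_arr (B := B) c k; omega
  set Inv : ℕ → State → Prop := fun i τ =>
    (Table.ofMem B τ.mem c).Stores K Y
      (fun v => ∃ j < i, Set.EqOn v (fun x => σ.mem a [j, x]) Y) ∧
    (∀ a', (∀ k, a' ≠ arr B c k) → τ.mem a' = σ.mem a') ∧
    τ.reg (sr B 6) = i ∧ τ.reg (sr B 7) = σ.mem a [] ∧ τ.reg (sr B 8) = 1 with hInv
  obtain ⟨n, hn, hinit⟩ := Prog.exec_run I (.block [.instr (.const (sr B 6) 0),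
    .instr (.const (sr B 8) 1), .instr (.load (sr B 7) a [])] : Prog Ω)
    (by simp [Prog.block, Prog.Straight]) σ
  generalize hτ : Prog.run I (.block [.instr (.const (sr B 6) 0),
    .instr (.const (sr B 8) 1), .instr (.load (sr B 7) a [])] : Prog Ω) σ = τ at hinit
  have h0 : Inv 0 τ := by
    have hm : τ.mem = σ.mem := by rw [← hτ]; rfl
    refine ⟨?_, fun a' _ => congrFun hm a', ?_, ?_, ?_⟩
    · simp only [Nat.not_lt_zero, false_and, exists_false]
      refine Table.stores_empty hK (fun k => ?_) (fun k => ?_) <;>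
      · simp only [Table.ofMem, hm]; exact hσ _ _
    all_goals
      rw [← hτ]
      simp [Prog.run, Instr.apply, State.setReg]
  have hstep : ∀ i τ, i < σ.mem a [] → Inv i τ →
      Inv (i + 1) ((buildTableBody Ω B c a K Y).run I τ) := by
    intro i τ hi h
    obtain ⟨i1, i2, i3, i4, i5⟩ := h
    simp only [buildTableBody, Prog.run_block_cons, Prog.run_block_nil]
    obtain ⟨a1, a2, a3⟩ := run_loadTupleProg I B a Y τ
    generalize Prog.run I (loadTupleProg Ω B a Y) τ = τ₁ at a1 a2 a3 ⊢
    set τ₂ := Prog.run I (.instr (.const (sr B 0) 1)) τ₁ with hτ₂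
    have b1 : τ₂.mem = τ.mem := a1
    have b2 : ∀ x ∈ Y, τ₂.reg (vr B x) = σ.mem a [i, x] := fun x hx => by
      rw [← i2 a haB, ← i3, ← a2 x hx]
      simp [hτ₂, Prog.run, Instr.apply, State.setReg]
    have b3 : ∀ k ≠ 9, k ≠ 0 → τ₂.reg (sr B k) = τ.reg (sr B k) := fun k hk hk0 => by
      rw [← a3 k hk]
      simp [hτ₂, Prog.run, Instr.apply, State.setReg, hk0]
    have b4 : τ₂.reg (sr B 0) = 1 := by simp [hτ₂, Prog.run, Instr.apply, State.setReg]
    clear_value τ₂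
    obtain ⟨c1, c2, c3⟩ := run_setMemberProg I B c K Y τ₂ (v := fun x => τ₂.reg (vr B x))
      (fun _ => rfl)
    generalize Prog.run I (setMemberProg Ω B c K Y) τ₂ = τ₃ at c1 c2 c3 ⊢
    have e : Set.EqOn (fun x => τ₂.reg (vr B x)) (fun x => σ.mem a [i, x]) Y := b2
    refine ⟨?_, fun a' ha' => ?_, ?_, ?_, ?_⟩
    · simp only [Prog.run, Instr.apply, State.setReg]
      rw [c1, b1]
      refine i1.setMember ?_ ?_ ?_
      · rintro u w e' ⟨j, hj, h⟩
        exact ⟨j, hj, e'.symm.trans h⟩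
      · intro u hu
        constructor
        · rintro ⟨j, hj, h⟩; exact ⟨j, by omega, h⟩
        · rintro ⟨j, hj, h⟩
          rcases Nat.lt_succ_iff_lt_or_eq.1 hj with hj | rfl
          · exact ⟨j, hj, h⟩
          · exact absurd (h.trans e.symm) hu
      · simp only [b4, ne_eq, one_ne_zero, not_false_eq_true, true_iff]
        exact ⟨i, by omega, e⟩
    · simp only [Prog.run, Instr.apply, State.setReg]
      rw [c2 a' ha', b1, i2 a' ha']
    · simp only [Prog.run, Instr.apply, State.setReg, Function.update_self]
      rw [c3 _ (not_scratch_sr (by omega)), c3 _ (not_scratch_sr (by omega)),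
        b3 6 (by omega) (by omega), b3 8 (by omega) (by omega), i3, i5]
    · simp only [Prog.run, Instr.apply, State.setReg]
      rw [Function.update_of_ne (by simp), c3 _ (not_scratch_sr (by omega)),
        b3 7 (by omega) (by omega), i4]
    · simp only [Prog.run, Instr.apply, State.setReg]
      rw [Function.update_of_ne (by simp), c3 _ (not_scratch_sr (by omega)),
        b3 8 (by omega) (by omega), i5]
  obtain ⟨tr, σ', h1, h2, h3⟩ := exec_loop I (straight_buildTableBody Ω B c a K Y) Inv
    (σ.mem a []) (b := .lt (sr B 6) (sr B 7))
    (fun i τ _ h => by simp only [Test.Holds]; rw [h.2.2.1, h.2.2.2.1])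
    hstep (σ.mem a []) 0 (by omega) τ h0
  refine ⟨_, σ', Exec.seq _ _ _ _ _ _ _ hinit h1, ?_, h3.1, h3.2.1⟩
  simp only [Prog.block, Prog.cost] at hn
  simp only [List.length_append, List.length_replicate]
  omega

theorem ViewStored.congr {D : Database S} {u : ViewTree Q.numAtoms} {σ σ' : State} {a : ℕ}
    (h : ViewStored Q D u σ a) (ha : σ'.mem a = σ.mem a) : ViewStored Q D u σ' a := by
  simpa only [ViewStored, ha] using h

theorem ViewStored.sat_iff {D : Database S} {u : ViewTree Q.numAtoms} {σ : State} {a : ℕ}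
    (h : ViewStored Q D u σ a) :
    u.Sat Q (Q.atomHolds D) =
      fun v => ∃ i < σ.mem a [], Set.EqOn v (fun x => σ.mem a [i, x]) (u.schema Q) := by
  funext v
  refine propext ⟨fun hv => ?_, ?_⟩
  · obtain ⟨i, ⟨hi, e⟩, -⟩ := h.2 v ((ViewTree.holds_iff_sat D u v).2 hv)
    exact ⟨i, hi, fun x hx => (e x hx).symm⟩
  · rintro ⟨i, hi, e⟩
    exact ViewTree.Sat.congr (ViewTree.atomCongr_atomHolds D) u e.symm
      ((ViewTree.holds_iff_sat D u _).1 (h.1 i hi))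

/-- A program that materialises a view needs at least as many steps as the view has tuples,
up to one. -/
theorem ViewStored.length_le {Ω : Type} {I : Ω → ℕ → ℕ → ℕ} {P : Prog Ω} {σ σ' : State}
    {tr : Trace} (hP : Exec I P σ tr σ') {D : Database S} {u : ViewTree Q.numAtoms} {a : ℕ}
    (h : ViewStored Q D u σ' a) (ha : ∀ l, σ.mem a l = 0) : σ'.mem a [] ≤ tr.length + 1 := by
  classical
  obtain ⟨F, hF, hmem⟩ := hP.exists_changed_cells
  set n := σ'.mem a [] with hn
  set Z := (Finset.range n).filter fun i => ∀ x ∈ u.schema Q, σ'.mem a [i, x] = 0 with hZ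
  -- An all-zero tuple can be stored without writing to any cell of its row. Since the list has no
  -- repetitions, there is at most one; it accounts for the `+ 1`.
  have hZ1 : Z.card ≤ 1 := by
    refine Finset.card_le_one.2 fun i hi j hj => ?_
    simp only [hZ, Finset.mem_filter, Finset.mem_range] at hi hj
    have h0 : u.Holds Q D (fun _ => 0) := by
      rw [ViewTree.holds_iff_sat, h.sat_iff]
      exact ⟨i, hi.1, fun x hx => (hi.2 x hx).symm⟩
    exact (h.2 _ h0).unique hi hj
  -- Every other index has a nonzero cell, which the run must have changed. Such cells are distinct
  -- for distinct indices because the index is the first component of the address.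
  have hNZ : (Finset.range n \ Z).card ≤ F.card := by
    have hex : ∀ i ∈ Finset.range n \ Z, ∃ x, σ'.mem a [i, x] ≠ 0 := by
      intro i hi
      simp only [hZ, Finset.mem_sdiff, Finset.mem_range, Finset.mem_filter, not_and,
        not_forall] at hi
      obtain ⟨x, _, hx⟩ := hi.2 hi.1
      exact ⟨x, hx⟩
    choose! w hw using hex
    refine Finset.card_le_card_of_injOn (fun i => (a, [i, w i])) (fun i hi => ?_) ?_
    · by_contra hFi
      exact hw i hi (by rw [hmem a _ hFi, ha])
    · intro i _ j _ hij
      simpa using congrArg (fun y : ℕ × List ℕ => y.2.head?) hij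
  have hsub : Z ⊆ Finset.range n := Finset.filter_subset _ _
  have := Finset.card_sdiff_add_card_eq_card hsub
  rw [Finset.card_range] at this
  omega

/-- The program `P` builds the tables for the view tree `t` from the materialised views in the
arrays `pl p`, in linear time. -/
def Builds {Ω : Type} (I : Ω → ℕ → ℕ → ℕ) (B : ℕ) (P : Prog Ω) (t : ViewTree Q.numAtoms)
    (K : Finset ℕ) (g pl : List ℕ → ℕ) : Prop :=
  ∃ C : ℕ, ∀ (D : Database S) (σ : State) (N : ℕ),
    (∀ p u, t.IsNode p u → ViewStored Q D u σ (pl p) ∧ σ.mem (pl p) [] ≤ N) →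
    (∀ p k l, σ.mem (arr B (g p) k) l = 0) →
    ∃ tr σ', Exec I P σ tr σ' ∧ tr.length ≤ C * (N + 1) ∧
      t.Stored Q B σ'.mem (Q.atomHolds D) K g ∧
      ∀ a, (∀ p k, a ≠ arr B (g p) k) → σ'.mem a = σ.mem a

theorem builds_block {Ω : Type} (I : Ω → ℕ → ℕ → ℕ) {B : ℕ} {ι : Type}
    (t : ι → ViewTree Q.numAtoms) (g pl : ι → List ℕ → ℕ)
    (hg : ∀ i j p q, g i p = g j q → i = j)
    (hpl : ∀ j p u, (t j).IsNode p u → pl j p < B) (P : ι → Prog Ω)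
    (hP : ∀ j, Builds I B (P j) (t j) ∅ (g j) (pl j)) (l : List ι) (hl : l.Nodup) :
    ∃ C : ℕ, ∀ (D : Database S) (σ : State) (N : ℕ),
      (∀ j ∈ l, ∀ p u, (t j).IsNode p u →
        ViewStored Q D u σ (pl j p) ∧ σ.mem (pl j p) [] ≤ N) →
      (∀ j ∈ l, ∀ p k m, σ.mem (arr B (g j p) k) m = 0) →
      ∃ tr σ', Exec I (.block (l.map P)) σ tr σ' ∧ tr.length ≤ C * (N + 1) ∧
        (∀ j ∈ l, (t j).Stored Q B σ'.mem (Q.atomHolds D) ∅ (g j)) ∧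
        ∀ a, (∀ j ∈ l, ∀ p k, a ≠ arr B (g j p) k) → σ'.mem a = σ.mem a := by
  induction l with
  | nil =>
    exact ⟨1, fun D σ N _ _ => ⟨_, σ, Exec.instr .skip σ, by simp, by simp, fun _ _ => rfl⟩⟩
  | cons j l ih =>
    rw [List.nodup_cons] at hl
    obtain ⟨C, hC⟩ := hP j
    obtain ⟨C', hC'⟩ := ih hl.2
    refine ⟨C + C', fun D σ N h1 h2 => ?_⟩
    have hne : ∀ j' ∈ l, ∀ p k p' k', arr B (g j' p) k ≠ arr B (g j p') k' :=
      fun j' hj' p k p' k' h => hl.1 (hg _ _ _ _ (arr_inj.1 h).1 ▸ hj')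
    obtain ⟨tr, σ₁, a1, a2, a3, a4⟩ := hC D σ N (h1 j (by simp)) (h2 j (by simp))
    have hsame : ∀ j' p u, (t j').IsNode p u → σ₁.mem (pl j' p) = σ.mem (pl j' p) :=
      fun j' p u hu => a4 _ fun p' k h => by
        have := hpl j' p u hu
        have := le_arr (B := B) (g j p') k
        omega
    obtain ⟨tr', σ', b1, b2, b3, b4⟩ := hC' D σ₁ N
      (fun j' hj' p u hu => by
        obtain ⟨k1, k2⟩ := h1 j' (by simp [hj']) p u hu
        exact ⟨k1.congr (hsame j' p u hu), by rwa [hsame j' p u hu]⟩)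
      (fun j' hj' p k m => by rw [a4 _ (hne j' hj' p k)]; exact h2 j' (by simp [hj']) p k m)
    refine ⟨tr ++ tr', σ', Exec.seq _ _ _ _ _ _ _ a1 b1, ?_, ?_, fun a ha => ?_⟩
    · rw [List.length_append, add_mul]; omega
    · intro j' hj'
      rcases List.mem_cons.1 hj' with rfl | hj'
      · exact a3.congr fun p k => by
          rw [b4 _ fun j' hj' p' k' => (hne j' hj' p' k' p k).symm]
      · exact b3 j' hj'
    · rw [b4 a fun j' hj' => ha j' (by simp [hj']), a4 a (ha j (by simp))]

/-- Build the tables for a view tree from the materialised views. -/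
noncomputable def buildTree (Ω : Type) (Q : CQ S) (B : ℕ) :
    ViewTree Q.numAtoms → Finset ℕ → (List ℕ → ℕ) → (List ℕ → ℕ) → Prog Ω
  | .atom j, K, g, pl => buildTable Ω B (g []) (pl []) K ((ViewTree.atom j).schema Q)
  | .proj X c, K, g, pl =>
    .seq (buildTable Ω B (g []) (pl []) K ((ViewTree.proj X c).schema Q))
      (buildTree Ω Q B c X (fun p => g (0 :: p)) fun p => pl (0 :: p))
  | .join n c, K, g, pl =>
    .seq (buildTable Ω B (g []) (pl []) K ((ViewTree.join n c).schema Q))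
      (.block ((List.finRange (n + 1)).map fun j : Fin (n + 1) =>
        buildTree Ω Q B (c j) ∅ (fun p => g ((j : ℕ) :: p)) fun p => pl ((j : ℕ) :: p)))

theorem exec_buildTable_root {Ω : Type} (I : Ω → ℕ → ℕ → ℕ) {B : ℕ} (t : ViewTree Q.numAtoms)
    {K : Finset ℕ} (hK : K ⊆ t.schema Q) {c a : ℕ} (ha : a < B) :
    ∃ C : ℕ, ∀ (D : Database S) (σ : State) (N : ℕ), ViewStored Q D t σ a → σ.mem a [] ≤ N →
      (∀ k l, σ.mem (arr B c k) l = 0) →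
      ∃ tr σ', Exec I (buildTable Ω B c a K (t.schema Q)) σ tr σ' ∧ tr.length ≤ C * (N + 1) ∧
        (Table.ofMem B σ'.mem c).Stores K (t.schema Q) (t.Sat Q (Q.atomHolds D)) ∧
        ∀ a', (∀ k, a' ≠ arr B c k) → σ'.mem a' = σ.mem a' := by
  refine ⟨(buildTableBody Ω B c a K (t.schema Q)).cost + 1 + 5, fun D σ N h1 h2 h3 => ?_⟩
  obtain ⟨tr, σ', k1, k2, k3, k4⟩ := exec_buildTable (Ω := Ω) I ha hK σ h3
  refine ⟨tr, σ', k1, k2.trans ?_, by rw [h1.sat_iff]; exact k3, k4⟩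
  nlinarith [Nat.mul_le_mul_right ((buildTableBody Ω B c a K (t.schema Q)).cost + 1) h2]

/-- The materialised views lie in arrays below `B` and the tables above, so building one table
neither spoils the remaining input nor the tables already built. `proj_subset` makes `X` an
admissible key for the child of a projection view. -/
theorem builds_buildTree {Ω : Type} (I : Ω → ℕ → ℕ → ℕ) {B : ℕ} {t : ViewTree Q.numAtoms}
    (ht : t.Safe) {K : Finset ℕ} (hK : K ⊆ t.schema Q) {g pl : List ℕ → ℕ}
    (hg : Function.Injective g) (hpl : ∀ p u, t.IsNode p u → pl p < B) :
    Builds I B (buildTree Ω Q B t K g pl) t K g pl := by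
  induction t generalizing K g pl with
  | atom j =>
    obtain ⟨C, hC⟩ := exec_buildTable_root I (Ω := Ω) (.atom j) hK (c := g [])
      (hpl [] _ (.root _))
    refine ⟨C, fun D σ N h1 h2 => ?_⟩
    obtain ⟨k1, k2⟩ := h1 [] _ (.root _)
    obtain ⟨tr, σ', l1, l2, l3, l4⟩ := hC D σ N k1 k2 (h2 [])
    exact ⟨tr, σ', l1, l2, l3, fun a ha => l4 a (ha [])⟩
  | proj X c ih =>
    obtain ⟨C, hC⟩ := exec_buildTable_root I (Ω := Ω) (.proj X c) hK (c := g [])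
      (hpl [] _ (.root _))
    obtain ⟨C', hC'⟩ := ih ht.of_proj (ht.proj_subset [] X c (.root _))
      (g := fun p => g (0 :: p)) (pl := fun p => pl (0 :: p)) (fun p q h => by simpa using hg h)
      (fun p u hu => hpl (0 :: p) u (.proj _ _ _ _ hu))
    refine ⟨C + C', fun D σ N h1 h2 => ?_⟩
    obtain ⟨k1, k2⟩ := h1 [] _ (.root _)
    obtain ⟨tr, σ₁, l1, l2, l3, l4⟩ := hC D σ N k1 k2 (h2 [])
    have hsame : ∀ p u, (ViewTree.proj X c).IsNode p u → σ₁.mem (pl p) = σ.mem (pl p) :=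
      fun p u hu => l4 _ fun k h => by
        have := hpl p u hu
        have := le_arr (B := B) (g []) k
        omega
    obtain ⟨tr', σ', m1, m2, m3, m4⟩ := hC' D σ₁ N
      (fun p u hu => by
        have hu' := ViewTree.IsNode.proj X c p u hu
        obtain ⟨k1, k2⟩ := h1 _ _ hu'
        exact ⟨k1.congr (hsame _ _ hu'), by rwa [hsame _ _ hu']⟩)
      (fun p k m => by
        rw [l4 _ fun k' h => by simpa using hg (arr_inj.1 h).1]; exact h2 (0 :: p) k m)
    refine ⟨tr ++ tr', σ', Exec.seq _ _ _ _ _ _ _ l1 m1, ?_, ⟨?_, m3⟩, fun a ha => ?_⟩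
    · rw [List.length_append, add_mul]; omega
    · rw [Table.ofMem_congr fun k => m4 _ fun p k' h => by simpa using hg (arr_inj.1 h).1]
      exact l3
    · rw [m4 a fun p => ha _, l4 a (ha [])]
  | join n c ih =>
    obtain ⟨C, hC⟩ := exec_buildTable_root I (Ω := Ω) (.join n c) hK (c := g [])
      (hpl [] _ (.root _))
    obtain ⟨C', hC'⟩ := builds_block I (B := B) c (fun (j : Fin (n + 1)) p => g ((j : ℕ) :: p))
      (fun (j : Fin (n + 1)) p => pl ((j : ℕ) :: p))
      (fun i j p q h => by
        have := hg h
        rw [List.cons.injEq] at this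
        exact Fin.ext this.1)
      (fun j p u hu => hpl _ u (.join _ _ _ _ _ hu))
      (fun j : Fin (n + 1) =>
        buildTree Ω Q B (c j) ∅ (fun p => g ((j : ℕ) :: p)) fun p => pl ((j : ℕ) :: p))
      (fun j => ih j (ht.of_join j) (Finset.empty_subset _) (fun p q h => by simpa using hg h)
        (fun p u hu => hpl _ u (.join _ _ _ _ _ hu)))
      (List.finRange (n + 1)) (List.nodup_finRange _)
    refine ⟨C + C', fun D σ N h1 h2 => ?_⟩
    obtain ⟨k1, k2⟩ := h1 [] _ (.root _)
    obtain ⟨tr, σ₁, l1, l2, l3, l4⟩ := hC D σ N k1 k2 (h2 [])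
    have hsame : ∀ p u, (ViewTree.join n c).IsNode p u → σ₁.mem (pl p) = σ.mem (pl p) :=
      fun p u hu => l4 _ fun k h => by
        have := hpl p u hu
        have := le_arr (B := B) (g []) k
        omega
    obtain ⟨tr', σ', m1, m2, m3, m4⟩ := hC' D σ₁ N
      (fun j _ p u hu => by
        have hu' := ViewTree.IsNode.join n c j p u hu
        obtain ⟨k1, k2⟩ := h1 _ _ hu'
        exact ⟨k1.congr (hsame _ _ hu'), by rwa [hsame _ _ hu']⟩)
      (fun j _ p k m => by
        rw [l4 _ fun k' h => by simpa using hg (arr_inj.1 h).1]; exact h2 _ k m)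
    refine ⟨tr ++ tr', σ', Exec.seq _ _ _ _ _ _ _ l1 m1, ?_,
      ⟨?_, fun j => m3 j (List.mem_finRange j)⟩, fun a ha => ?_⟩
    · rw [List.length_append, add_mul]; omega
    · rw [Table.ofMem_congr fun k => m4 _ fun j _ p k' h => by simpa using hg (arr_inj.1 h).1]
      exact l3
    · rw [m4 a fun j _ p => ha _, l4 a (ha [])]

end materialised

/-! ### Total preprocessing time -/

section preprocessing
variable {S : Vocabulary} {Q : CQ S} (T : Rewriting Q)

/-- Build the tables for all views of the rewriting. -/
noncomputable def buildProg (Ω : Type) (B : ℕ) (place : Fin T.numTrees → List ℕ → ℕ) : Prog Ω :=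
  .block ((List.finRange T.numTrees).map fun τ =>
    buildTree Ω Q B (T.tree τ) ∅ (tableName τ) (place τ))

/-- `place` is defined on all addresses, but only finitely many of them are nodes, so the array
names in use are bounded. -/
theorem exists_place_bound (t : ViewTree Q.numAtoms) (pl : List ℕ → ℕ) :
    ∃ B, ∀ p u, t.IsNode p u → pl p < B := by
  induction t generalizing pl with
  | atom i => exact ⟨pl [] + 1, fun p u h => by cases h; omega⟩
  | proj X c ih =>
    obtain ⟨B, hB⟩ := ih fun p => pl (0 :: p)
    refine ⟨max (pl [] + 1) B, fun p u h => ?_⟩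
    cases h with
    | root => omega
    | proj _ _ _ _ h => exact lt_max_of_lt_right (hB _ _ h)
  | join n c ih =>
    choose B hB using fun j : Fin (n + 1) => ih j fun p => pl ((j : ℕ) :: p)
    refine ⟨max (pl [] + 1) (∑ j, B j), fun p u h => ?_⟩
    cases h with
    | root => omega
    | join _ _ j _ _ h =>
      exact lt_max_of_lt_right ((hB j _ _ h).trans_le
        (Finset.single_le_sum (fun _ _ => Nat.zero_le _) (Finset.mem_univ j)))

variable {T}

/-- The time is compared with the actual run `tr₁` of the materialisation program, which bounds
every view size by `ViewStored.length_le`. -/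
theorem exec_preprocessing {Ω : Type} {I : Ω → ℕ → ℕ → ℕ} (hT : T.IsSafe) {B : ℕ} {P : Prog Ω}
    {place : Fin T.numTrees → List ℕ → ℕ} (hSB : S.numRels ≤ B) (hPB : P.arrayBound ≤ B)
    (hplace : ∀ τ p u, (T.tree τ).IsNode p u → place τ p < B)
    (hplace' : ∀ τ p, S.numRels ≤ place τ p) :
    ∃ C : ℕ, ∀ (D : Database S) (σ : State), IsInput D σ → ∀ tr₁ σ₁, Exec I P σ tr₁ σ₁ →
      (∀ τ p u, (T.tree τ).IsNode p u → ViewStored Q D u σ₁ (place τ p)) →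
      ∃ tr σ', Exec I (.seq P (buildProg T Ω B place)) σ tr σ' ∧ tr.length ≤ C * tr₁.length ∧
        T.Stored B σ'.mem (Q.atomHolds D) := by
  obtain ⟨C, hC⟩ := builds_block I (B := B) T.tree (fun τ => tableName τ) place
    (fun τ τ' p q h => Fin.ext (tableName_inj.1 h).1) hplace
    (fun τ => buildTree Ω Q B (T.tree τ) ∅ (tableName τ) (place τ))
    (fun τ => builds_buildTree I (hT.safe_tree τ) (Finset.empty_subset _)
      (fun p q h => (tableName_inj.1 h).2) (hplace τ)) (List.finRange T.numTrees)
    (List.nodup_finRange _)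
  -- All views have size at most `tr₁.length + 1`, so building costs at most `C * (tr₁.length + 2)`,
  -- which is at most `3 * C * tr₁.length` as the run is nonempty.
  refine ⟨1 + 3 * C, fun D σ hσ tr₁ σ₁ h1 h2 => ?_⟩
  have hzero : ∀ a ≥ S.numRels, ∀ l, σ.mem a l = 0 := by
    obtain ⟨L, -, rfl⟩ := hσ
    intro a ha l
    simp [inputState, Nat.not_lt.2 ha]
  obtain ⟨tr₂, σ₂, k1, k2, k3, -⟩ := hC D σ₁ (tr₁.length + 1)
    (fun τ _ p u hu => ⟨h2 τ p u hu,
      (h2 τ p u hu).length_le h1 fun l => hzero _ (hplace' τ p) l⟩)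
    (fun τ _ p k m => by
      rw [h1.mem_eq_of_arrayBound_le _ (hPB.trans (le_arr _ _))]
      exact hzero _ (hSB.trans (le_arr _ _)) m)
  refine ⟨tr₁ ++ tr₂, σ₂, Exec.seq _ _ _ _ _ _ _ h1 k1, ?_, fun τ => k3 τ (List.mem_finRange τ)⟩
  have := h1.trace_length_pos
  rw [List.length_append]
  nlinarith

end preprocessing

/-! ## Traces with bounded delay -/

namespace Trace

/-- A trace with an output, at most `a` silent steps at the beginning and at the end, and at most
`2 * a` silent steps between outputs. -/
structure Steady (a : ℕ) (tr : Trace) : Prop where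
  out : ∃ e ∈ tr, e ≠ none
  pre : ∀ s, s <+: tr → (∀ e ∈ s, e = none) → s.length ≤ a
  suf : ∀ s, s <:+ tr → (∀ e ∈ s, e = none) → s.length ≤ a
  inf : ∀ s, s <:+: tr → (∀ e ∈ s, e = none) → s.length ≤ 2 * a

theorem steady_singleton (y : List ℕ) : Steady 0 [some y] where
  out := ⟨some y, by simp, by simp⟩
  pre s hs h := by
    cases s with
    | nil => simp
    | cons e s =>
      have := hs.subset (List.mem_cons_self ..)
      rw [h e (by simp)] at this
      simp at this
  suf s hs h := by
    cases s with
    | nil => simp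
    | cons e s =>
      have := hs.subset (List.mem_cons_self ..)
      rw [h e (by simp)] at this
      simp at this
  inf s hs h := by
    cases s with
    | nil => simp
    | cons e s =>
      have := hs.subset (List.mem_cons_self ..)
      rw [h e (by simp)] at this
      simp at this

variable {a b : ℕ} {t t' : Trace}

theorem Steady.not_prefix (ht : Steady a t) {s : Trace} (hs : ∀ e ∈ s, e = none) :
    ¬ t <+: s := fun h => by
  obtain ⟨e, he, hne⟩ := ht.out
  exact hne (hs e (h.subset he))

theorem Steady.not_suffix (ht : Steady a t) {s : Trace} (hs : ∀ e ∈ s, e = none) :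
    ¬ t <:+ s := fun h => by
  obtain ⟨e, he, hne⟩ := ht.out
  exact hne (hs e (h.subset he))

/-- A silent stretch across the seam is a silent end followed by a silent beginning, hence the
factor 2. As both parts contain an output, no stretch crosses a whole part, so the bound does not
grow with the number of parts. -/
theorem Steady.append (ht : Steady a t) (ht' : Steady a t') : Steady a (t ++ t') where
  out := by
    obtain ⟨e, he, hne⟩ := ht.out
    exact ⟨e, List.mem_append_left _ he, hne⟩
  pre s hs h :=
    (List.prefix_or_prefix_of_prefix hs (List.prefix_append t t')).elim (ht.pre s · h)
      fun h' => absurd h' (ht.not_prefix h)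
  suf s hs h :=
    (List.suffix_or_suffix_of_suffix hs (List.suffix_append t t')).elim (ht'.suf s · h)
      fun h' => absurd h' (ht'.not_suffix h)
  inf s hs h := by
    rcases List.infix_append_iff.1 hs with h1 | h1 | ⟨s₁, s₂, rfl, h1, h2⟩
    · exact ht.inf s h1 h
    · exact ht'.inf s h1 h
    · have := ht.suf s₁ h1 fun e he => h e (by simp [he])
      have := ht'.pre s₂ h2 fun e he => h e (by simp [he])
      rw [List.length_append]
      omega

/-- Only the gap before the first output grows; the other gaps remain within the old bounds. -/
theorem Steady.pad_left (ht : Steady a t) {n : ℕ} (hn : n ≤ b) :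
    Steady (a + b) (List.replicate n none ++ t) where
  out := by
    obtain ⟨e, he, hne⟩ := ht.out
    exact ⟨e, List.mem_append_right _ he, hne⟩
  pre s hs h := by
    rcases List.prefix_or_prefix_of_prefix hs (List.prefix_append _ t) with h' | ⟨s', rfl⟩
    · have := h'.length_le
      rw [List.length_replicate] at this
      omega
    · have := ht.pre s' ((List.prefix_append_right_inj _).1 hs) fun e he => h e (by simp [he])
      rw [List.length_append, List.length_replicate]
      omega
  suf s hs h := by
    rcases List.suffix_or_suffix_of_suffix hs (List.suffix_append _ t) with h' | h'
    · have := ht.suf s h' h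
      omega
    · exact absurd h' (ht.not_suffix h)
  inf s hs h := by
    rcases List.infix_append_iff.1 hs with h1 | h1 | ⟨s₁, s₂, rfl, h1, h2⟩
    · have := h1.length_le
      rw [List.length_replicate] at this
      omega
    · have := ht.inf s h1 h
      omega
    · have h3 := h1.length_le
      rw [List.length_replicate] at h3
      have := ht.pre s₂ h2 fun e he => h e (by simp [he])
      rw [List.length_append]
      omega

theorem Steady.pad_right (ht : Steady a t) {n : ℕ} (hn : n ≤ b) :
    Steady (a + b) (t ++ List.replicate n none) where
  out := by
    obtain ⟨e, he, hne⟩ := ht.out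
    exact ⟨e, List.mem_append_left _ he, hne⟩
  pre s hs h := by
    rcases List.prefix_or_prefix_of_prefix hs (List.prefix_append t _) with h' | h'
    · have := ht.pre s h' h
      omega
    · exact absurd h' (ht.not_prefix h)
  suf s hs h := by
    rcases List.suffix_or_suffix_of_suffix hs (List.suffix_append t _) with h' | ⟨s', rfl⟩
    · have := h'.length_le
      rw [List.length_replicate] at this
      omega
    · have hs' : s' <:+ t := by
        obtain ⟨p, hp⟩ := hs
        rw [← List.append_assoc] at hp
        exact ⟨p, List.append_cancel_right hp⟩
      have := ht.suf s' hs' fun e he => h e (by simp [he])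
      rw [List.length_append, List.length_replicate]
      omega
  inf s hs h := by
    rcases List.infix_append_iff.1 hs with h1 | h1 | ⟨s₁, s₂, rfl, h1, h2⟩
    · have := ht.inf s h1 h
      omega
    · have := h1.length_le
      rw [List.length_replicate] at this
      omega
    · have h3 := h2.length_le
      rw [List.length_replicate] at h3
      have := ht.suf s₁ h1 fun e he => h e (by simp [he])
      rw [List.length_append]
      omega

theorem outputs_append (t t' : Trace) : outputs (t ++ t') = outputs t ++ outputs t' := by
  simp [outputs]

theorem outputs_replicate (n : ℕ) : outputs (List.replicate n none) = [] := by
  simp [outputs]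

end Trace

/-! ## Nested loops -/

section enumeration
variable {S : Vocabulary} {Q : CQ S}

/-- A loop over the tuples with a given key in the table `code` for the root view of `tree`. -/
structure Level (Q : CQ S) where
  code : ℕ
  key : Finset ℕ
  tree : ViewTree Q.numAtoms

namespace Level

/-- The variables of the view. -/
def vars (ℓ : Level Q) : Finset ℕ := ℓ.tree.schema Q

/-- The table contains the view. -/
def Stored (B : ℕ) (mem : ℕ → List ℕ → ℕ) (A : Fin Q.numAtoms → (ℕ → ℕ) → Prop)
    (ℓ : Level Q) : Prop :=
  (Table.ofMem B mem ℓ.code).Stores ℓ.key ℓ.vars (ℓ.tree.Sat Q A)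

/-- The number of tuples with the key given by `v`. -/
noncomputable def count (B : ℕ) (mem : ℕ → List ℕ → ℕ) (ℓ : Level Q) (v : ℕ → ℕ) : ℕ :=
  mem (arr B ℓ.code 1) (tup v ℓ.key)

/-- The valuation `v`, extended by the `i`-th tuple with the key given by `v`. -/
noncomputable def extend (B : ℕ) (mem : ℕ → List ℕ → ℕ) (ℓ : Level Q) (v : ℕ → ℕ) (i : ℕ) :
    ℕ → ℕ :=
  fun x => if x ∈ ℓ.vars \ ℓ.key then mem (arr B ℓ.code (x + 2)) (i :: tup v ℓ.key) else v x

variable {B : ℕ} {mem : ℕ → List ℕ → ℕ} {A : Fin Q.numAtoms → (ℕ → ℕ) → Prop} {ℓ : Level Q}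

/-- The position recovers `i` from the extended valuation, so different iterations of the loop
assign different tuples. -/
theorem Stored.extend (h : ℓ.Stored B mem A) {v : ℕ → ℕ} {i : ℕ} (hi : i < ℓ.count B mem v) :
    mem (arr B ℓ.code 0) (tup (ℓ.extend B mem v i) ℓ.vars) = i + 1 ∧
      ℓ.tree.Sat Q A (ℓ.extend B mem v i) := by
  obtain ⟨h1, h2⟩ := h.entry v i hi
  have e : Set.EqOn (ℓ.extend B mem v i)
      (fun x => (Table.ofMem B mem ℓ.code).elem x (i :: tup v ℓ.key)) ℓ.vars := by
    intro x hx
    by_cases hk : x ∈ ℓ.key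
    · simp only [Level.extend, Finset.mem_sdiff, hk, not_true_eq_false, and_false, if_false]
      exact (h2 x hk).symm
    · simp only [Level.extend, Finset.mem_sdiff, hk, not_false_eq_true, and_true]
      exact if_pos hx
  rw [← tup_eq_iff.2 e] at h1
  exact ⟨h1, (h.pos_ne_zero_iff _).1 (by rw [h1]; omega)⟩

theorem extend_eqOn {V : Finset ℕ} (hV : ∀ x ∈ ℓ.vars, x ∈ V → x ∈ ℓ.key) (v : ℕ → ℕ) (i : ℕ) :
    Set.EqOn (ℓ.extend B mem v i) v V := by
  intro x hx
  simp only [extend, Finset.mem_sdiff]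
  rw [if_neg]
  exact fun h => h.2 (hV x h.1 hx)

theorem Stored.exists_extend (h : ℓ.Stored B mem A) {u v : ℕ → ℕ} (hu : ℓ.tree.Sat Q A u)
    (huv : Set.EqOn u v ℓ.key) :
    ∃ i < ℓ.count B mem v, Set.EqOn u (ℓ.extend B mem v i) ℓ.vars := by
  obtain ⟨h1, h2, h3⟩ := h.mem u hu
  rw [tup_eq_iff.2 huv] at h2 h3
  refine ⟨_, (show (Table.ofMem B mem ℓ.code).pos (tup u ℓ.vars) - 1 < _ by
    simp only [count]; exact Nat.lt_of_lt_of_le (by omega) h2), fun x hx => ?_⟩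
  simp only [Level.extend, Finset.mem_sdiff]
  split_ifs with hk
  · exact (h3 x hx).symm
  · exact huv (by by_contra hk'; exact hk ⟨hx, hk'⟩)

end Level

/-- The valuations at the innermost position of nested loops. -/
noncomputable def enumVals (B : ℕ) (mem : ℕ → List ℕ → ℕ) :
    List (Level Q) → (ℕ → ℕ) → List (ℕ → ℕ)
  | [], v => [v]
  | ℓ :: ls, v =>
    (List.range (ℓ.count B mem v)).flatMap fun i => enumVals B mem ls (ℓ.extend B mem v i)

/-- Nested loops behave well if they are started with a valuation of the variables in `V` that
satisfies `H`: the keys are known in time, no variable is assigned twice, and no loop is empty. -/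
def Adequate (A : Fin Q.numAtoms → (ℕ → ℕ) → Prop) :
    ((ℕ → ℕ) → Prop) → Finset ℕ → List (Level Q) → Prop
  | _, _, [] => True
  | H, V, ℓ :: ls => ℓ.key ⊆ V ∧ (∀ x ∈ ℓ.vars, x ∈ V → x ∈ ℓ.key) ∧
    (∀ v, H v → ∃ w, (∀ x ∈ ℓ.key, w x = v x) ∧ ℓ.tree.Sat Q A w) ∧
    Adequate A (fun v => H v ∧ ℓ.tree.Sat Q A v) (V ∪ ℓ.vars) ls

/-- The variables assigned by nested loops. -/
def levelVars (ls : List (Level Q)) : Finset ℕ := ls.foldr (fun ℓ V => ℓ.vars ∪ V) ∅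

theorem mem_levelVars {ls : List (Level Q)} {x : ℕ} :
    x ∈ levelVars ls ↔ ∃ ℓ ∈ ls, x ∈ ℓ.vars := by
  induction ls with
  | nil => simp [levelVars]
  | cons ℓ ls ih =>
    simp only [levelVars, List.foldr_cons, Finset.mem_union, List.mem_cons, exists_eq_or_imp]
    exact or_congr_right ih

/-! ### Which valuations nested loops visit -/

section
variable {B : ℕ} {mem : ℕ → List ℕ → ℕ} {A : Fin Q.numAtoms → (ℕ → ℕ) → Prop}

/-- The inner loops start knowing more than `H` and with more assigned variables than `V`, but with
none beyond those of `l₁`. They must therefore be adequate for all such `H'` and `V'`. -/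
theorem Adequate.append {H : (ℕ → ℕ) → Prop} {V : Finset ℕ} {l₁ l₂ : List (Level Q)}
    (h₁ : Adequate A H V l₁)
    (h₂ : ∀ (H' : (ℕ → ℕ) → Prop) (V' : Finset ℕ), (∀ v, H' v → H v) → V ⊆ V' →
      (∀ x ∈ V', x ∈ V ∨ x ∈ levelVars l₁) → Adequate A H' V' l₂) :
    Adequate A H V (l₁ ++ l₂) := by
  induction l₁ generalizing H V with
  | nil => exact h₂ H V (fun _ h => h) (Finset.Subset.refl _) fun x hx => Or.inl hx
  | cons ℓ l₁ ih =>
    obtain ⟨a1, a2, a3, a4⟩ := h₁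
    refine ⟨a1, a2, a3, ih a4 fun H' V' b1 b2 b3 => h₂ H' V' (fun v h => (b1 v h).1)
      (Finset.subset_union_left.trans b2) fun x hx => ?_⟩
    simp only [levelVars, List.foldr_cons, Finset.mem_union] at b3 ⊢
    rcases b3 x hx with (h | h) | h
    · exact Or.inl h
    · exact Or.inr (Or.inl h)
    · exact Or.inr (Or.inr h)

theorem mem_enumVals (hA : ViewTree.AtomCongr Q A) {ls : List (Level Q)} {H : (ℕ → ℕ) → Prop}
    {V : Finset ℕ} (had : Adequate A H V ls) (hst : ∀ ℓ ∈ ls, ℓ.Stored B mem A) {u v : ℕ → ℕ}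
    (hu : u ∈ enumVals B mem ls v) : Set.EqOn u v V ∧ ∀ ℓ ∈ ls, ℓ.tree.Sat Q A u := by
  induction ls generalizing H V v with
  | nil =>
    obtain rfl : u = v := by simpa [enumVals] using hu
    exact ⟨fun _ _ => rfl, by simp⟩
  | cons ℓ ls ih =>
    obtain ⟨a1, a2, a3, a4⟩ := had
    simp only [enumVals, List.mem_flatMap, List.mem_range] at hu
    obtain ⟨i, hi, hu⟩ := hu
    obtain ⟨b1, b2⟩ := ih a4 (fun ℓ hℓ => hst ℓ (by simp [hℓ])) hu
    rw [Finset.coe_union, Set.eqOn_union] at b1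
    refine ⟨b1.1.trans (Level.extend_eqOn a2 v i), fun ℓ' hℓ' => ?_⟩
    rcases List.mem_cons.1 hℓ' with rfl | hℓ'
    · exact ViewTree.Sat.congr hA _ b1.2.symm ((hst ℓ' (by simp)).extend hi).2
    · exact b2 ℓ' hℓ'

theorem exists_mem_enumVals {ls : List (Level Q)} {H : (ℕ → ℕ) → Prop}
    {V : Finset ℕ} (had : Adequate A H V ls) (hst : ∀ ℓ ∈ ls, ℓ.Stored B mem A) {u v : ℕ → ℕ}
    (huv : Set.EqOn u v V) (hu : ∀ ℓ ∈ ls, ℓ.tree.Sat Q A u) :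
    ∃ u' ∈ enumVals B mem ls v, Set.EqOn u u' (V ∪ levelVars ls : Finset ℕ) := by
  induction ls generalizing H V v with
  | nil => exact ⟨v, by simp [enumVals], by simpa [levelVars] using huv⟩
  | cons ℓ ls ih =>
    obtain ⟨a1, a2, a3, a4⟩ := had
    obtain ⟨i, hi, e⟩ := (hst ℓ (by simp)).exists_extend (hu ℓ (by simp))
      (huv.mono (by exact_mod_cast a1))
    obtain ⟨u', h1, h2⟩ := ih (v := ℓ.extend B mem v i) a4 (fun ℓ hℓ => hst ℓ (by simp [hℓ]))
      (by
        rw [Finset.coe_union, Set.eqOn_union]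
        exact ⟨huv.trans (Level.extend_eqOn a2 v i).symm, e⟩)
      (fun ℓ hℓ => hu ℓ (by simp [hℓ]))
    refine ⟨u', ?_, ?_⟩
    · simp only [enumVals, List.mem_flatMap, List.mem_range]
      exact ⟨i, hi, h1⟩
    · simpa only [levelVars, List.foldr_cons, ← Finset.union_assoc] using h2

/-- Two visited valuations separate at some loop, where their indices differ. The tuple of this loop
determines its index, and inner loops no longer reassign its variables. -/
theorem pairwise_enumVals (hA : ViewTree.AtomCongr Q A) {ls : List (Level Q)}
    {H : (ℕ → ℕ) → Prop} {V : Finset ℕ} (had : Adequate A H V ls)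
    (hst : ∀ ℓ ∈ ls, ℓ.Stored B mem A) (v : ℕ → ℕ) :
    (enumVals B mem ls v).Pairwise
      fun u u' => ¬ Set.EqOn u u' (V ∪ levelVars ls : Finset ℕ) := by
  induction ls generalizing H V v with
  | nil => simp [enumVals]
  | cons ℓ ls ih =>
    obtain ⟨a1, a2, a3, a4⟩ := had
    have hst' : ∀ ℓ ∈ ls, ℓ.Stored B mem A := fun ℓ hℓ => hst ℓ (by simp [hℓ])
    have hV : V ∪ levelVars (ℓ :: ls) = V ∪ ℓ.vars ∪ levelVars ls := by
      simp only [levelVars, List.foldr_cons, Finset.union_assoc]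
    rw [hV]
    refine List.pairwise_flatMap.2 ⟨fun i _ => ih a4 hst' _, ?_⟩
    refine List.Pairwise.imp_of_mem ?_ List.nodup_range
    intro i j hi hj hij u hu u' hu' e
    rw [List.mem_range] at hi hj
    obtain ⟨b1, -⟩ := mem_enumVals hA a4 hst' hu
    obtain ⟨b2, -⟩ := mem_enumVals hA a4 hst' hu'
    have e' : Set.EqOn u u' (V ∪ ℓ.vars : Finset ℕ) := e.mono (by
      exact_mod_cast Finset.subset_union_left)
    have h1 := b1.symm.trans (e'.trans b2)
    rw [Finset.coe_union, Set.eqOn_union] at h1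
    have p1 := ((hst ℓ (by simp)).extend hi).1
    have p2 := ((hst ℓ (by simp)).extend hj).1
    rw [tup_eq_iff.2 h1.2, p2] at p1
    omega

end

/-- Load the tuple with the index `sr (10 + 2 * d)`. -/
noncomputable def levelLoad (Ω : Type) (B d : ℕ) (ℓ : Level Q) : Prog Ω :=
  loadEach Ω (vr B) (fun x => arr B ℓ.code (x + 2))
    (sr B (10 + 2 * d) :: ℓ.key.toList.map (vr B)) (ℓ.vars \ ℓ.key).toList

/-- Nested loops, with an output at the innermost position. -/
noncomputable def enumProg (Ω : Type) (B : ℕ) (out : List ℕ) : ℕ → List (Level Q) → Prog Ω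
  | _, [] => .emit (out.map (vr B))
  | d, ℓ :: ls =>
    .seq (.block [.instr (.const (sr B (10 + 2 * d)) 0),
      .instr (.load (sr B (11 + 2 * d)) (arr B ℓ.code 1) (ℓ.key.toList.map (vr B)))])
    (.loop (.lt (sr B (10 + 2 * d)) (sr B (11 + 2 * d)))
      (.seq (levelLoad Ω B d ℓ) (.seq (enumProg Ω B out (d + 1) ls)
        (.block [.instr (.const (sr B 0) 1),
          .instr (.add (sr B (10 + 2 * d)) (sr B (10 + 2 * d)) (sr B 0))]))))

/-- A bound on the delay of nested loops. -/
noncomputable def delayBound (Ω : Type) (B : ℕ) : ℕ → List (Level Q) → ℕ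
  | _, [] => 0
  | d, ℓ :: ls => delayBound Ω B (d + 1) ls + ((levelLoad Ω B d ℓ).cost + 4) + 1 + 3

/-- The delay bound depends only on the loops, not on the tables: no loop is empty, so every
iteration contains an output, and `Steady.append` joins iterations without loss. Registers match `v`
only on `V`, so `H` may depend only on these variables. The loop at depth `d` uses the registers `sr
B (10 + 2 * d)` and `sr B (11 + 2 * d)`, which inner loops preserve. -/
theorem exec_enumProg {Ω : Type} (I : Ω → ℕ → ℕ → ℕ) (B : ℕ)
    {A : Fin Q.numAtoms → (ℕ → ℕ) → Prop} (hA : ViewTree.AtomCongr Q A) (out : List ℕ)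
    (ls : List (Level Q)) (d : ℕ) {H : (ℕ → ℕ) → Prop} {V : Finset ℕ} {σ : State}
    (had : Adequate A H V ls) (hst : ∀ ℓ ∈ ls, ℓ.Stored B σ.mem A)
    (hH : ∀ u v, Set.EqOn u v V → H u → H v) (hout : ∀ x ∈ out, x ∈ V ∪ levelVars ls)
    {v : ℕ → ℕ} (hv : H v) (hσ : ∀ x ∈ V, σ.reg (vr B x) = v x) :
    ∃ tr σ', Exec I (enumProg Ω B out d ls) σ tr σ' ∧ σ'.mem = σ.mem ∧
      (∀ x ∈ V, σ'.reg (vr B x) = v x) ∧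
      (∀ k, 10 ≤ k → k < 10 + 2 * d → σ'.reg (sr B k) = σ.reg (sr B k)) ∧
      tr.outputs = (enumVals B σ.mem ls v).map (fun u => out.map u) ∧
      tr.Steady (delayBound Ω B d ls) := by
  induction ls generalizing d H V σ v with
  | nil =>
    refine ⟨_, σ, Exec.emit _ σ, rfl, hσ, fun _ _ _ => rfl, ?_, Trace.steady_singleton _⟩
    simp only [Trace.outputs, List.map_map, List.filterMap_cons, id_eq, List.filterMap_nil,
      enumVals, List.map_cons, List.map_nil, List.cons.injEq, and_true]
    exact List.map_congr_left fun x hx => hσ x (by simpa [levelVars] using hout x hx)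
  | cons ℓ ls ih =>
    obtain ⟨a1, a2, a3, a4⟩ := had
    have hℓ := hst ℓ (by simp)
    set n := ℓ.count B σ.mem v with hn
    set K := (levelLoad Ω B d ℓ).cost + 4 with hK
    have hkey : ∀ reg : ℕ → ℕ, (∀ x ∈ V, reg (vr B x) = v x) →
        (ℓ.key.toList.map (vr B)).map reg = tup v ℓ.key := fun reg h => by
      rw [map_vr_eq_tup]
      exact tup_eq_iff.2 fun x hx => h x (a1 hx)
    -- one iteration
    have hstep : ∀ i < n, ∀ τ : State, τ.mem = σ.mem → (∀ x ∈ V, τ.reg (vr B x) = v x) →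
        τ.reg (sr B (10 + 2 * d)) = i →
        ∃ tr τ', Exec I (.seq (levelLoad Ω B d ℓ) (.seq (enumProg Ω B out (d + 1) ls)
          (.block [.instr (.const (sr B 0) 1),
          .instr (.add (sr B (10 + 2 * d)) (sr B (10 + 2 * d)) (sr B 0))]))) τ tr τ' ∧
          τ'.mem = σ.mem ∧ (∀ x ∈ V, τ'.reg (vr B x) = v x) ∧
          τ'.reg (sr B (10 + 2 * d)) = i + 1 ∧
          (∀ k, 10 ≤ k → k < 10 + 2 * d ∨ k = 11 + 2 * d →
            τ'.reg (sr B k) = τ.reg (sr B k)) ∧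
          Trace.outputs tr =
            (enumVals B σ.mem ls (ℓ.extend B σ.mem v i)).map (fun u => out.map u) ∧
          Trace.Steady (delayBound Ω B (d + 1) ls + K) (none :: tr) := by
      intro i hi τ t1 t2 t3
      obtain ⟨n₁, hn₁, e1⟩ := (levelLoad Ω B d ℓ).exec_run I (straight_loadEach _ _ _ _) τ
      obtain ⟨b1, b2, b3⟩ := run_loadEach I (Ω := Ω) (dst := vr B)
        (fun x y h => by simpa using h) (fun x => arr B ℓ.code (x + 2))
        (sr B (10 + 2 * d) :: ℓ.key.toList.map (vr B)) (ℓ.vars \ ℓ.key).toList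
        (by simp) τ
      change (Prog.run I (levelLoad Ω B d ℓ) τ).mem = _ at b1
      change ∀ x ∈ _, (Prog.run I (levelLoad Ω B d ℓ) τ).reg _ = _ at b2
      change ∀ r, _ → (Prog.run I (levelLoad Ω B d ℓ) τ).reg r = _ at b3
      generalize Prog.run I (levelLoad Ω B d ℓ) τ = τ₁ at e1 b1 b2 b3
      rw [t1] at b1
      simp only [List.map_cons, hkey τ.reg t2, t3, t1, Finset.mem_toList] at b2 b3
      have hext := Level.extend_eqOn (B := B) (mem := σ.mem) a2 v i
      have c1 : ∀ x ∈ V ∪ ℓ.vars, τ₁.reg (vr B x) = ℓ.extend B σ.mem v i x := by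
        intro x hx
        by_cases hx' : x ∈ ℓ.vars \ ℓ.key
        · rw [b2 x hx', Level.extend, if_pos hx']
        · have hxV : x ∈ V := by
            rcases Finset.mem_union.1 hx with h | h
            · exact h
            · exact a1 (by by_contra hk; exact hx' (Finset.mem_sdiff.2 ⟨h, hk⟩))
          rw [hext hxV, b3 _ fun y hy h => hx' (by rwa [vr_inj.1 h]), t2 x hxV]
      have c2 : ∀ k, τ₁.reg (sr B k) = τ.reg (sr B k) := fun k => b3 _ (by simp)
      have hH' : H (ℓ.extend B σ.mem v i) ∧ ℓ.tree.Sat Q A (ℓ.extend B σ.mem v i) :=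
        ⟨hH _ _ hext.symm hv, (hℓ.extend hi).2⟩
      obtain ⟨tr, τ₂, f1, f2, f3, f4, f5, f6⟩ := ih (d + 1) (σ := τ₁) a4
        (fun ℓ' h => b1 ▸ hst ℓ' (by simp [h]))
        (fun u w e h => by
          rw [Finset.coe_union, Set.eqOn_union] at e
          exact ⟨hH u w e.1 h.1, ViewTree.Sat.congr hA _ e.2 h.2⟩)
        (fun x hx => by
          simpa only [levelVars, List.foldr_cons, ← Finset.union_assoc] using hout x hx)
        hH' c1
      have e3 := Exec.seq _ _ _ _ _ _ _ (Exec.instr (I := I) (.const (sr B 0) 1) τ₂)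
        (Exec.seq _ _ _ _ _ _ _ (Exec.instr
          (.add (sr B (10 + 2 * d)) (sr B (10 + 2 * d)) (sr B 0)) _)
          (Exec.instr .skip _))
      refine ⟨_, _, Exec.seq _ _ _ _ _ _ _ e1 (Exec.seq _ _ _ _ _ _ _ f1 e3), ?_, ?_, ?_, ?_,
        ?_, ?_⟩
      · exact f2.trans b1
      · intro x hx
        simp only [Instr.apply, State.setReg]
        rw [Function.update_of_ne vr_ne_sr, Function.update_of_ne vr_ne_sr,
          f3 x (Finset.mem_union_left _ hx), hext hx]
      · simp only [Instr.apply, State.setReg, Function.update_self]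
        rw [Function.update_of_ne (by simp), f4 _ (by omega) (by omega), c2, t3]
      · intro k hk hk'
        simp only [Instr.apply, State.setReg]
        rw [Function.update_of_ne (by rw [ne_eq, sr_inj]; omega),
          Function.update_of_ne (by rw [ne_eq, sr_inj]; omega), f4 k hk (by omega), c2]
      · rw [Trace.outputs_append, Trace.outputs_append, Trace.outputs_replicate, f5, b1]
        simp [Trace.outputs]
      -- Three silent steps follow the inner loops (constant, increment, final skip); the loop test
      -- and the loading of the tuple precede them.
      · have h1 := (f6.pad_right (b := 3) (n := 3) le_rfl).pad_left
          (b := (levelLoad Ω B d ℓ).cost + 1) (n := n₁ + 1) (by omega)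
        have h2 : delayBound Ω B (d + 1) ls + 3 + ((levelLoad Ω B d ℓ).cost + 1) =
          delayBound Ω B (d + 1) ls + K := by omega
        rw [h2, List.replicate_succ, List.cons_append] at h1
        exact h1
    -- the loop
    have hloop : ∀ (m i : ℕ), i + m = n → ∀ τ : State, τ.mem = σ.mem →
        (∀ x ∈ V, τ.reg (vr B x) = v x) → τ.reg (sr B (10 + 2 * d)) = i →
        τ.reg (sr B (11 + 2 * d)) = n →
        ∃ tr τ', Exec I (.loop (.lt (sr B (10 + 2 * d)) (sr B (11 + 2 * d)))
          (.seq (levelLoad Ω B d ℓ) (.seq (enumProg Ω B out (d + 1) ls)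
          (.block [.instr (.const (sr B 0) 1),
          .instr (.add (sr B (10 + 2 * d)) (sr B (10 + 2 * d)) (sr B 0))])))) τ
            (tr ++ [none]) τ' ∧
          τ'.mem = σ.mem ∧ (∀ x ∈ V, τ'.reg (vr B x) = v x) ∧
          (∀ k, 10 ≤ k → k < 10 + 2 * d → τ'.reg (sr B k) = τ.reg (sr B k)) ∧
          Trace.outputs tr = ((List.range' i m).flatMap fun i =>
            enumVals B σ.mem ls (ℓ.extend B σ.mem v i)).map (fun u => out.map u) ∧
          (m = 0 → tr = []) ∧
          (m ≠ 0 → Trace.Steady (delayBound Ω B (d + 1) ls + K) tr) := by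
      intro m
      induction m with
      | zero =>
        intro i hi τ t1 t2 t3 t4
        exact ⟨[], τ, Exec.loop_false _ _ _ (by simp [Test.Holds, t3, t4]; omega), t1, t2,
          fun _ _ _ => rfl, by simp [Trace.outputs], fun _ => rfl, fun h => absurd rfl h⟩
      | succ m ihm =>
        intro i hi τ t1 t2 t3 t4
        obtain ⟨tr, τ₁, f1, f2, f3, f4, f5, f6, f7⟩ := hstep i (by omega) τ t1 t2 t3
        obtain ⟨tr', τ₂, g1, g2, g3, g4, g5, g6, g7⟩ := ihm (i + 1) (by omega) τ₁ f2 f3 f4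
          ((f5 _ (by omega) (Or.inr rfl)).trans t4)
        refine ⟨none :: (tr ++ tr'), τ₂, ?_, g2, g3,
          fun k hk hk' => (g4 k hk hk').trans (f5 k hk (Or.inl hk')), ?_, by simp, fun _ => ?_⟩
        · have := Exec.loop_true _ _ _ _ _ _ _
            (show Test.Holds τ (.lt (sr B (10 + 2 * d)) (sr B (11 + 2 * d))) by
              simp only [Test.Holds, t3, t4]; omega) f1 g1
          simpa only [List.cons_append, List.append_assoc] using this
        · change Trace.outputs ((tr ++ tr' : Trace)) = _
          rw [Trace.outputs_append, f6, g5, List.range'_succ, List.flatMap_cons, List.map_append]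
        · by_cases hm : m = 0
          · rw [g6 hm, List.append_nil]; exact f7
          · rw [← List.cons_append]; exact f7.append (g7 hm)
    set τ := Prog.run I (.block [.instr (.const (sr B (10 + 2 * d)) 0),
      .instr (.load (sr B (11 + 2 * d)) (arr B ℓ.code 1) (ℓ.key.toList.map (vr B)))]) σ with hτ
    obtain ⟨n₀, hn₀, e0⟩ := Prog.exec_run I (.block [.instr (.const (sr B (10 + 2 * d)) 0),
      .instr (.load (sr B (11 + 2 * d)) (arr B ℓ.code 1) (ℓ.key.toList.map (vr B)))])
      (by simp [Prog.block, Prog.Straight]) σ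
    have r1 : ∀ x, τ.reg (vr B x) = σ.reg (vr B x) := fun x => by
      simp [hτ, Prog.run, Instr.apply, State.setReg]
    have r2 : τ.reg (sr B (10 + 2 * d)) = 0 := by
      simp only [hτ, Prog.run, Prog.run_block_cons, Prog.run_block_nil, Instr.apply, State.setReg]
      rw [Function.update_of_ne (by rw [ne_eq, sr_inj]; omega), Function.update_self]
    have r3 : τ.reg (sr B (11 + 2 * d)) = n := by
      simp only [hτ, Prog.run, Prog.run_block_cons, Prog.run_block_nil, Instr.apply, State.setReg,
        Function.update_self]
      rw [hkey _ fun x hx => by rw [Function.update_of_ne vr_ne_sr]; exact hσ x hx]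
      rfl
    have r4 : ∀ k, k < 10 + 2 * d → τ.reg (sr B k) = σ.reg (sr B k) := fun k hk => by
      simp only [hτ, Prog.run, Prog.run_block_cons, Prog.run_block_nil, Instr.apply, State.setReg]
      rw [Function.update_of_ne (by rw [ne_eq, sr_inj]; omega),
        Function.update_of_ne (by rw [ne_eq, sr_inj]; omega)]
    obtain ⟨tr, σ', g1, g2, g3, g4, g5, g6, g7⟩ := hloop n 0 (by omega) τ rfl
      (fun x hx => (r1 x).trans (hσ x hx)) r2 r3
    refine ⟨_, σ', Exec.seq _ _ _ _ _ _ _ e0 g1, g2, g3,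
      fun k hk hk' => (g4 k hk hk').trans (r4 k hk'), ?_, ?_⟩
    · rw [Trace.outputs_append, Trace.outputs_append, Trace.outputs_replicate, g5,
        ← List.range_eq_range']
      simp [Trace.outputs, enumVals, ← hn]
    -- Adequacy provides a tuple with the current key, so the loop runs at least once. This is what
    -- keeps the delay bounded.
    · have hn0 : n ≠ 0 := (hℓ.len_ne_zero_iff v).2 (a3 v hv)
      have h1 := ((g7 hn0).pad_right (b := 1) (n := 1) le_rfl).pad_left (b := 3) (n := n₀)
        (by simpa [Prog.block, Prog.cost] using hn₀)
      exact h1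

end enumeration

/-! ## Nested loops for a part of a view tree -/

namespace ViewTree
variable {S : Vocabulary} {Q : CQ S} {A : Fin Q.numAtoms → (ℕ → ℕ) → Prop}

theorem Safe.exists_leaf_of_mem_schema {t : ViewTree Q.numAtoms} (ht : t.Safe) {x : ℕ}
    (hx : x ∈ t.schema Q) : ∃ i, t.HasLeaf i ∧ x ∈ Q.atomVars i := by
  induction t with
  | atom i => exact ⟨i, by simp [HasLeaf, leafCount], hx⟩
  | proj X c ih => exact ih ht.of_proj (ht.proj_subset [] X c (.root _) hx)
  | join n c ih =>
    simp only [schema, Finset.mem_biUnion, Finset.mem_univ, true_and] at hx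
    obtain ⟨j, hx⟩ := hx
    obtain ⟨i, hi, hxi⟩ := ih j (ht.of_join j) hx
    exact ⟨i, hasLeaf_join.2 ⟨j, hi⟩, hxi⟩

/-- A variable that occurs below `t` but not in its schema has been projected away somewhere in `t`;
by correctness all atoms with this variable are below that projection view. -/
theorem Safe.hasLeaf_of_not_mem_schema {t : ViewTree Q.numAtoms} (ht : t.Safe) {x : ℕ}
    (hx : x ∉ t.schema Q) {i j : Fin Q.numAtoms} (hi : t.HasLeaf i) (hxi : x ∈ Q.atomVars i)
    (hxj : x ∈ Q.atomVars j) : t.HasLeaf j := by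
  induction t with
  | atom k =>
    obtain rfl : i = k := by
      by_contra h
      simp [HasLeaf, leafCount, h] at hi
    exact absurd hxi hx
  | proj X c ih =>
    by_cases hc : x ∈ c.schema Q
    · exact ht.proj_atoms [] X c (.root _) x hc hx j hxj
    · exact ih ht.of_proj hc hi
  | join n c ih =>
    obtain ⟨k, hk⟩ := hasLeaf_join.1 hi
    exact hasLeaf_join.2 ⟨k, ih k (ht.of_join k) (fun h => hx (schema_child_subset c k h)) hk⟩

/-- Otherwise all atoms with `x` would be below `c a`, although one of them is below `c b`, against
the uniqueness of leaves. -/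
theorem Safe.mem_schema_of_ne {n : ℕ} {c : Fin (n + 1) → ViewTree Q.numAtoms}
    (ht : (join n c).Safe) {a b : Fin (n + 1)} (hab : a ≠ b) {i j : Fin Q.numAtoms}
    (hi : (c a).HasLeaf i) (hj : (c b).HasLeaf j) {x : ℕ} (hxi : x ∈ Q.atomVars i)
    (hxj : x ∈ Q.atomVars j) : x ∈ (c a).schema Q := by
  by_contra hx
  exact hab (ht.child_unique ((ht.of_join a).hasLeaf_of_not_mem_schema hx hi hxi hxj) hj)

theorem sat_of_leaves {t : ViewTree Q.numAtoms} {w : ℕ → ℕ} (h : ∀ i, t.HasLeaf i → A i w) :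
    t.Sat Q A w := by
  induction t with
  | atom i => exact h i (by simp [HasLeaf, leafCount])
  | proj X c ih => exact ⟨w, fun _ _ => rfl, ih h⟩
  | join n c ih => exact fun j => ih j fun i hi => h i (hasLeaf_join.2 ⟨j, hi⟩)

/-- Solutions of the children of a join view that agree with the same tuple of the join view can
be combined. -/
theorem Safe.glue (hA : AtomCongr Q A) {n : ℕ} {c : Fin (n + 1) → ViewTree Q.numAtoms}
    (ht : (join n c).Safe) {F : Fin (n + 1) → Finset ℕ} (hF : ∀ j, (c j).schema Q ⊆ F j)
    (hF' : ∀ j, ∀ x ∈ F j, ∃ i, (c j).HasLeaf i ∧ x ∈ Q.atomVars i) {u : ℕ → ℕ}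
    (h : ∀ j, ∃ w, Set.EqOn w u (F j) ∧ ∀ i, (c j).HasLeaf i → A i w) :
    ∃ w, (∀ j, Set.EqOn w u (F j)) ∧ ∀ i, (join n c).HasLeaf i → A i w := by
  classical
  choose w hw hwA using h
  -- A variable that occurs below two children lies in the schemas of both, so both solutions give
  -- it the value under `u`. All other variables occur below at most one child; those that occur
  -- nowhere get the default 0.
  have key : ∀ x, ∃ y, ∀ j i, (c j).HasLeaf i → x ∈ Q.atomVars i → w j x = y := by
    intro x
    by_cases hx : ∃ j i, (c j).HasLeaf i ∧ x ∈ Q.atomVars i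
    · obtain ⟨j, i, hi, hxi⟩ := hx
      refine ⟨w j x, fun j' i' hi' hxi' => ?_⟩
      by_cases hj : j' = j
      · rw [hj]
      · rw [hw j' (hF j' (ht.mem_schema_of_ne hj hi' hi hxi' hxi)),
          hw j (hF j (ht.mem_schema_of_ne (Ne.symm hj) hi hi' hxi hxi'))]
    · exact ⟨0, fun j i hi hxi => absurd ⟨j, i, hi, hxi⟩ hx⟩
  choose y hy using key
  refine ⟨y, fun j x hx => ?_, fun i hi => ?_⟩
  · obtain ⟨i, hi, hxi⟩ := hF' j x hx
    rw [← hy x j i hi hxi, hw j hx]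
  · obtain ⟨j, hj⟩ := hasLeaf_join.1 hi
    exact hA i (w j) y (fun x hx => hy x j i hj hx) (hwA j i hj)

/-- Climbing down the tree, a projection view supplies a witness for the projected variables, and at
a join view the children's solutions are glued. Thus projecting early loses no information about the
atoms below. -/
theorem Safe.exists_solution (hA : AtomCongr Q A) {t : ViewTree Q.numAtoms} (ht : t.Safe)
    {u : ℕ → ℕ} (hu : t.Sat Q A u) :
    ∃ w, Set.EqOn w u (t.schema Q) ∧ ∀ i, t.HasLeaf i → A i w := by
  induction t generalizing u with
  | atom j =>
    refine ⟨u, fun _ _ => rfl, fun i hi => ?_⟩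
    obtain rfl : i = j := by
      by_contra h
      simp [HasLeaf, leafCount, h] at hi
    exact hu
  | proj X c ih =>
    obtain ⟨u', h1, h2⟩ := hu
    obtain ⟨w, h3, h4⟩ := ih ht.of_proj h2
    exact ⟨w, fun x hx => (h3 (ht.proj_subset [] X c (.root _) hx)).trans (h1 x hx), h4⟩
  | join n c ih =>
    obtain ⟨w, h1, h2⟩ := ht.glue hA (fun j => Finset.Subset.refl _)
      (fun j x hx => (ht.of_join j).exists_leaf_of_mem_schema hx)
      (fun j => ih j (ht.of_join j) (hu j))
    refine ⟨w, fun x hx => ?_, h2⟩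
    simp only [schema, Finset.coe_biUnion, Set.mem_iUnion] at hx
    obtain ⟨j, -, hx⟩ := hx
    exact h1 j hx

/-- The nested loops `ls` enumerate the values of the variables in `F` for a given tuple of the
root view of `t`. -/
structure Covers (t : ViewTree Q.numAtoms) (F : Finset ℕ) (K : Finset ℕ) (g : List ℕ → ℕ)
    (ls : List (Level Q)) : Prop where
  stored : ∀ B mem A, t.Stored Q B mem A K g → ∀ ℓ ∈ ls, ℓ.Stored B mem A
  adequate : ∀ A (H : (ℕ → ℕ) → Prop) (V : Finset ℕ), (∀ v, H v → t.Sat Q A v) →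
    t.schema Q ⊆ V → (∀ x ∈ F, x ∈ V → x ∈ t.schema Q) → Adequate A H V ls
  vars : t.schema Q ∪ levelVars ls = F
  leaf : ∀ x ∈ F, ∃ i, t.HasLeaf i ∧ x ∈ Q.atomVars i
  solution : ∀ A, AtomCongr Q A → ∀ u, t.Sat Q A u → (∀ ℓ ∈ ls, ℓ.tree.Sat Q A u) →
    ∃ w, Set.EqOn w u F ∧ ∀ i, t.HasLeaf i → A i w
  sat : ∀ A w, (∀ i, t.HasLeaf i → A i w) → ∀ ℓ ∈ ls, ℓ.tree.Sat Q A w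

theorem Safe.covers_root {t : ViewTree Q.numAtoms} (ht : t.Safe) (K : Finset ℕ)
    (g : List ℕ → ℕ) : t.Covers (t.schema Q) K g [] where
  stored _ _ _ _ := by simp
  adequate _ _ _ _ _ _ := trivial
  vars := by simp [levelVars]
  leaf _ hx := ht.exists_leaf_of_mem_schema hx
  solution _ hA _ hu _ := ht.exists_solution hA hu
  sat _ _ _ := by simp

/-- Crossing a projection view costs one loop over the child's tuples with the given values on `X`.
It is nonempty precisely because the valuation satisfies the projection view. -/
theorem Safe.covers_proj {X : Finset ℕ} {c : ViewTree Q.numAtoms} (ht : (proj X c).Safe)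
    {F K : Finset ℕ} {g : List ℕ → ℕ} {ls : List (Level Q)}
    (h : c.Covers F X (fun p => g (0 :: p)) ls) :
    (proj X c).Covers (X ∪ F) K g (⟨g [0], X, c⟩ :: ls) := by
  have hX : X ⊆ c.schema Q := ht.proj_subset [] X c (.root _)
  have hcF : c.schema Q ⊆ F := by rw [← h.vars]; exact Finset.subset_union_left
  have hF : X ∪ F = F := Finset.union_eq_right.2 (hX.trans hcF)
  refine ⟨?_, ?_, ?_, ?_, ?_, ?_⟩
  · intro B mem A hs ℓ hℓ
    rcases List.mem_cons.1 hℓ with rfl | hℓ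
    · exact hs.2.root
    · exact h.stored B mem A hs.2 ℓ hℓ
  · intro A H V h1 h2 h3
    rw [hF] at h3
    refine ⟨h2, fun x hx hV => h3 x (hcF hx) hV, h1, ?_⟩
    refine h.adequate A _ _ (fun v hv => hv.2) Finset.subset_union_right fun x hx hV => ?_
    rcases Finset.mem_union.1 hV with hV | hV
    · exact hX (h3 x hx hV)
    · exact hV
  · rw [← h.vars]
    rfl
  · rw [hF]; exact h.leaf
  · intro A hA u _ hl
    rw [hF]
    exact h.solution A hA u (hl ⟨g [0], X, c⟩ (by simp)) fun ℓ hℓ => hl ℓ (by simp [hℓ])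
  · intro A w hw ℓ hℓ
    rcases List.mem_cons.1 hℓ with rfl | hℓ
    · exact sat_of_leaves (t := c) hw
    · exact h.sat A w hw ℓ hℓ

theorem mem_levelVars_flatMap {ι : Type} {l : List ι} {ls : ι → List (Level Q)} {x : ℕ} :
    x ∈ levelVars (l.flatMap ls) ↔ ∃ j ∈ l, x ∈ levelVars (ls j) := by
  simp only [mem_levelVars, List.mem_flatMap]
  constructor
  · rintro ⟨ℓ, ⟨j, hj, hℓ⟩, hx⟩; exact ⟨j, hj, ℓ, hℓ, hx⟩
  · rintro ⟨j, hj, ℓ, hℓ, hx⟩; exact ⟨ℓ, ⟨j, hj, hℓ⟩, hx⟩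

/-- A tuple of the join view already fixes a tuple of each child, so only the loops of the children
are concatenated. They are independent: two children share only variables from both their schemas,
which are fixed by then. -/
theorem Safe.covers_join {n : ℕ} {c : Fin (n + 1) → ViewTree Q.numAtoms} (ht : (join n c).Safe)
    {F : Fin (n + 1) → Finset ℕ} {K : Finset ℕ} {g : List ℕ → ℕ}
    {ls : Fin (n + 1) → List (Level Q)}
    (h : ∀ j, (c j).Covers (F j) ∅ (fun p => g ((j : ℕ) :: p)) (ls j)) :
    (join n c).Covers (Finset.univ.biUnion F) K g ((List.finRange (n + 1)).flatMap ls) := by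
  have hcF : ∀ j, (c j).schema Q ⊆ F j := fun j => by
    rw [← (h j).vars]; exact Finset.subset_union_left
  refine ⟨?_, ?_, ?_, ?_, ?_, ?_⟩
  · intro B mem A hs ℓ hℓ
    obtain ⟨j, _, hℓ⟩ := List.mem_flatMap.1 hℓ
    exact (h j).stored B mem A (hs.2 j) ℓ hℓ
  · intro A H V h1 h2 h3
    have key : ∀ (l : List (Fin (n + 1))), l.Nodup → ∀ (H : (ℕ → ℕ) → Prop) (V : Finset ℕ),
        (∀ v, H v → (join n c).Sat Q A v) → (join n c).schema Q ⊆ V →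
        (∀ j ∈ l, ∀ x ∈ F j, x ∈ V → x ∈ (c j).schema Q) → Adequate A H V (l.flatMap ls) := by
      intro l
      induction l with
      | nil => intros; trivial
      | cons j l ih =>
        intro hl H V h1 h2 h3
        rw [List.nodup_cons] at hl
        rw [List.flatMap_cons]
        refine Adequate.append ((h j).adequate A H V (fun v hv => h1 v hv j)
          ((schema_child_subset c j).trans h2) (h3 j (by simp))) fun H' V' k1 k2 k3 => ?_
        refine ih hl.2 H' V' (fun v hv => h1 v (k1 v hv)) (h2.trans k2) fun j' hj' x hx hV => ?_
        rcases k3 x hV with hV | hV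
        · exact h3 j' (by simp [hj']) x hx hV
        · obtain ⟨i, hi, hxi⟩ := (h j').leaf x hx
          obtain ⟨i', hi', hxi'⟩ := (h j).leaf x (by
            rw [← (h j).vars]; exact Finset.mem_union_right _ hV)
          exact ht.mem_schema_of_ne (ne_of_mem_of_not_mem hj' hl.1) hi hi' hxi hxi'
    refine key _ (List.nodup_finRange _) H V h1 h2 fun j _ x hx hV => ?_
    -- A variable of `F j` that is already assigned lies in the schema of some child. If this is
    -- another child, then `x` occurs below both and so also lies in the schema of `c j`.
    have hxs := h3 x (Finset.mem_biUnion.2 ⟨j, Finset.mem_univ j, hx⟩) hV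
    by_contra hxj
    simp only [schema, Finset.mem_biUnion, Finset.mem_univ, true_and] at hxs
    obtain ⟨j', hxs⟩ := hxs
    obtain ⟨i, hi, hxi⟩ := (h j).leaf x hx
    obtain ⟨i', hi', hxi'⟩ := (ht.of_join j').exists_leaf_of_mem_schema hxs
    refine hxj (ht.mem_schema_of_ne ?_ hi hi' hxi hxi')
    rintro rfl
    exact hxj hxs
  · ext x
    simp only [schema, Finset.mem_union, Finset.mem_biUnion, Finset.mem_univ, true_and,
      mem_levelVars_flatMap, List.mem_finRange, ← exists_or]
    exact exists_congr fun j => by rw [← (h j).vars, Finset.mem_union]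
  · intro x hx
    obtain ⟨j, -, hx⟩ := Finset.mem_biUnion.1 hx
    obtain ⟨i, hi, hxi⟩ := (h j).leaf x hx
    exact ⟨i, hasLeaf_join.2 ⟨j, hi⟩, hxi⟩
  · intro A hA u hu hl
    obtain ⟨w, h1, h2⟩ := ht.glue hA hcF (fun j => (h j).leaf) (fun j => (h j).solution A hA u
      (hu j) fun ℓ hℓ => hl ℓ (List.mem_flatMap.2 ⟨j, List.mem_finRange j, hℓ⟩))
    refine ⟨w, fun x hx => ?_, h2⟩
    rw [Finset.coe_biUnion, Set.mem_iUnion₂] at hx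
    obtain ⟨j, -, hx⟩ := hx
    exact h1 j hx
  · intro A w hw ℓ hℓ
    obtain ⟨j, _, hℓ⟩ := List.mem_flatMap.1 hℓ
    exact (h j).sat A w (fun i hi => hw i (hasLeaf_join.2 ⟨j, hi⟩)) ℓ hℓ

theorem Safe.exists_covers {t : ViewTree Q.numAtoms} (ht : t.Safe) {F : Finset ℕ}
    (h : t.TopSubtree Q F) (K : Finset ℕ) (g : List ℕ → ℕ) : ∃ ls, t.Covers F K g ls := by
  classical
  induction h generalizing K g with
  | root t => exact ⟨[], ht.covers_root K g⟩
  | proj X c F _ ih =>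
    obtain ⟨ls, h⟩ := ih ht.of_proj X fun p => g (0 :: p)
    exact ⟨_, ht.covers_proj h⟩
  | join n c J F _ ih =>
    -- A child outside `J` is treated as if its root alone belonged to the part. This adds no
    -- variables, since its schema is contained in that of the join view.
    have hex : ∀ j : Fin (n + 1), ∃ ls, (c j).Covers
        (if j ∈ J then F j else (c j).schema Q) ∅ (fun p => g ((j : ℕ) :: p)) ls := by
      intro j
      by_cases hj : j ∈ J
      · rw [if_pos hj]
        exact ih j hj (ht.of_join j) ∅ _
      · rw [if_neg hj]
        exact ⟨[], (ht.of_join j).covers_root ∅ _⟩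
    choose ls hls using hex
    refine ⟨(List.finRange (n + 1)).flatMap ls, ?_⟩
    convert ht.covers_join (K := K) (g := g) hls using 1
    ext x
    simp only [schema, Finset.mem_union, Finset.mem_biUnion, Finset.mem_univ, true_and]
    constructor
    · rintro (⟨j, hx⟩ | ⟨j, hj, hx⟩)
      · refine ⟨j, ?_⟩
        rw [← (hls j).vars]
        exact Finset.mem_union_left _ hx
      · exact ⟨j, by rwa [if_pos hj]⟩
    · rintro ⟨j, hx⟩
      split_ifs at hx with hj
      · exact Or.inr ⟨j, hj, hx⟩
      · exact Or.inl ⟨j, hx⟩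

end ViewTree

/-! ## Connected components and the enumeration program -/

section final
variable {S : Vocabulary} {Q : CQ S}

theorem CQ.SameComponent.symm {i j : Fin Q.numAtoms} (h : Q.SameComponent i j) :
    Q.SameComponent j i := by
  induction h with
  | refl => exact .refl
  | tail _ h ih =>
    obtain ⟨x, h1, h2⟩ := h
    exact ih.head ⟨x, h2, h1⟩

theorem Database.insertTuple_self (D : Database S) (r : Fin S.numRels)
    (t : Fin (S.arity r) → ℕ) : D.insertTuple r t r = insert t (D r) :=
  Function.update_self _ _ _

theorem Database.deleteTuple_self (D : Database S) (r : Fin S.numRels)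
    (t : Fin (S.arity r) → ℕ) : D.deleteTuple r t r = (D r).erase t :=
  Function.update_self _ _ _

theorem CQ.exists_representatives (Q : CQ S) :
    ∃ (R : List (Fin Q.numAtoms)) (rep : Fin Q.numAtoms → Fin Q.numAtoms), R.Nodup ∧
      (∀ i ∈ R, ∀ j ∈ R, Q.SameComponent i j → i = j) ∧
      ∀ j, rep j ∈ R ∧ Q.SameComponent (rep j) j := by
  classical
  let s : Setoid (Fin Q.numAtoms) :=
    ⟨Q.SameComponent, fun _ => .refl, fun h => h.symm, fun h h' => h.trans h'⟩
  let rep : Fin Q.numAtoms → Fin Q.numAtoms := fun j => (Quotient.mk s j).out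
  have h1 : ∀ j, Q.SameComponent (rep j) j := fun j => Quotient.mk_out (s := s) j
  have h2 : ∀ i j, Q.SameComponent i j → rep i = rep j := fun i j h => by
    simp only [rep]; rw [Quotient.sound (s := s) h]
  refine ⟨(List.finRange _).filter fun i => rep i = i, rep, (List.nodup_finRange _).filter _,
    fun i hi j hj h => ?_, fun j => ⟨?_, h1 j⟩⟩
  · simp only [List.mem_filter, List.mem_finRange, true_and, decide_eq_true_eq] at hi hj
    rw [← hi, ← hj, h2 i j h]
  · simp only [List.mem_filter, List.mem_finRange, true_and, decide_eq_true_eq]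
    exact h2 _ _ (h1 j)

theorem CQ.mem_componentFree {i : Fin Q.numAtoms} {x : ℕ} :
    x ∈ Q.componentFree i ↔ x ∈ Q.head ∧ ∃ j, Q.SameComponent i j ∧ x ∈ Q.atomVars j := by
  simp [CQ.componentFree]

theorem CQ.sameComponent_of_mem {i j i' j' : Fin Q.numAtoms} {x : ℕ}
    (hi : Q.SameComponent i i') (hj : Q.SameComponent j j') (hxi : x ∈ Q.atomVars i')
    (hxj : x ∈ Q.atomVars j') : Q.SameComponent i j :=
  (hi.tail ⟨x, hxi, hxj⟩).trans hj.symm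

/-- Nested loops for all trees of a rewriting, given nested loops for the representatives of the
components of the query. -/
theorem adequate_flatMap {T : Rewriting Q} {R : List (Fin Q.numAtoms)} (hR : R.Nodup)
    (hR' : ∀ i ∈ R, ∀ j ∈ R, Q.SameComponent i j → i = j)
    {τ : Fin Q.numAtoms → Fin T.numTrees} {ls : Fin Q.numAtoms → List (Level Q)}
    (hls : ∀ i, (T.tree (τ i)).Covers (Q.componentFree i) ∅ (tableName (τ i)) (ls i))
    (A : Fin Q.numAtoms → (ℕ → ℕ) → Prop)
    (hne : ∀ i ∈ R, ∃ w, (T.tree (τ i)).Sat Q A w) :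
    Adequate A (fun _ => True) ∅
      (R.flatMap fun i => ⟨tableName (τ i) [], ∅, T.tree (τ i)⟩ :: ls i) := by
  have hvars : ∀ i, levelVars ((⟨tableName (τ i) [], ∅, T.tree (τ i)⟩ : Level Q) :: ls i) =
      Q.componentFree i := fun i => (hls i).vars
  have key : ∀ l : List (Fin Q.numAtoms), l.Nodup → (∀ i ∈ l, i ∈ R) →
      ∀ (H : (ℕ → ℕ) → Prop) (V : Finset ℕ),
      (∀ i ∈ l, ∀ x ∈ Q.componentFree i, x ∉ V) → Adequate A H V
      (l.flatMap fun i => ⟨tableName (τ i) [], ∅, T.tree (τ i)⟩ :: ls i) := by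
    intro l
    induction l with
    | nil => intros; trivial
    | cons i l ih =>
      intro hl hlR H V hV
      rw [List.nodup_cons] at hl
      rw [List.flatMap_cons]
      have hsub : (T.tree (τ i)).schema Q ⊆ Q.componentFree i := by
        rw [← (hls i).vars]; exact Finset.subset_union_left
      refine Adequate.append ⟨Finset.empty_subset _,
        fun x hx hxV => absurd hxV (hV i (by simp) x (hsub hx)),
        fun v _ => ?_, ?_⟩ fun H' V' _ k2 k3 => ih hl.2 (fun j hj => hlR j (by simp [hj])) H' V'
          fun j hj x hx hxV => ?_
      · obtain ⟨w, hw⟩ := hne i (hlR i (by simp))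
        exact ⟨w, by simp, hw⟩
      · refine (hls i).adequate A _ _ (fun v hv => hv.2) Finset.subset_union_right
          fun x hx hxV => (Finset.mem_union.1 hxV).resolve_left (hV i (by simp) x hx)
      · rcases k3 x hxV with h | h
        · exact hV j (by simp [hj]) x hx h
        · rw [hvars, CQ.mem_componentFree] at h
          obtain ⟨-, i', hi', hxi'⟩ := h
          obtain ⟨-, j', hj', hxj'⟩ := CQ.mem_componentFree.1 hx
          have := hR' i (hlR i (by simp)) j (hlR j (by simp [hj]))
            (CQ.sameComponent_of_mem hi' hj' hxi' hxj')
          exact hl.1 (this ▸ hj)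
  exact key R hR (fun _ h => h) _ _ (by simp)

/-- A guard first tests that the root views are all nonempty; if one is empty, so is the query
result. Afterwards the loops are adequate, and solutions found for the individual components combine
because components share no variables. -/
theorem Rewriting.IsSafe.exists_enumProg {Ω : Type} (I : Ω → ℕ → ℕ → ℕ) {T : Rewriting Q}
    (hT : T.IsSafe) (B : ℕ) :
    ∃ (E : Prog Ω) (c : ℕ), ∀ (D : Database S) (σ : State),
      T.Stored B σ.mem (Q.atomHolds D) →
      ∃ tr σ', Exec I E σ tr σ' ∧ σ'.mem = σ.mem ∧ tr.outputs.Nodup ∧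
        (∀ y, y ∈ tr.outputs ↔ y ∈ Q.result D) ∧ tr.DelayLE c := by
  obtain ⟨R, rep, hR, hR', hrep⟩ := Q.exists_representatives
  have hτ : ∀ i, ∃ τ, (T.tree τ).HasLeaf i := fun i => by
    have := hT.leaf_unique i
    obtain ⟨τ, _, h⟩ := Finset.exists_ne_zero_of_sum_ne_zero (by rw [this]; exact one_ne_zero)
    exact ⟨τ, Nat.pos_of_ne_zero h⟩
  choose τ hτ using hτ
  choose ls hls using fun i => (hT.safe_tree (τ i)).exists_covers (hT.enumeration i (τ i) (hτ i))
    ∅ (tableName (τ i))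
  -- There is one block of loops per component, even if several components share a tree. The root
  -- schema is then contained in the free variables of each of them, hence empty, and repeating its
  -- loop assigns nothing twice.
  set L : List (Level Q) :=
    R.flatMap fun i => ⟨tableName (τ i) [], ∅, T.tree (τ i)⟩ :: ls i with hL
  set G : Prog Ω := testAll Ω B (R.map fun i => (arr B (tableName (τ i) []) 1, [])) with hG
  have hLvars : ∀ x, x ∈ levelVars L ↔ x ∈ Q.head := by
    intro x
    rw [hL, ViewTree.mem_levelVars_flatMap]
    constructor
    · rintro ⟨i, _, hx⟩
      have : x ∈ Q.componentFree i := by rw [← (hls i).vars]; exact hx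
      exact (CQ.mem_componentFree.1 this).1
    · intro hx
      obtain ⟨j, k, hjk⟩ := Q.head_mem_body x hx
      refine ⟨rep j, (hrep j).1, ?_⟩
      have : x ∈ Q.componentFree (rep j) :=
        CQ.mem_componentFree.2 ⟨hx, j, (hrep j).2, by
          simp only [CQ.atomVars, Finset.mem_image, Finset.mem_univ, true_and]; exact ⟨k, hjk⟩⟩
      rw [← (hls _).vars] at this
      exact this
  -- The doubled term bounds the gaps of a steady trace with the guard and its test in front; the
  -- rest covers the run without output, which consists of the guard, its test and a skip.
  refine ⟨.seq G (.ite (.eq (sr B 0) (sr B 3)) (.instr .skip) (enumProg Ω B Q.head 0 L)),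
    2 * (delayBound Ω B 0 L + (G.cost + 1)) + G.cost + 2, fun D σ hσ => ?_⟩
  have hA := ViewTree.atomCongr_atomHolds (Q := Q) D
  obtain ⟨n, hn, e1⟩ := G.exec_run I (straight_testAll _ _) σ
  obtain ⟨g1, -, g2, g3⟩ := run_testAll I (Ω := Ω) B
    (R.map fun i => (arr B (tableName (τ i) []) 1, [])) (by simp) σ
  rw [← hG] at g1 g2 g3
  generalize Prog.run I G σ = σ₁ at e1 g1 g2 g3
  have hlen : ∀ i, σ.mem (arr B (tableName (τ i) []) 1) [] ≠ 0 ↔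
      ∃ w, (T.tree (τ i)).Sat Q (Q.atomHolds D) w := fun i => by
    have := (hσ (τ i)).root.len_ne_zero_iff fun _ => 0
    simpa [tup, Table.ofMem] using this
  have hguard : σ₁.reg (sr B 0) ≠ 0 ↔ ∀ i ∈ R, ∃ w, (T.tree (τ i)).Sat Q (Q.atomHolds D) w := by
    rw [g2]
    simp only [List.mem_map, forall_exists_index, and_imp, forall_apply_eq_imp_iff₂,
      List.map_nil, hlen]
  by_cases h0 : σ₁.reg (sr B 0) = 0
  · refine ⟨_, σ₁, Exec.seq _ _ _ _ _ _ _ e1 (Exec.ite_true _ _ _ _ _ _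
      (by simp only [Test.Holds, h0, g3]) (Exec.instr .skip _)), g1, ?_, ?_, ?_⟩
    · rw [Trace.outputs_append, Trace.outputs_replicate]
      simp [Trace.outputs]
    · intro y
      rw [Trace.outputs_append, Trace.outputs_replicate]
      simp only [Trace.outputs, List.nil_append, id_eq, List.filterMap_cons, List.filterMap_nil,
        List.not_mem_nil, false_iff]
      rintro ⟨v, hv, -⟩
      exact hguard.2 (fun i _ => ⟨v, ViewTree.sat_of_leaves fun j _ => hv j⟩) h0
    · intro s hs _
      have := hs.length_le
      simp only [List.length_append, List.length_replicate, List.length_cons,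
        List.length_nil] at this
      omega
  · have had : Adequate (Q.atomHolds D) (fun _ => True) ∅ L :=
      adequate_flatMap hR hR' hls _ (hguard.1 h0)
    have hst : ∀ ℓ ∈ L, ℓ.Stored B σ₁.mem (Q.atomHolds D) := by
      intro ℓ hℓ
      rw [g1]
      obtain ⟨i, _, hℓ⟩ := List.mem_flatMap.1 hℓ
      rcases List.mem_cons.1 hℓ with rfl | hℓ
      · exact (hσ (τ i)).root
      · exact (hls i).stored B _ _ (hσ (τ i)) ℓ hℓ
    obtain ⟨tr, σ₂, k1, k2, -, -, k3, k4⟩ := exec_enumProg I B hA Q.head L 0 had hst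
      (fun _ _ _ _ => trivial) (fun x hx => Finset.mem_union_right _ ((hLvars x).2 hx))
      (v := fun _ => 0) trivial (by simp)
    refine ⟨_, σ₂, Exec.seq _ _ _ _ _ _ _ e1 (Exec.ite_false _ _ _ _ _ _
      (by simpa only [Test.Holds, g3] using h0) k1), k2.trans g1, ?_⟩
    have hout : Trace.outputs (List.replicate n none ++ none :: tr) =
        (enumVals B σ₁.mem L fun _ => 0).map fun u => Q.head.map u := by
      rw [Trace.outputs_append, Trace.outputs_replicate, ← k3]
      simp [Trace.outputs]
    have hhead : ∀ u v : ℕ → ℕ, Q.head.map u = Q.head.map v ↔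
        Set.EqOn u v (∅ ∪ levelVars L : Finset ℕ) := fun u v => by
      simp only [List.map_inj_left, Set.EqOn, Finset.mem_coe, Finset.empty_union, hLvars]
    refine ⟨?_, fun y => ?_, ?_⟩
    · rw [hout]
      refine List.pairwise_map.2 ((pairwise_enumVals hA had hst _).imp fun h => ?_)
      rwa [ne_eq, hhead]
    · rw [hout, List.mem_map]
      constructor
      · rintro ⟨u, hu, rfl⟩
        obtain ⟨-, hsat⟩ := mem_enumVals hA had hst hu
        have hsol : ∀ i ∈ R, ∃ w, Set.EqOn w u (Q.componentFree i) ∧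
            ∀ j, (T.tree (τ i)).HasLeaf j → Q.atomHolds D j w := fun i hi =>
          (hls i).solution _ hA u (hsat ⟨tableName (τ i) [], ∅, T.tree (τ i)⟩
              (List.mem_flatMap.2 ⟨i, hi, by simp⟩))
            fun ℓ hℓ => hsat ℓ (List.mem_flatMap.2 ⟨i, hi, by simp [hℓ]⟩)
        choose! w hw hwA using hsol
        -- Each variable takes its value from the solution chosen for its own component. Only there
        -- is agreement with `u` on the free variables known, even if the tree also contains other
        -- components.
        have hval : ∀ x, ∃ y, ∀ j, x ∈ Q.atomVars j → w (rep j) x = y := by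
          intro x
          by_cases hx : ∃ j, x ∈ Q.atomVars j
          · obtain ⟨j, hj⟩ := hx
            refine ⟨w (rep j) x, fun j' hj' => ?_⟩
            rw [hR' _ (hrep j').1 _ (hrep j).1
              (CQ.sameComponent_of_mem (hrep j').2 (hrep j).2 hj' hj)]
          · exact ⟨0, fun j hj => absurd ⟨j, hj⟩ hx⟩
        choose y hy using hval
        refine ⟨y, fun j => ?_, List.map_congr_left fun x hx => ?_⟩
        · refine hA j (w (rep j)) y (fun x hx => hy x j hx) (hwA _ (hrep j).1 j ?_)
          exact hT.component _ _ (hrep j).2 _ (hτ _)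
        · obtain ⟨j, k, hjk⟩ := Q.head_mem_body x hx
          have hxj : x ∈ Q.atomVars j := by
            simp only [CQ.atomVars, Finset.mem_image, Finset.mem_univ, true_and]
            exact ⟨k, hjk⟩
          rw [← hy x j hxj]
          exact (hw _ (hrep j).1 (CQ.mem_componentFree.2 ⟨hx, j, (hrep j).2, hxj⟩)).symm
      · rintro ⟨v, hv, rfl⟩
        obtain ⟨u, hu, e⟩ := exists_mem_enumVals (u := v) (v := fun _ => 0) had hst (by simp)
          (fun ℓ hℓ => by
            obtain ⟨i, _, hℓ⟩ := List.mem_flatMap.1 hℓ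
            rcases List.mem_cons.1 hℓ with rfl | hℓ
            · exact ViewTree.sat_of_leaves fun j _ => hv j
            · exact (hls i).sat _ v (fun j _ => hv j) ℓ hℓ)
        exact ⟨u, hu, ((hhead v u).2 e).symm⟩
    · have h1 := k4.pad_left (b := G.cost + 1) (n := n + 1) (by omega)
      have h2 : List.replicate (n + 1) none ++ tr = List.replicate n none ++ none :: tr := by
        rw [List.replicate_succ', List.append_assoc]; rfl
      rw [h2] at h1
      intro s hs h
      have := h1.inf s hs h
      omega

/-! ## The dynamic evaluation algorithm -/

theorem canBeEvaluated_of_isSafe {Ω : Type} {I : Ω → ℕ → ℕ → ℕ} {T : Rewriting Q}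
    (hT : T.IsSafe) {f : ℕ → ℝ} (h : T.HasMaterialisationTime I f) : Q.CanBeEvaluated I f := by
  obtain ⟨P, place, c₀, hplace', hP⟩ := h
  choose b hb using fun τ => exists_place_bound (T.tree τ) (place τ)
  -- Names from `B` on are fresh: they avoid the input arrays, all arrays that `P` writes to, the
  -- materialised views, and the registers in which an update tuple arrives.
  set B := S.numRels + P.arrayBound + ∑ τ, b τ + ∑ r, S.arity r
  have hplace : ∀ τ p u, (T.tree τ).IsNode p u → place τ p < B := fun τ p u hu => by
    have h1 := hb τ p u hu
    have h2 : b τ ≤ ∑ τ, b τ :=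
      Finset.single_le_sum (fun _ _ => Nat.zero_le _) (Finset.mem_univ τ)
    omega
  have hB : ∀ r, S.arity r ≤ B := fun r => by
    have h2 : S.arity r ≤ ∑ r, S.arity r :=
      Finset.single_le_sum (fun _ _ => Nat.zero_le _) (Finset.mem_univ r)
    omega
  obtain ⟨C, hC⟩ := exec_preprocessing (I := I) hT (B := B) (P := P) (place := place)
    (by omega) (by omega) hplace hplace'
  obtain ⟨E, cE, hE⟩ := hT.exists_enumProg I B
  set alg : DynAlg S Ω := ⟨.seq P (buildProg T Ω B place), updateProg T Ω B 1,
    updateProg T Ω B 0, E⟩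
  have hpre : ∀ (D : Database S) (σ : State), IsInput D σ → ∃ tr σ',
      Exec I alg.pre σ tr σ' ∧ (tr.length : ℝ) ≤ (C * c₀ : ℕ) * f D.size ∧ 0 ≤ f D.size ∧
      T.Stored B σ'.mem (Q.atomHolds D) := by
    intro D σ hσ
    obtain ⟨tr₁, σ₁, h1, h2, h3⟩ := hP D σ hσ
    obtain ⟨tr, σ', k1, k2, k3⟩ := hC D σ hσ tr₁ σ₁ h1 h3
    refine ⟨tr, σ', k1, ?_, ?_, k3⟩
    · have k2' : (tr.length : ℝ) ≤ C * tr₁.length := by exact_mod_cast k2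
      refine k2'.trans ?_
      push_cast
      rw [mul_assoc]
      exact mul_le_mul_of_nonneg_left h2 (Nat.cast_nonneg _)
    -- Since `f` is an arbitrary real function, its sign must be derived before the constant can be
    -- enlarged; a run of positive length below `c₀ * f D.size` forces `f D.size` to be positive.
    · have h4 : (0 : ℝ) < tr₁.length := by exact_mod_cast h1.trace_length_pos
      exact (pos_of_mul_pos_right (h4.trans_le h2) (Nat.cast_nonneg _)).le
  have hins : ∀ (D : Database S) (σ : State), T.Stored B σ.mem (Q.atomHolds D) →
      ∀ r, S.dynamic r → ∀ t, T.Stored B ((alg.ins r).run I (σ.loadTuple t)).mem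
        (Q.atomHolds (D.insertTuple r t)) := by
    intro D σ hσ r hr t
    refine run_updateProg I hT hr (hB r) (fun r' hr' => ?_) (fun s hs => ?_) ?_ hσ
    · exact Function.update_of_ne hr' _ _
    · simp [Database.insertTuple_self, hs]
    · simp [Database.insertTuple_self]
  have hdel : ∀ (D : Database S) (σ : State), T.Stored B σ.mem (Q.atomHolds D) →
      ∀ r, S.dynamic r → ∀ t, T.Stored B ((alg.del r).run I (σ.loadTuple t)).mem
        (Q.atomHolds (D.deleteTuple r t)) := by
    intro D σ hσ r hr t
    refine run_updateProg I hT hr (hB r) (fun r' hr' => ?_) (fun s hs => ?_) ?_ hσ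
    · exact Function.update_of_ne hr' _ _
    · simp [Database.deleteTuple_self, hs]
    · simp [Database.deleteTuple_self]
  have hsi : ∀ r, (alg.ins r).Straight := fun r => straight_updateProg T Ω B 1 r
  have hsd : ∀ r, (alg.del r).Straight := fun r => straight_updateProg T Ω B 0 r
  have hinv : ∀ (D : Database S) (σ : State), alg.Reach I D σ →
      T.Stored B σ.mem (Q.atomHolds D) := by
    intro D σ hr
    induction hr with
    | pre D σ σ' tr hσ he =>
      obtain ⟨tr', σ'', k1, -, -, k2⟩ := hpre D σ hσ
      -- Reachability refers to any run of the program; by determinism it is the one constructed, so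
      -- the invariant carries over.
      obtain ⟨-, rfl⟩ := k1.deterministic he
      exact k2
    | ins D σ σ' tr r t _ hr he ih =>
      obtain ⟨n, -, k⟩ := (alg.ins r).exec_run I (hsi r) (σ.loadTuple t)
      obtain ⟨-, rfl⟩ := k.deterministic he
      exact hins D σ ih r hr t
    | del D σ σ' tr r t _ hr he ih =>
      obtain ⟨n, -, k⟩ := (alg.del r).exec_run I (hsd r) (σ.loadTuple t)
      obtain ⟨-, rfl⟩ := k.deterministic he
      exact hdel D σ ih r hr t
    | enum D σ σ' tr _ he ih =>
      obtain ⟨tr', σ'', k1, k2, -⟩ := hE D σ ih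
      obtain ⟨-, rfl⟩ := k1.deterministic he
      rwa [k2]
  refine ⟨alg, C * c₀ + ∑ r, ((alg.ins r).cost + (alg.del r).cost) + cE, ?_, ?_, ?_⟩
  · intro D σ hσ
    obtain ⟨tr, σ', k1, k2, k3, -⟩ := hpre D σ hσ
    refine ⟨tr, σ', k1, k2.trans (mul_le_mul_of_nonneg_right ?_ k3)⟩
    exact_mod_cast (by omega)
  · intro D σ _ r _ t
    have hcost : (alg.ins r).cost + (alg.del r).cost ≤
        ∑ r, ((alg.ins r).cost + (alg.del r).cost) :=
      Finset.single_le_sum (f := fun r => (alg.ins r).cost + (alg.del r).cost)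
        (fun _ _ => Nat.zero_le _) (Finset.mem_univ r)
    obtain ⟨n, hn, k⟩ := (alg.ins r).exec_run I (hsi r) (σ.loadTuple t)
    obtain ⟨n', hn', k'⟩ := (alg.del r).exec_run I (hsd r) (σ.loadTuple t)
    refine ⟨⟨_, _, k, ?_⟩, ⟨_, _, k', ?_⟩⟩ <;>
    · rw [List.length_replicate]
      omega
  · intro D σ hr
    obtain ⟨tr, σ', k1, -, k2, k3, k4⟩ := hE D σ (hinv D σ hr)
    exact ⟨tr, σ', k1, k2, k3, fun s hs h => (k4 s hs h).trans (by omega)⟩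

end final

end DynCQ

theorem mainTheorem8 {Ω : Type} (I : Ω → ℕ → ℕ → ℕ) (S : DynCQ.Vocabulary) (Q : DynCQ.CQ S)
    (f : ℕ → ℝ)
    (h : ∃ T : DynCQ.Rewriting Q, T.IsSafe ∧ T.HasMaterialisationTime I f) :
    Q.CanBeEvaluated I f := by
  obtain ⟨T, hT, hm⟩ := h
  exact DynCQ.canBeEvaluated_of_isSafe hT hm
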